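/- **Setting.** Fix predicate symbols and function symbols with arities (constants are $0$-ary function symbols) and an arity-preserving involution $P\mapsto\overline P$ on predicate symbols with $\overline P\neq P$. Formulas of first-order multiplicative linear logic without units are built from atoms $P(t_1,\dots,t_n)$ by tensor $\otimes$, par $\wp$, $\forall x$, $\exists x$; negation is extended by $\overline{A\otimes B}=\overline A\wp \overline B$, $\overline{A\wp B}=\overline A\otimes\overline B$, $\overline{\exists xA}=\forall x\overline A$, $\overline{\forall xA}=\exists x\overline A$. A formula is identified with its parse tree, whose edges are directed from arguments to connectives and quantifiers; a *sequent* is a disjoint union of formulas. A *linking* on a sequent is a set of disjoint pairs (*links*) of leaves with dual predicate symbols whose union contains every leaf. After renaming bound variables apart, a *unifier* of a linking assigns terms, built from free and universally bound variables, to the non-vacuous existentially bound variables so that the argument sequences at the two ends of every link become equal. The *graph* of a unifiable linking is the parse forest together with an undirected edge for every link and a directed edge (*leap*) from $\exists x$ to $\forall y$ whenever the most general unifier assigns to $x$ a term containing $y$. A *switching* is obtained by deleting all but one of the edges into each $\wp $ and each $\forall$ and forgetting directions. A linking is *correct* if it is unifiable and all its switchings are trees. A *cut* is a disjoint union of dual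 formulas $A$, $\overline A$ with an edge between their roots; a *cut sequent* is a disjoint union of a sequent and finitely many cuts. The *encoding* of a cut sequent replaces each cut by $\exists x_1\cdots\exists x_n(A\otimes\overline A)$, where $x_1,\dots,x_n$ are the free variables of $A$, keeping the leaves. A *unification net* is a linking on a cut sequent which is correct on its encoding. A *cut reduction* is one of the following rewrites: - *atomic*: if a cut joins leaves $P\vec t$ and $\overline P\vec t$, which are linked to leaves $a$ and $d$ by two different links, delete the cut and both links, and link $a$ to $d$; - *multiplicative*: replace a cut between $\overline A\wp \overline B$ and $A\otimes B$ by a cut between $\overline A$ and $A$ and a cut between $\overline B$ and $B$; - *quantifier*: replace a cut between $\exists x\overline A$ and $\forall xA$ by a cut between $\overline A$ and $A$. The *size* of a net is the number of occurrences of predicate symbols, connectives, quantifiers, function symbols and variables (in terms) in the formulas of its cut sequent, both formulas of each cut included. A net is given to a machine as the word that lists these symbols in prefix order, formula by formula, each by a record of four numbers, the record of each leaf holding the position of the record of the leaf that it is linked to. The machine is a unit-cost random access machine whose only arithmetic is the addition and (truncated) subtraction of constants of the program. **Theorem (Linear time cut elimination).** There are a program $p$ of such a machine and a constant $C$, independent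 of the symbols, such that for every unification net $\theta$: 1. every sequence of cut reductions starting from $\theta$ has at most $\mathrm{size}(\theta)$ steps (so cut reduction is strongly normalizing); 2. cut reduction is confluent from $\theta$: if $\theta$ reduces to $\theta_1$ and to $\theta_2$, then $\theta_1$ and $\theta_2$ reduce to a common $\theta_3$; 3. $\theta$ reduces, by cut reductions, to a unification net $\theta'$ without cuts, and $p$ computes it in linear time: for every injective numbering of the predicate and function symbols of each arity, $p$, started on the word of $\theta$, halts after at most $C\cdot\mathrm{size}(\theta)$ units of time with the word of $\theta'$ as its output. -/

import Mathlib

universe u v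

namespace UnificationNet

/-- A duality on the predicate symbols of `L`: an involution without fixed points which preserves
arity. -/
structure Duality (L : FirstOrder.Language.{u, v}) where
  neg : ∀ {n : ℕ}, L.Relations n → L.Relations n
  neg_neg : ∀ {n : ℕ} (P : L.Relations n), neg (neg P) = P
  neg_ne : ∀ {n : ℕ} (P : L.Relations n), neg P ≠ P

/-- Formulas of first-order multiplicative linear logic without units, as parse trees. The variables
are natural numbers. Every leaf carries a name `l`, which identifies it as a vertex of the forest
that it belongs to. -/
inductive Fml (L : FirstOrder.Language.{u, v}) : Type (max u v)
  | atom (l : ℕ) {n : ℕ} (P : L.Relations n) (ts : Fin n → L.Term ℕ)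
  | tensor (A B : Fml L)
  | par (A B : Fml L)
  | all (x : ℕ) (A : Fml L)
  | ex (x : ℕ) (A : Fml L)

/-- `IsDual D A B`: up to the names of its leaves, `B` is the negation of `A`. -/
inductive IsDual {L : FirstOrder.Language.{u, v}} (D : Duality L) : Fml L → Fml L → Prop
  | atom (i j : ℕ) {n : ℕ} (P : L.Relations n) (ts : Fin n → L.Term ℕ) :
      IsDual D (.atom i P ts) (.atom j (D.neg P) ts)
  | tensor {A A' B B' : Fml L} :
      IsDual D A A' → IsDual D B B' → IsDual D (.tensor A B) (.par A' B')
  | par {A A' B B' : Fml L} :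
      IsDual D A A' → IsDual D B B' → IsDual D (.par A B) (.tensor A' B')
  | all (x : ℕ) {A A' : Fml L} : IsDual D A A' → IsDual D (.all x A) (.ex x A')
  | ex (x : ℕ) {A A' : Fml L} : IsDual D A A' → IsDual D (.ex x A) (.all x A')

/-- The free variables of a formula. -/
def Fml.freeVars {L : FirstOrder.Language.{u, v}} : Fml L → Finset ℕ
  | .atom _ _ ts => Finset.univ.biUnion fun k => (ts k).varFinset
  | .tensor A B => A.freeVars ∪ B.freeVars
  | .par A B => A.freeVars ∪ B.freeVars
  | .all x A => A.freeVars.erase x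
  | .ex x A => A.freeVars.erase x

/-- A (cut-free) sequent: a disjoint union of formulas, listed in some order. -/
abbrev Sequent (L : FirstOrder.Language.{u, v}) := List (Fml L)

/-! ### Vertices and variables of a sequent -/

/-- An address `(i, p)` points at a vertex of the `i`-th formula of a sequent: follow the path `p`
from the root (`false`: first or only argument, `true`: second argument). -/
abbrev Addr := ℕ × List Bool

/-- The subformula found by following a path from the root. -/
def Fml.sub {L : FirstOrder.Language.{u, v}} : Fml L → List Bool → Option (Fml L)
  | A, [] => some A
  | .tensor A _, false :: p => A.sub p
  | .tensor _ B, true :: p => B.sub p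
  | .par A _, false :: p => A.sub p
  | .par _ B, true :: p => B.sub p
  | .all _ A, false :: p => A.sub p
  | .ex _ A, false :: p => A.sub p
  | _, _ => none

/-- The subformula of `Γ` rooted at the address `a`, if `a` is the address of a vertex. -/
def subAt {L : FirstOrder.Language.{u, v}} (Γ : Sequent L) (a : Addr) : Option (Fml L) :=
  Γ[a.1]?.bind fun A => A.sub a.2

/-- The vertices of the labelled forest `Γ`. -/
def Vertex {L : FirstOrder.Language.{u, v}} (Γ : Sequent L) : Type :=
  {a : Addr // (subAt Γ a).isSome = true}

/-- The variables of a sequent after bound variables have been renamed apart, so that the sequent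
is clean: `inl x` is the free variable `x`, and `inr a` is the variable bound by the quantifier
with address `a`. -/
abbrev Var := ℕ ⊕ Addr

/-- A leaf with its name, its predicate symbol, and its terms, in clean form. -/
structure Leaf (L : FirstOrder.Language.{u, v}) where
  name : ℕ
  arity : ℕ
  pred : L.Relations arity
  args : Fin arity → L.Term Var

/-- The leaves, from left to right, of a formula whose root has address `(i, p)` and whose
variables `x` denote `e x`. -/
def Fml.leaves {L : FirstOrder.Language.{u, v}} (i : ℕ) : Fml L → List Bool → (ℕ → Var) → List (Leaf L)
  | .atom l (n := n) P ts, _, e => [⟨l, n, P, fun k => (ts k).relabel e⟩]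
  | .tensor A B, p, e => A.leaves i (p ++ [false]) e ++ B.leaves i (p ++ [true]) e
  | .par A B, p, e => A.leaves i (p ++ [false]) e ++ B.leaves i (p ++ [true]) e
  | .all x A, p, e => A.leaves i (p ++ [false]) (Function.update e x (Sum.inr (i, p)))
  | .ex x A, p, e => A.leaves i (p ++ [false]) (Function.update e x (Sum.inr (i, p)))

/-- The leaves of a sequent, in clean form. -/
def leaves {L : FirstOrder.Language.{u, v}} (Γ : Sequent L) : List (Leaf L) :=
  Γ.zipIdx.flatMap fun Ai => Ai.1.leaves Ai.2 [] Sum.inl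

/-! ### Linkings and unifiers -/

/-- Two leaves have dual predicate symbols. -/
inductive DualLeaves {L : FirstOrder.Language.{u, v}} (D : Duality L) : Leaf L → Leaf L → Prop
  | mk (l m : ℕ) {n : ℕ} (P : L.Relations n) (ts us : Fin n → L.Term Var) :
      DualLeaves D ⟨l, n, P, ts⟩ ⟨m, n, D.neg P, us⟩

/-- `Λ` is a linking on `Γ`: a set of disjoint pairs of leaves with dual predicate symbols whose
union contains every leaf. Leaves are given by their names, which must be distinct. -/
def IsLinking {L : FirstOrder.Language.{u, v}} (D : Duality L) (Γ : Sequent L) (Λ : Finset (Sym2 ℕ)) : Prop :=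
  ((leaves Γ).map Leaf.name).Nodup ∧
  (∀ e ∈ Λ, ∃ o ∈ leaves Γ, ∃ o' ∈ leaves Γ, DualLeaves D o o' ∧ e = s(o.name, o'.name)) ∧
  (∀ o ∈ leaves Γ, ∃! e, e ∈ Λ ∧ o.name ∈ e)

/-- `x` is (the variable of) a non-vacuous existential quantifier of `Γ`. -/
def IsExVar {L : FirstOrder.Language.{u, v}} (Γ : Sequent L) (x : Addr) : Prop :=
  (∃ z A, subAt Γ x = some (.ex z A)) ∧
  ∃ o ∈ leaves Γ, ∃ k, Sum.inr x ∈ (o.args k).varFinset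

/-- `y` is (the variable of) a universal quantifier of `Γ`. -/
def IsAllVar {L : FirstOrder.Language.{u, v}} (Γ : Sequent L) (y : Addr) : Prop :=
  ∃ z A, subAt Γ y = some (.all z A)

/-- `σ` is a unifier: it assigns terms over free and universal variables to the non-vacuous
existential variables, fixes all other variables, and equalizes the term sequences at the two ends
of every link. -/
def IsUnifier {L : FirstOrder.Language.{u, v}} (Γ : Sequent L) (Λ : Finset (Sym2 ℕ)) (σ : Var → L.Term Var) :
    Prop :=
  (∀ z : ℕ, σ (Sum.inl z) = .var (Sum.inl z)) ∧
  (∀ a : Addr, ¬ IsExVar Γ a → σ (Sum.inr a) = .var (Sum.inr a)) ∧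
  (∀ x : Addr, IsExVar Γ x → ∀ y : Addr, Sum.inr y ∈ (σ (Sum.inr x)).varFinset → IsAllVar Γ y) ∧
  (∀ o ∈ leaves Γ, ∀ o' ∈ leaves Γ, s(o.name, o'.name) ∈ Λ →
    (List.ofFn fun k => (o.args k).subst σ) = List.ofFn fun k => (o'.args k).subst σ)

/-- `σ` is a most general unifier: every unifier arises from it by substituting terms for free
variables. -/
def IsMGU {L : FirstOrder.Language.{u, v}} (Γ : Sequent L) (Λ : Finset (Sym2 ℕ)) (σ : Var → L.Term Var) :
    Prop :=
  IsUnifier Γ Λ σ ∧ ∀ τ, IsUnifier Γ Λ τ → ∃ ρ : ℕ → L.Term Var, ∀ x, IsExVar Γ x →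
    τ (Sum.inr x) = (σ (Sum.inr x)).subst (Sum.elim ρ fun a => .var (Sum.inr a))

/-- The most general unifier assigns to the existential variable of `x` a term that contains the
universal variable of `y`. -/
def Precedes {L : FirstOrder.Language.{u, v}} (Γ : Sequent L) (Λ : Finset (Sym2 ℕ)) (x y : Addr) : Prop :=
  IsExVar Γ x ∧ IsAllVar Γ y ∧ ∃ σ, IsMGU Γ Λ σ ∧ Sum.inr y ∈ (σ (Sum.inr x)).varFinset

/-! ### The graph of a linking, switchings, correctness -/

/-- A directed edge of the graph of a linking: from an argument to its connective or quantifier, or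
a leap. -/
def Arc {L : FirstOrder.Language.{u, v}} (Γ : Sequent L) (Λ : Finset (Sym2 ℕ)) (a b : Vertex Γ) : Prop :=
  (a.1.1 = b.1.1 ∧ ∃ d, a.1.2 = b.1.2 ++ [d]) ∨ Precedes Γ Λ a.1 b.1

/-- An undirected edge of the graph of a linking, between the leaves of a link. -/
def Linked {L : FirstOrder.Language.{u, v}} (Γ : Sequent L) (Λ : Finset (Sym2 ℕ)) (a b : Vertex Γ) : Prop :=
  ∃ (l m : ℕ) (n n' : ℕ) (P : L.Relations n) (Q : L.Relations n')
    (ts : Fin n → L.Term ℕ) (us : Fin n' → L.Term ℕ),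
    subAt Γ a.1 = some (.atom l P ts) ∧ subAt Γ b.1 = some (.atom m Q us) ∧ s(l, m) ∈ Λ

/-- The vertices labelled by a par or a universal quantifier. -/
def IsSwitched {L : FirstOrder.Language.{u, v}} (Γ : Sequent L) (b : Vertex Γ) : Prop :=
  (∃ A B, subAt Γ b.1 = some (.par A B)) ∨ ∃ x A, subAt Γ b.1 = some (.all x A)

/-- `w` selects an edge into each par and universal quantifier, by its source. -/
def IsSwitching {L : FirstOrder.Language.{u, v}} (Γ : Sequent L) (Λ : Finset (Sym2 ℕ))
    (w : Vertex Γ → Vertex Γ) : Prop :=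
  ∀ b, IsSwitched Γ b → Arc Γ Λ (w b) b

/-- The directed edges that survive in the switching `w`. -/
def Kept {L : FirstOrder.Language.{u, v}} (Γ : Sequent L) (Λ : Finset (Sym2 ℕ))
    (w : Vertex Γ → Vertex Γ) (a b : Vertex Γ) : Prop :=
  Arc Γ Λ a b ∧ (IsSwitched Γ b → w b = a)

/-- The undirected graph of the switching `w`. -/
def switchGraph {L : FirstOrder.Language.{u, v}} (Γ : Sequent L) (Λ : Finset (Sym2 ℕ))
    (w : Vertex Γ → Vertex Γ) : SimpleGraph (Vertex Γ) :=
  SimpleGraph.fromRel fun a b => Linked Γ Λ a b ∨ Kept Γ Λ w a b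

/-- A linking on a sequent is correct if it is unifiable and all its switchings are trees. Two
parallel edges of a switching (an argument edge from `b` to `a` and a leap from `a` to `b`) form a
cycle; since a simple graph does not see it, this case is excluded separately. -/
def IsCorrect {L : FirstOrder.Language.{u, v}} (Γ : Sequent L) (Λ : Finset (Sym2 ℕ)) : Prop :=
  (∃ σ, IsUnifier Γ Λ σ) ∧
  ∀ w, IsSwitching Γ Λ w →
    (switchGraph Γ Λ w).IsTree ∧ ∀ a b, ¬ (Kept Γ Λ w a b ∧ Kept Γ Λ w b a)

/-! ### Cuts -/

/-- A set of links on a cut sequent. The cut sequent is the disjoint union of the formulas `concl`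
and of the cuts `cuts`; a cut is a pair of formulas, joined by a cut edge between their roots. -/
structure Net (L : FirstOrder.Language.{u, v}) where
  concl : List (Fml L)
  cuts : List (Fml L × Fml L)
  links : Finset (Sym2 ℕ)

/-- The encoding `∃ x₁ … ∃ xₙ (A ⊗ A')` of a cut between `A` and `A'`, where the `xᵢ` are the
free variables of `A`. -/
def encodeCut {L : FirstOrder.Language.{u, v}} (c : Fml L × Fml L) : Fml L :=
  (c.1.freeVars.sort (· ≤ ·)).foldr Fml.ex (.tensor c.1 c.2)

/-- The encoding of the cut sequent of a net as a sequent without cuts, with the same leaves. -/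
def Net.encode {L : FirstOrder.Language.{u, v}} (θ : Net L) : Sequent L :=
  θ.concl ++ θ.cuts.map encodeCut

/-- `θ` is a unification net: its cuts are between dual formulas, and its links form a linking which
is correct on the encoding of its cut sequent. -/
def Net.IsUnet {L : FirstOrder.Language.{u, v}} (D : Duality L) (θ : Net L) : Prop :=
  (∀ c ∈ θ.cuts, IsDual D c.1 c.2) ∧ IsLinking D θ.encode θ.links ∧ IsCorrect θ.encode θ.links

def Net.CutFree {L : FirstOrder.Language.{u, v}} (θ : Net L) : Prop := θ.cuts = []

/-- One cut reduction: atomic, multiplicative or quantifier. -/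
inductive Step {L : FirstOrder.Language.{u, v}} (D : Duality L) : Net L → Net L → Prop
  | atomic (Γ : List (Fml L)) (pre post : List (Fml L × Fml L)) (Λ : Finset (Sym2 ℕ))
      (a i j d : ℕ) {n : ℕ} (P : L.Relations n) (ts : Fin n → L.Term ℕ) :
      s(a, i) ∈ Λ → s(j, d) ∈ Λ → s(a, i) ≠ s(j, d) →
      Step D ⟨Γ, pre ++ (.atom i P ts, .atom j (D.neg P) ts) :: post, Λ⟩
        ⟨Γ, pre ++ post, insert s(a, d) ((Λ.erase s(a, i)).erase s(j, d))⟩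
  | tensorPar (Γ : List (Fml L)) (pre post : List (Fml L × Fml L)) (Λ : Finset (Sym2 ℕ))
      (A B A' B' : Fml L) :
      Step D ⟨Γ, pre ++ (.tensor A B, .par A' B') :: post, Λ⟩
        ⟨Γ, pre ++ (A, A') :: (B, B') :: post, Λ⟩
  | parTensor (Γ : List (Fml L)) (pre post : List (Fml L × Fml L)) (Λ : Finset (Sym2 ℕ))
      (A B A' B' : Fml L) :
      Step D ⟨Γ, pre ++ (.par A B, .tensor A' B') :: post, Λ⟩
        ⟨Γ, pre ++ (A, A') :: (B, B') :: post, Λ⟩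
  | exAll (Γ : List (Fml L)) (pre post : List (Fml L × Fml L)) (Λ : Finset (Sym2 ℕ))
      (x : ℕ) (A A' : Fml L) :
      Step D ⟨Γ, pre ++ (.ex x A, .all x A') :: post, Λ⟩ ⟨Γ, pre ++ (A, A') :: post, Λ⟩
  | allEx (Γ : List (Fml L)) (pre post : List (Fml L × Fml L)) (Λ : Finset (Sym2 ℕ))
      (x : ℕ) (A A' : Fml L) :
      Step D ⟨Γ, pre ++ (.all x A, .ex x A') :: post, Λ⟩ ⟨Γ, pre ++ (A, A') :: post, Λ⟩

/-- Zero or more cut reductions. -/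
def Reduces {L : FirstOrder.Language.{u, v}} (D : Duality L) : Net L → Net L → Prop :=
  Relation.ReflTransGen (Step D)

/-! ### Size -/

/-- The number of occurrences of variables and function symbols in a term. -/
def termSize {L : FirstOrder.Language.{u, v}} : L.Term ℕ → ℕ
  | .var _ => 1
  | .func _ ts => 1 + ∑ k, termSize (ts k)

/-- The number of occurrences of predicate symbols, connectives, quantifiers, variables (in terms)
and function symbols. -/
def Fml.size {L : FirstOrder.Language.{u, v}} : Fml L → ℕ
  | .atom _ _ ts => 1 + ∑ k, termSize (ts k)
  | .tensor A B => 1 + A.size + B.size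
  | .par A B => 1 + A.size + B.size
  | .all _ A => 1 + A.size
  | .ex _ A => 1 + A.size

def Net.size {L : FirstOrder.Language.{u, v}} (θ : Net L) : ℕ :=
  (θ.concl.map Fml.size).sum + (θ.cuts.map fun c => c.1.size + c.2.size).sum

/-! ### Nets as words

A net is written as a sequence of records of four numbers each, formulas and terms being written in
prefix order. The first number of a record is a tag: `0` end of the word, `1` tensor, `2` par,
`3` universal quantifier, `4` existential quantifier, `5` leaf, `6` variable, `7` function symbol,
`8` start of a formula, `9` start of the first formula of a cut, `10` start of the second formula of
a cut. The last number of the record of a leaf is a pointer: the position, in the word, of the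
record of the leaf that it is linked to. -/

/-- A numbering of the function and predicate symbols of each arity. -/
structure Numbering (L : FirstOrder.Language.{u, v}) where
  func : ∀ n : ℕ, L.Functions n → ℕ
  rel : ∀ n : ℕ, L.Relations n → ℕ
  func_injective : ∀ n, Function.Injective (func n)
  rel_injective : ∀ n, Function.Injective (rel n)

/-- A record. Its last component is the name of the leaf that the record stands for, if any. -/
abbrev Record := ℕ × ℕ × ℕ × Option ℕ

def termRecords {L : FirstOrder.Language.{u, v}} (ν : Numbering L) : L.Term ℕ → List Record
  | .var x => [(6, x, 0, none)]
  | .func (l := n) f ts =>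
      (7, ν.func n f, n, none) :: (List.ofFn fun k => termRecords ν (ts k)).flatten

def Fml.records {L : FirstOrder.Language.{u, v}} (ν : Numbering L) : Fml L → List Record
  | .atom l (n := n) P ts =>
      (5, ν.rel n P, n, some l) :: (List.ofFn fun k => termRecords ν (ts k)).flatten
  | .tensor A B => (1, 0, 0, none) :: (A.records ν ++ B.records ν)
  | .par A B => (2, 0, 0, none) :: (A.records ν ++ B.records ν)
  | .all x A => (3, x, 0, none) :: A.records ν
  | .ex x A => (4, x, 0, none) :: A.records ν

def Net.records {L : FirstOrder.Language.{u, v}} (ν : Numbering L) (θ : Net L) : List Record :=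
  (θ.concl.flatMap fun A => (8, 0, 0, none) :: A.records ν) ++
  (θ.cuts.flatMap fun c =>
    (9, 0, 0, none) :: c.1.records ν ++ (10, 0, 0, none) :: c.2.records ν) ++
  [(0, 0, 0, none)]

/-- The name of the leaf to which the leaf with name `l` is linked. -/
noncomputable def Net.partner {L : FirstOrder.Language.{u, v}} (θ : Net L) (l : ℕ) : ℕ :=
  Classical.epsilon fun m => s(l, m) ∈ θ.links

/-- The position in the word of `θ` of the record of the leaf with name `l`. -/
def Net.position {L : FirstOrder.Language.{u, v}} (ν : Numbering L) (θ : Net L) (l : ℕ) : ℕ :=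
  4 * (θ.records ν).findIdx fun r => decide (r.2.2.2 = some l)

/-- The word of a net. -/
noncomputable def Net.word {L : FirstOrder.Language.{u, v}} (ν : Numbering L) (θ : Net L) : List ℕ :=
  (θ.records ν).flatMap fun r =>
    [r.1, r.2.1, r.2.2.1, r.2.2.2.elim 0 fun l => θ.position ν (θ.partner l)]

/-! ### Random access machines

Programs of a random access machine with unbounded indirectly addressable memory. Its arithmetic
consists of adding or subtracting a constant of the program, so that a number can grow by at
most a constant in one unit of time. -/

structure Ram where
  reg : ℕ → ℕ
  mem : ℕ → ℕ

inductive Cond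
  | eq (r s : ℕ)
  | ne (r s : ℕ)
  | lt (r s : ℕ)

def Cond.Holds (m : Ram) : Cond → Prop
  | .eq r s => m.reg r = m.reg s
  | .ne r s => m.reg r ≠ m.reg s
  | .lt r s => m.reg r < m.reg s

inductive Prog
  | const (r k : ℕ)
  | plus (r s k : ℕ)
  | minus (r s k : ℕ)
  | load (r s : ℕ)
  | store (r s : ℕ)
  | seq (p q : Prog)
  | cond (b : Cond) (p q : Prog)
  | loop (b : Cond) (p : Prog)

def Ram.setReg (m : Ram) (r k : ℕ) : Ram := ⟨Function.update m.reg r k, m.mem⟩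

def Ram.setMem (m : Ram) (a k : ℕ) : Ram := ⟨m.reg, Function.update m.mem a k⟩

/-- `Runs p m t m'`: started in the state `m`, the program `p` halts in the state `m'` after exactly
`t` units of time. Each elementary operation and each evaluation of a condition takes one unit. -/
inductive Runs : Prog → Ram → ℕ → Ram → Prop
  | const (r k : ℕ) (m : Ram) : Runs (.const r k) m 1 (m.setReg r k)
  | plus (r s k : ℕ) (m : Ram) : Runs (.plus r s k) m 1 (m.setReg r (m.reg s + k))
  | minus (r s k : ℕ) (m : Ram) : Runs (.minus r s k) m 1 (m.setReg r (m.reg s - k))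
  | load (r s : ℕ) (m : Ram) : Runs (.load r s) m 1 (m.setReg r (m.mem (m.reg s)))
  | store (r s : ℕ) (m : Ram) : Runs (.store r s) m 1 (m.setMem (m.reg r) (m.reg s))
  | seq {p q : Prog} {m m' m'' : Ram} {t t' : ℕ} :
      Runs p m t m' → Runs q m' t' m'' → Runs (.seq p q) m (t + t') m''
  | cond_true {b : Cond} {p q : Prog} {m m' : Ram} {t : ℕ} :
      b.Holds m → Runs p m t m' → Runs (.cond b p q) m (t + 1) m'
  | cond_false {b : Cond} {p q : Prog} {m m' : Ram} {t : ℕ} :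
      ¬ b.Holds m → Runs q m t m' → Runs (.cond b p q) m (t + 1) m'
  | loop_true {b : Cond} {p : Prog} {m m' m'' : Ram} {t t' : ℕ} :
      b.Holds m → Runs p m t m' → Runs (.loop b p) m' t' m'' →
      Runs (.loop b p) m (t + t' + 1) m''
  | loop_false {b : Cond} {p : Prog} {m : Ram} :
      ¬ b.Holds m → Runs (.loop b p) m 1 m

/-- The initial state on the input `w`: the word `w` followed by zeros in memory, and zeros in all
registers. -/
def Ram.init (w : List ℕ) : Ram := ⟨fun _ => 0, fun a => w.getD a 0⟩

/-- The memory starts with the word `w`. -/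
def Ram.Output (m : Ram) (w : List ℕ) : Prop := ∀ a, a < w.length → m.mem a = w.getD a 0

end UnificationNet

open UnificationNet

namespace UnificationNet

open FirstOrder.Language (Term)
open Relation (EqvGen)

variable {L : FirstOrder.Language.{u, v}}

/-! ### Occurrences of variables in terms -/

/-! Termination is immediate, since every reduction removes symbols. Everything else rests on two
facts: cut reduction preserves unification nets (`Step.isUnet`), and a net with a cut is never
stuck.

Preservation splits correctness into connectedness and a count. Charge a leaf 1, a tensor -2 and
every other vertex 0. Counting edges at their targets shows that for every switching twice the
number of vertices minus twice the number of edges, parallel edges included, is the total charge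
(`balance_eq`), which does not depend on the switching. So a connected switching is a tree without
parallel edges as soon as the total is 2, and every reduction preserves the total. Only unifiability
and connectedness remain to be carried through a reduction (`isUnet_of_gconnected`).

For this the tensor and the quantifiers that encode a cut are contracted to one hub, and vertices
are identified with subformulas, which keep their identity when addresses change. In a net the
chosen edge into a par or universal quantifier P is a bridge: without it, all possible sources of
edges into P lie together on the side away from P (`GSwitching.conn_of_arc`). If P is cut against T,
the children of P are thus on one side, and the hub and T on the other. The new cuts join the
children of T to those of P and so reconnect the two sides (`GReduction.connected`). On the level of
unifiers, the multiplicative reduction only drops identifications of variables. The quantifier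
reduction substitutes the term of the existential variable for the universal one, so that a new leap
is at worst the composite of a leap into P and a leap out of T. The atomic reduction composes two
equations and replaces a path by an edge.

Leaps refer to a most general unifier. It is obtained without a unification algorithm, as the least
general generalization of all unifiers (`exists_isMGU`). Hence x leaps to y exactly if every unifier
puts y into the term of x (`precedes_iff`), a property that is easily transported between
unification problems.

For confluence, different cuts reduce independently. Two atomic reductions contract different pairs
of points of a matching, which commutes (`contract_comm`), and the leaves of an atomic cut are not
linked to each other, because they would form a triangle with the tensor of the encoding
(`Net.IsUnet.not_linked`). The resulting diamond property makes the cut-free reduct unique.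

The machine uses that dual formulas have records of the same shape. Two pointers move through both
formulas of a cut in lockstep and simulate its complete reduction; only at leaves is there work,
namely two pointer updates (`Walk.cut`). The conclusions come first in the word, so positions in
them remain valid, and an end mark behind them yields the word of the reduct. -/

/-- The variable `v` occurs in a term. -/
def Occ {α : Type*} (v : α) : L.Term α → Prop
  | .var w => w = v
  | .func _ ts => ∃ k, Occ v (ts k)

theorem occ_var {α : Type*} {v w : α} : Occ (L := L) v (.var w) ↔ w = v := Iff.rfl

/-- `Occ` asks for no decidable equality, so it also serves for variables in `GVar`; this is the
bridge to the `varFinset` of the definitions. -/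
theorem mem_varFinset {α : Type*} [DecidableEq α] {v : α} (t : L.Term α) :
    v ∈ t.varFinset ↔ Occ v t := by
  induction t with
  | var w => simp [Term.varFinset, Occ, eq_comm]
  | func f ts ih => simp [Term.varFinset, Occ, ih]

theorem subst_congr {α β : Type*} {σ τ : α → L.Term β} (t : L.Term α)
    (h : ∀ v, Occ v t → σ v = τ v) : t.subst σ = t.subst τ := by
  induction t with
  | var w => exact h w rfl
  | func f ts ih =>
    simp only [Term.subst]
    congr 1
    funext k
    exact ih k fun v hv => h v ⟨k, hv⟩

theorem subst_subst {α β γ : Type*} (σ : α → L.Term β) (τ : β → L.Term γ) (t : L.Term α) :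
    (t.subst σ).subst τ = t.subst fun v => (σ v).subst τ := by
  induction t with
  | var w => rfl
  | func f ts ih => simp [Term.subst, ih]

theorem relabel_eq_subst {α β : Type*} (f : α → β) (t : L.Term α) :
    t.relabel f = t.subst fun v => .var (f v) := by
  induction t with
  | var w => rfl
  | func g ts ih => simp [Term.subst, Term.relabel, ih]

theorem subst_var {α : Type*} (t : L.Term α) : t.subst (fun v => .var v) = t := by
  induction t with
  | var w => rfl
  | func g ts ih => simp [Term.subst, ih]

theorem occ_subst {α β : Type*} {v : β} (σ : α → L.Term β) (t : L.Term α) :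
    Occ v (t.subst σ) ↔ ∃ w, Occ w t ∧ Occ v (σ w) := by
  induction t with
  | var w => simp [Term.subst, Occ]
  | func g ts ih =>
    simp only [Term.subst, Occ, ih]
    exact ⟨fun ⟨k, w, h, h'⟩ => ⟨w, ⟨k, h⟩, h'⟩, fun ⟨w, ⟨k, h⟩, h'⟩ => ⟨k, w, h, h'⟩⟩

theorem occ_relabel {α β : Type*} {v : β} (f : α → β) (t : L.Term α) :
    Occ v (t.relabel f) ↔ ∃ w, Occ w t ∧ f w = v := by
  rw [relabel_eq_subst, occ_subst]
  rfl

/-! ### Most general unifiers -/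

/-- The least general generalization of the family of terms `g`, the first argument being a member
of this family. The variables that it introduces are named by `code`. -/
noncomputable def lgg {U : Type*} (code : (U → L.Term Var) → ℕ) :
    L.Term Var → (U → L.Term Var) → L.Term Var
  | .var _, g =>
      open Classical in
      -- A bound variable survives only if the whole family consists of it. Any other family becomes
      -- a free variable named after the family, so that equal families receive the same variable.
      if h : ∃ a : Addr, ∀ τ, g τ = .var (Sum.inr a) then .var (Sum.inr h.choose)
      else .var (Sum.inl (code g))
  | .func (l := n) f ts, g =>
      open Classical in
      if h : ∃ gs : Fin n → U → L.Term Var, ∀ τ, g τ = .func f fun k => gs k τ then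
        .func f fun k => lgg code (ts k) (h.choose k)
      else .var (Sum.inl (code g))

/-- The families of terms which a least general generalization replaces by variables. -/
inductive LggCut {U : Type*} : L.Term Var → (U → L.Term Var) → (U → L.Term Var) → Prop
  | here (t : L.Term Var) (g : U → L.Term Var) : LggCut t g g
  | func {n : ℕ} (f : L.Functions n) (ts : Fin n → L.Term Var) (gs : Fin n → U → L.Term Var)
      (k : Fin n) (g : U → L.Term Var) :
      LggCut (ts k) (gs k) g → LggCut (.func f ts) (fun τ => .func f fun k => gs k τ) g

theorem func_injective {α : Type*} {n : ℕ} {f : L.Functions n} {ts us : Fin n → L.Term α}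
    (h : Term.func f ts = Term.func f us) : ts = us := by
  injection h with _ _ h

/-- A family that is cut off sits at a position of the fixed term `t`, which has finitely many
positions. Hence finitely many codes have to be kept apart. -/
theorem lggCut_finite {U : Type*} (t : L.Term Var) (g : U → L.Term Var) :
    {g' | LggCut t g g'}.Finite := by
  induction t generalizing g with
  | var w =>
    refine (Set.finite_singleton g).subset ?_
    rintro g' h
    cases h
    rfl
  | @func n f ts ih =>
    by_cases h : ∃ gs : Fin n → U → L.Term Var, g = fun τ => .func f fun k => gs k τ
    · obtain ⟨gs, rfl⟩ := h
      refine ((Set.finite_singleton (fun τ => Term.func f fun k => gs k τ)).union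
        (Set.finite_iUnion fun k => ih k (gs k))).subset ?_
      rintro g' h
      generalize hg : (fun τ => Term.func f fun k => gs k τ) = g0 at h
      generalize ht : Term.func f ts = t0 at h
      cases h with
      | here => exact Or.inl rfl
      | @func m f' ts' gs' k _ h =>
        right
        cases ht
        have : gs = gs' := by
          funext k τ
          exact congrFun (func_injective (congrFun hg τ)) k
        subst this
        exact Set.mem_iUnion.2 ⟨k, h⟩
    · refine (Set.finite_singleton g).subset ?_
      rintro g' h'
      cases h' with
      | here => rfl
      | func f ts gs k g h' => exact absurd ⟨gs, rfl⟩ h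

/-- Every member of a family of terms is an instance of the least general generalization. -/
theorem lgg_subst {U : Type*} (code : (U → L.Term Var) → ℕ) (τ : U) (ρ : ℕ → L.Term Var)
    (t : L.Term Var) (g : U → L.Term Var) (hρ : ∀ g', LggCut t g g' → ρ (code g') = g' τ) :
    (lgg code t g).subst (Sum.elim ρ fun a => .var (Sum.inr a)) = g τ := by
  induction t generalizing g with
  | var w =>
    rw [lgg]
    split_ifs with h
    · simp [Term.subst, ← h.choose_spec τ]
    · simp [Term.subst, hρ g (.here _ _)]
  | func f ts ih =>
    rw [lgg]
    split_ifs with h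
    · rw [h.choose_spec τ]
      simp only [Term.subst]
      congr 1
      funext k
      refine ih k _ fun g' hg' => hρ g' ?_
      have := LggCut.func f ts h.choose k g' hg'
      rwa [← funext h.choose_spec] at this
    · simp [Term.subst, hρ g (.here _ _)]

/-- The components of a family with a common head symbol are determined by it, so the decomposition
picked by choice is the given one. -/
theorem lgg_func {U : Type*} (code : (U → L.Term Var) → ℕ) (τ₀ : U) {n : ℕ} (f : L.Functions n)
    (gs : Fin n → U → L.Term Var) :
    lgg code (.func f fun k => gs k τ₀) (fun τ => .func f fun k => gs k τ) =
      .func f fun k => lgg code (gs k τ₀) (gs k) := by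
  rw [lgg]
  have h : ∃ gs' : Fin n → U → L.Term Var,
      ∀ τ : U, (Term.func f fun k => gs k τ) = .func f fun k => gs' k τ := ⟨gs, fun _ => rfl⟩
  rw [dif_pos h]
  have : h.choose = gs := by
    funext k τ
    exact (congrFun (func_injective (h.choose_spec τ)) k).symm
  rw [this]

/-- Generalizing only forgets structure and creates no occurrence of a bound variable. This keeps
the general unifier within the permitted range. -/
theorem occ_lgg_inr {U : Type*} (code : (U → L.Term Var) → ℕ) (τ : U) (y : Addr) (t : L.Term Var)
    (g : U → L.Term Var) (h : Occ (Sum.inr y) (lgg code t g)) : Occ (Sum.inr y) (g τ) := by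
  induction t generalizing g with
  | var w =>
    rw [lgg] at h
    split_ifs at h with h'
    · rwa [h'.choose_spec τ]
    · cases h
  | func f ts ih =>
    rw [lgg] at h
    split_ifs at h with h'
    · obtain ⟨k, hk⟩ := h
      rw [h'.choose_spec τ]
      exact ⟨k, ih k _ hk⟩
    · cases h

/-- Generalization commutes with substitution. -/
theorem lgg_of_subst {U : Type*} (code : (U → L.Term Var) → ℕ) (τ₀ : U) (s : U → Var → L.Term Var)
    (σ : Var → L.Term Var) (t : L.Term Var)
    (hσ : ∀ v, Occ v t → σ v = lgg code (s τ₀ v) fun τ => s τ v) :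
    t.subst σ = lgg code (t.subst (s τ₀)) fun τ => t.subst (s τ) := by
  induction t with
  | var w => exact hσ w rfl
  | func f ts ih =>
    simp only [Term.subst]
    rw [lgg_func code τ₀ f fun k τ => (ts k).subst (s τ)]
    congr 1
    funext k
    exact ih k fun v hv => hσ v ⟨k, hv⟩

/-- Reduces equations between argument sequences to equations between terms; one index `τ` is needed
to know that the two sequences have the same length. -/
theorem map_eq_map_of_forall {U α β γ : Type*} [Nonempty U] {f : U → α → β} {h : α → γ}
    {as bs : List α} (hf : ∀ τ, as.map (f τ) = bs.map (f τ))
    (hh : ∀ a ∈ as, ∀ b ∈ bs, (∀ τ, f τ a = f τ b) → h a = h b) : as.map h = bs.map h := by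
  induction as generalizing bs with
  | nil =>
    obtain ⟨τ⟩ := ‹Nonempty U›
    cases bs with
    | nil => rfl
    | cons b bs => cases hf τ
  | cons a as ih =>
    cases bs with
    | nil =>
      obtain ⟨τ⟩ := ‹Nonempty U›
      cases hf τ
    | cons b bs =>
      simp only [List.map_cons, List.cons.injEq] at hf ⊢
      exact ⟨hh a (by simp) b (by simp) fun τ => (hf τ).1,
        ih (fun τ => (hf τ).2) fun a ha b hb => hh a (by simp [ha]) b (by simp [hb])⟩

/-- The terms of a leaf. -/
def Leaf.terms (o : Leaf L) : List (L.Term Var) := List.ofFn o.args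

theorem Leaf.ofFn_subst (o : Leaf L) (σ : Var → L.Term Var) :
    (List.ofFn fun k => (o.args k).subst σ) = o.terms.map fun t => t.subst σ := by
  rw [Leaf.terms, List.map_ofFn]
  rfl

/-- The generalization of a free variable `z` has to be `z` itself, so its constant family gets the
code `z`. The remaining families are numbered above these codes. -/
theorem exists_code {F : Type*} (c : ℕ → F) (hc : Function.Injective c) {S : Set F}
    (hS : S.Finite) {Z : Set ℕ} (hZ : Z.Finite) :
    ∃ code : F → ℕ, Set.InjOn code S ∧ ∀ z ∈ Z, code (c z) = z := by
  classical
  obtain ⟨e, he⟩ := Set.countable_iff_exists_injOn.1 hS.countable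
  obtain ⟨N, hN⟩ := hZ.bddAbove
  refine ⟨fun g => if h : ∃ z ∈ Z, g = c z then h.choose else N + 1 + e g, ?_, ?_⟩
  · intro g hg g' hg' h
    dsimp only at h
    split_ifs at h with h1 h2 h2
    · rw [h1.choose_spec.2, h2.choose_spec.2, h]
    · have := hN h1.choose_spec.1
      omega
    · have := hN h2.choose_spec.1
      omega
    · exact he hg hg' (by omega)
  · intro z hz
    have h : ∃ z' ∈ Z, c z = c z' := ⟨z, hz, rfl⟩
    dsimp only
    rw [dif_pos h]
    exact (hc h.choose_spec.2).symm

/-- The variable `v` occurs in a leaf of `Γ`. -/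
def Occurs (Γ : Sequent L) (v : Var) : Prop := ∃ o ∈ leaves Γ, ∃ k, Occ v (o.args k)

theorem occurs_finite (Γ : Sequent L) : {v | Occurs Γ v}.Finite := by
  have : {v | Occurs Γ v} = ⋃ o ∈ {o | o ∈ leaves Γ}, ⋃ k, {v | Occ v (o.args k)} := by
    ext v
    simp [Occurs]
  rw [this]
  refine (List.finite_toSet _).biUnion fun o _ => Set.finite_iUnion fun k => ?_
  have : {v | Occ v (o.args k)} = (o.args k).varFinset := by
    ext v
    simp [mem_varFinset]
  rw [this]
  exact Finset.finite_toSet _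

theorem isExVar_iff {Γ : Sequent L} {x : Addr} :
    IsExVar Γ x ↔ (∃ z A, subAt Γ x = some (.ex z A)) ∧ Occurs Γ (Sum.inr x) := by
  simp [IsExVar, Occurs, mem_varFinset]

/-- A unifiable linking has a most general unifier. -/
theorem exists_isMGU {Γ : Sequent L} {Λ : Finset (Sym2 ℕ)} (h : ∃ σ, IsUnifier Γ Λ σ) :
    ∃ σ, IsMGU Γ Λ σ := by
  classical
  obtain ⟨τ₀, hτ₀⟩ := h
  let U := {τ // IsUnifier Γ Λ τ}
  let t₀ : U := ⟨τ₀, hτ₀⟩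
  have hU : Nonempty U := ⟨t₀⟩
  let fam : Var → U → L.Term Var := fun v τ => τ.1 v
  let c : ℕ → U → L.Term Var := fun z _ => .var (Sum.inl z)
  have hc : Function.Injective c := by
    intro z z' h
    have := congrFun h t₀
    simpa [c] using this
  let S : Set (U → L.Term Var) := ⋃ v ∈ {v | Occurs Γ v}, {g | LggCut (τ₀ v) (fam v) g}
  have hS : S.Finite := (occurs_finite Γ).biUnion fun v _ => lggCut_finite _ _
  obtain ⟨code, hcode, hcodeZ⟩ := exists_code c hc hS
    (Z := {z | Occurs Γ (Sum.inl z)})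
    (Set.Finite.preimage (s := {v | Occurs Γ v}) Sum.inl_injective.injOn (occurs_finite Γ))
  let σ : Var → L.Term Var := fun v => Sum.elim (fun z => .var (Sum.inl z))
    (fun a => if IsExVar Γ a then lgg code (τ₀ (Sum.inr a)) (fam (Sum.inr a))
      else .var (Sum.inr a)) v
  have hσ : ∀ v, Occurs Γ v → σ v = lgg code (τ₀ v) (fam v) := by
    rintro (z | a) hv
    · have h0 : τ₀ (Sum.inl z) = .var (Sum.inl z) := hτ₀.1 z
      have hf : fam (Sum.inl z) = c z := funext fun τ => τ.2.1 z
      rw [h0, lgg, dif_neg, hf, hcodeZ z hv]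
      · rfl
      · rintro ⟨a, ha⟩
        have := ha t₀
        rw [hf] at this
        simp [c] at this
    · by_cases hx : IsExVar Γ a
      · simp [σ, hx]
      · have h0 : τ₀ (Sum.inr a) = .var (Sum.inr a) := hτ₀.2.1 a hx
        have hf : ∃ b : Addr, ∀ τ, fam (Sum.inr a) τ = .var (Sum.inr b) :=
          ⟨a, fun τ => τ.2.2.1 a hx⟩
        rw [h0, lgg, dif_pos hf]
        have := hf.choose_spec t₀
        rw [← this]
        simp [σ, hx, fam, t₀, h0]
  refine ⟨σ, ⟨fun z => rfl, fun a ha => by simp [σ, ha], ?_, ?_⟩, ?_⟩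
  · intro x hx y hy
    rw [mem_varFinset, hσ _ (isExVar_iff.1 hx).2] at hy
    exact hτ₀.2.2.1 x hx y ((mem_varFinset _).2 (occ_lgg_inr code t₀ y _ _ hy))
  · intro o ho o' ho' hl
    have key : ∀ o ∈ leaves Γ, ∀ t ∈ o.terms,
        t.subst σ = lgg code (t.subst τ₀) fun τ : U => t.subst τ.1 := by
      intro o ho t ht
      obtain ⟨k, rfl⟩ := List.mem_ofFn.1 ht
      exact lgg_of_subst code t₀ (fun τ : U => τ.1) σ _ fun v hv => hσ v ⟨o, ho, k, hv⟩
    rw [Leaf.ofFn_subst, Leaf.ofFn_subst]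
    refine map_eq_map_of_forall (f := fun (τ : U) t => t.subst τ.1) (fun τ => ?_) ?_
    · have := τ.2.2.2.2 o ho o' ho' hl
      rwa [Leaf.ofFn_subst, Leaf.ofFn_subst] at this
    · intro t ht t' ht' h
      -- All unifiers equalize the two terms, so they define the same family and have the same
      -- generalization.
      rw [key o ho t ht, key o' ho' t' ht', funext h]
      exact congrArg (fun s => lgg code s _) (h t₀)
  · intro τ hτ
    -- `ρ` decodes a variable into its family and evaluates the family at `τ`.
    let ρ : ℕ → L.Term Var := fun n =>
      if h : ∃ g ∈ S, code g = n then h.choose ⟨τ, hτ⟩ else .var (Sum.inl n)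
    refine ⟨ρ, fun x hx => ?_⟩
    have hocc := (isExVar_iff.1 hx).2
    rw [hσ _ hocc, lgg_subst code (⟨τ, hτ⟩ : U) ρ]
    intro g hg
    have hgS : g ∈ S := Set.mem_biUnion (show Sum.inr x ∈ {v | Occurs Γ v} from hocc) hg
    have h : ∃ g' ∈ S, code g' = code g := ⟨g, hgS, rfl⟩
    simp only [ρ]
    rw [dif_pos h, hcode h.choose_spec.1 hgS h.choose_spec.2]

/-- Of a unifiable linking, `x` precedes `y` if all unifiers assign to `x` a term containing `y`. -/
theorem precedes_iff {Γ : Sequent L} {Λ : Finset (Sym2 ℕ)} (h : ∃ σ, IsUnifier Γ Λ σ) {x y : Addr} :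
    Precedes Γ Λ x y ↔ IsExVar Γ x ∧ IsAllVar Γ y ∧
      ∀ σ, IsUnifier Γ Λ σ → Occ (Sum.inr y) (σ (Sum.inr x)) := by
  constructor
  · rintro ⟨hx, hy, σ, hσ, hxy⟩
    refine ⟨hx, hy, fun τ hτ => ?_⟩
    -- Every unifier is an instance of `σ` by a substitution for free variables, which leaves
    -- occurrences of bound variables in place.
    obtain ⟨ρ, hρ⟩ := hσ.2 τ hτ
    rw [hρ x hx, occ_subst]
    exact ⟨_, (mem_varFinset _).1 hxy, rfl⟩
  · rintro ⟨hx, hy, hxy⟩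
    obtain ⟨σ, hσ⟩ := exists_isMGU h
    exact ⟨hx, hy, σ, hσ, (mem_varFinset _).2 (hxy σ hσ.1)⟩

/-! ### Subformulas -/

/-- `Child B A`: the formula `B` is an argument of the outermost connective or quantifier of `A`. -/
inductive Child : Fml L → Fml L → Prop
  | tensorLeft (A B : Fml L) : Child A (.tensor A B)
  | tensorRight (A B : Fml L) : Child B (.tensor A B)
  | parLeft (A B : Fml L) : Child A (.par A B)
  | parRight (A B : Fml L) : Child B (.par A B)
  | all (x : ℕ) (A : Fml L) : Child A (.all x A)
  | ex (x : ℕ) (A : Fml L) : Child A (.ex x A)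

theorem Fml.sub_nil (A : Fml L) : A.sub [] = some A := by cases A <;> rfl

/-- `Q` is a subformula of `A`. -/
def Sub (Q A : Fml L) : Prop := ∃ p, A.sub p = some Q

theorem Sub.refl (A : Fml L) : Sub A A := ⟨[], A.sub_nil⟩

theorem sub_append (A : Fml L) (p q : List Bool) : A.sub (p ++ q) = (A.sub p).bind fun B => B.sub q := by
  induction p generalizing A with
  | nil => simp [Fml.sub_nil]
  | cons d p ih => cases A <;> cases d <;> simp [Fml.sub, ih]

theorem child_iff_sub {Q A : Fml L} : Child Q A ↔ ∃ d, A.sub [d] = some Q := by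
  constructor
  · intro h
    cases h
    · exact ⟨false, by simp [Fml.sub, Fml.sub_nil]⟩
    · exact ⟨true, by simp [Fml.sub, Fml.sub_nil]⟩
    · exact ⟨false, by simp [Fml.sub, Fml.sub_nil]⟩
    · exact ⟨true, by simp [Fml.sub, Fml.sub_nil]⟩
    · exact ⟨false, by simp [Fml.sub, Fml.sub_nil]⟩
    · exact ⟨false, by simp [Fml.sub, Fml.sub_nil]⟩
  · rintro ⟨d, h⟩
    cases A <;> cases d <;> simp [Fml.sub, Fml.sub_nil] at h <;> subst h <;> constructor

theorem Sub.trans {A B C : Fml L} (h : Sub A B) (h' : Sub B C) : Sub A C := by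
  obtain ⟨p, hp⟩ := h
  obtain ⟨q, hq⟩ := h'
  exact ⟨q ++ p, by simp [sub_append, hq, hp]⟩

theorem Child.sub {A B : Fml L} (h : Child A B) : Sub A B := by
  obtain ⟨d, hd⟩ := child_iff_sub.1 h
  exact ⟨[d], hd⟩

theorem sub_iff {Q A : Fml L} : Sub Q A ↔ Q = A ∨ ∃ B, Child B A ∧ Sub Q B := by
  constructor
  · rintro ⟨p, hp⟩
    cases p with
    | nil =>
      rw [Fml.sub_nil] at hp
      exact Or.inl (Option.some.inj hp).symm
    | cons d p =>
      rw [← List.singleton_append, sub_append] at hp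
      obtain ⟨B, hB, hp⟩ := Option.bind_eq_some_iff.1 hp
      exact Or.inr ⟨B, child_iff_sub.2 ⟨d, hB⟩, p, hp⟩
  · rintro (rfl | ⟨B, hB, h⟩)
    · exact .refl _
    · exact h.trans hB.sub

theorem child_tensor {Q A B : Fml L} : Child Q (.tensor A B) ↔ Q = A ∨ Q = B := by
  constructor
  · rintro ⟨⟩ <;> simp
  · rintro (rfl | rfl) <;> constructor

theorem child_par {Q A B : Fml L} : Child Q (.par A B) ↔ Q = A ∨ Q = B := by
  constructor
  · rintro ⟨⟩ <;> simp
  · rintro (rfl | rfl) <;> constructor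

theorem child_all {Q A : Fml L} {x : ℕ} : Child Q (.all x A) ↔ Q = A := by
  constructor
  · rintro ⟨⟩; rfl
  · rintro rfl; constructor

theorem child_ex {Q A : Fml L} {x : ℕ} : Child Q (.ex x A) ↔ Q = A := by
  constructor
  · rintro ⟨⟩; rfl
  · rintro rfl; constructor

theorem not_child_atom {Q : Fml L} {l n : ℕ} {P : L.Relations n} {ts : Fin n → L.Term ℕ} :
    ¬ Child Q (.atom l P ts) := by rintro ⟨⟩

theorem sub_tensor {Q A B : Fml L} : Sub Q (.tensor A B) ↔ Q = .tensor A B ∨ Sub Q A ∨ Sub Q B := by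
  rw [sub_iff]
  simp only [child_tensor, or_and_right, exists_or, exists_eq_left]

theorem sub_par {Q A B : Fml L} : Sub Q (.par A B) ↔ Q = .par A B ∨ Sub Q A ∨ Sub Q B := by
  rw [sub_iff]
  simp only [child_par, or_and_right, exists_or, exists_eq_left]

theorem sub_all {Q A : Fml L} {x : ℕ} : Sub Q (.all x A) ↔ Q = .all x A ∨ Sub Q A := by
  rw [sub_iff]
  simp only [child_all, exists_eq_left]

theorem sub_ex {Q A : Fml L} {x : ℕ} : Sub Q (.ex x A) ↔ Q = .ex x A ∨ Sub Q A := by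
  rw [sub_iff]
  simp only [child_ex, exists_eq_left]

theorem sub_atom {Q : Fml L} {l n : ℕ} {P : L.Relations n} {ts : Fin n → L.Term ℕ} :
    Sub Q (.atom l P ts) ↔ Q = .atom l P ts := by
  rw [sub_iff]
  simp [not_child_atom]

theorem Child.size_lt {A B : Fml L} (h : Child A B) : A.size < B.size := by
  cases h <;> simp only [Fml.size] <;> omega

theorem Sub.size_le {A B : Fml L} (h : Sub A B) : A.size ≤ B.size := by
  obtain ⟨p, hp⟩ := h
  induction p generalizing B with
  | nil =>
    rw [Fml.sub_nil] at hp
    rw [Option.some.inj hp]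
  | cons d p ih =>
    rw [← List.singleton_append, sub_append] at hp
    obtain ⟨C, hC, hp⟩ := Option.bind_eq_some_iff.1 hp
    exact (ih hp).trans (child_iff_sub.2 ⟨d, hC⟩).size_lt.le

/-! ### Names and predicate symbols of leaves -/

/-- The name of a leaf together with its predicate symbol. -/
abbrev Sig (L : FirstOrder.Language.{u, v}) := ℕ × Σ n, L.Relations n

def Fml.sigs : Fml L → List (Sig L)
  | .atom l (n := n) P _ => [(l, ⟨n, P⟩)]
  | .tensor A B => A.sigs ++ B.sigs
  | .par A B => A.sigs ++ B.sigs
  | .all _ A => A.sigs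
  | .ex _ A => A.sigs

/-- The names of the leaves of a formula, from left to right. -/
def Fml.names (A : Fml L) : List ℕ := A.sigs.map Prod.fst

@[simp] theorem names_atom (l : ℕ) {n : ℕ} (P : L.Relations n) (ts : Fin n → L.Term ℕ) :
    (Fml.atom l P ts).names = [l] := rfl
@[simp] theorem names_tensor (A B : Fml L) : (Fml.tensor A B).names = A.names ++ B.names := by
  simp [Fml.names, Fml.sigs]
@[simp] theorem names_par (A B : Fml L) : (Fml.par A B).names = A.names ++ B.names := by
  simp [Fml.names, Fml.sigs]
@[simp] theorem names_all (x : ℕ) (A : Fml L) : (Fml.all x A).names = A.names := rfl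
@[simp] theorem names_ex (x : ℕ) (A : Fml L) : (Fml.ex x A).names = A.names := rfl

/-- There are no units. Since every subformula has a leaf, distinct leaf names pin down where a
subformula sits. -/
theorem names_ne_nil (A : Fml L) : A.names ≠ [] := by
  induction A <;> simp_all

theorem exists_mem_names (A : Fml L) : ∃ l, l ∈ A.names :=
  List.exists_mem_of_ne_nil _ (names_ne_nil A)

def Leaf.sig (o : Leaf L) : Sig L := (o.name, ⟨o.arity, o.pred⟩)

theorem leaves_sig (A : Fml L) (i : ℕ) (p : List Bool) (e : ℕ → Var) :
    (A.leaves i p e).map Leaf.sig = A.sigs := by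
  induction A generalizing p e <;> simp_all [Fml.leaves, Fml.sigs, Leaf.sig]

theorem Child.names_subset {A B : Fml L} (h : Child A B) : A.names ⊆ B.names := by
  cases h <;> simp

theorem Sub.names_sublist {A B : Fml L} (h : Sub A B) : A.names.Sublist B.names := by
  obtain ⟨p, hp⟩ := h
  induction p generalizing B with
  | nil =>
    rw [Fml.sub_nil] at hp
    rw [Option.some.inj hp]
  | cons d p ih =>
    rw [← List.singleton_append, sub_append] at hp
    obtain ⟨C, hC, hp⟩ := Option.bind_eq_some_iff.1 hp
    refine (ih hp).trans ?_
    cases child_iff_sub.2 ⟨d, hC⟩ <;> simp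

theorem Sub.names_subset {A B : Fml L} (h : Sub A B) : A.names ⊆ B.names := h.names_sublist.subset

/-- If the leaves have distinct names, then distinct vertices carry distinct subformulas. -/
theorem sub_inj {A Q : Fml L} (hA : A.names.Nodup) {p q : List Bool} (hp : A.sub p = some Q)
    (hq : A.sub q = some Q) : p = q := by
  induction p generalizing A q with
  | nil =>
    cases q with
    | nil => rfl
    | cons d q =>
      rw [Fml.sub_nil] at hp
      cases hp
      rw [← List.singleton_append, sub_append] at hq
      obtain ⟨C, hC, hq⟩ := Option.bind_eq_some_iff.1 hq
      have h1 := (child_iff_sub.2 ⟨d, hC⟩).size_lt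
      have h2 := Sub.size_le ⟨q, hq⟩
      omega
  | cons d p ih =>
    rw [← List.singleton_append, sub_append] at hp
    obtain ⟨C, hC, hp⟩ := Option.bind_eq_some_iff.1 hp
    have hsub := Sub.names_subset (A := Q) (B := C) ⟨p, hp⟩
    have hnd : C.names.Nodup := hA.sublist (Sub.names_sublist ⟨[d], hC⟩)
    cases q with
    | nil =>
      have h2 := Sub.size_le (A := Q) (B := C) ⟨p, hp⟩
      rw [Fml.sub_nil] at hq
      cases hq
      have h1 := (child_iff_sub.2 ⟨d, hC⟩).size_lt
      omega
    | cons d' q =>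
      rw [← List.singleton_append, sub_append] at hq
      obtain ⟨C', hC', hq⟩ := Option.bind_eq_some_iff.1 hq
      have hsub' := Sub.names_subset ⟨q, hq⟩
      by_cases hd : d = d'
      · subst hd
        rw [hC] at hC'
        cases hC'
        rw [ih hnd hp hq]
      -- The two arguments of a binary connective have disjoint names, while `Q` would have its
      -- leaves in both.
      · exfalso
        obtain ⟨l, hl⟩ := exists_mem_names Q
        have hl1 := hsub hl
        have hl2 := hsub' hl
        cases A <;> cases d <;> cases d' <;> simp [Fml.sub, Fml.sub_nil] at hC hC' hd <;>
          subst hC <;> subst hC' <;> simp [List.nodup_append] at hA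
        · exact hA.2.2 _ hl1 _ hl2 rfl
        · exact hA.2.2 _ hl2 _ hl1 rfl
        · exact hA.2.2 _ hl1 _ hl2 rfl
        · exact hA.2.2 _ hl2 _ hl1 rfl

/-! ### Names in sequents -/

theorem getElem?_eq_of_nodup_flatMap {α : Type*} {f : α → List ℕ} {l : List α}
    (h : (l.flatMap f).Nodup) {i j : ℕ} {a b : α} (ha : l[i]? = some a) (hb : l[j]? = some b) {x : ℕ}
    (hxa : x ∈ f a) (hxb : x ∈ f b) : i = j := by
  rw [List.nodup_flatMap, List.pairwise_iff_getElem] at h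
  obtain ⟨hi, rfl⟩ := List.getElem?_eq_some_iff.1 ha
  obtain ⟨hj, rfl⟩ := List.getElem?_eq_some_iff.1 hb
  rcases lt_trichotomy i j with hij | hij | hij
  · exact absurd hxb (h.2 i j hi hj hij hxa)
  · exact hij
  · exact absurd hxa (h.2 j i hj hi hij hxb)

/-- Two members of a list which have a common name are equal if all names are distinct. -/
theorem eq_of_mem_of_nodup_flatMap {α : Type*} {f : α → List ℕ} {l : List α} (h : (l.flatMap f).Nodup)
    {a b : α} (ha : a ∈ l) (hb : b ∈ l) {x : ℕ} (hxa : x ∈ f a) (hxb : x ∈ f b) : a = b := by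
  obtain ⟨i, hi⟩ := List.mem_iff_getElem?.1 ha
  obtain ⟨j, hj⟩ := List.mem_iff_getElem?.1 hb
  rw [getElem?_eq_of_nodup_flatMap h hi hj hxa hxb, hj] at hi
  exact (Option.some.inj hi).symm

/-- This justifies identifying vertices with subformulas, which survive a reduction even though
addresses shift. -/
theorem subAt_inj {Γ : Sequent L} (hΓ : (Γ.flatMap Fml.names).Nodup) {a b : Addr} {Q : Fml L}
    (ha : subAt Γ a = some Q) (hb : subAt Γ b = some Q) : a = b := by
  obtain ⟨i, p⟩ := a
  obtain ⟨j, q⟩ := b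
  obtain ⟨A, hA, ha⟩ := Option.bind_eq_some_iff.1 ha
  obtain ⟨B, hB, hb⟩ := Option.bind_eq_some_iff.1 hb
  obtain ⟨l, hl⟩ := exists_mem_names Q
  have hij : i = j := getElem?_eq_of_nodup_flatMap hΓ hA hB (Sub.names_subset ⟨p, ha⟩ hl)
    (Sub.names_subset ⟨q, hb⟩ hl)
  subst hij
  rw [hA] at hB
  cases hB
  exact congrArg (Prod.mk i) (sub_inj ((List.nodup_flatMap.1 hΓ).1 A (List.mem_of_getElem? hA)) ha hb)

theorem leaves_sequent_sig (Γ : Sequent L) : (leaves Γ).map Leaf.sig = Γ.flatMap Fml.sigs := by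
  rw [leaves, List.map_flatMap]
  have : (fun Ai : Fml L × ℕ => (Fml.leaves Ai.2 Ai.1 [] Sum.inl).map Leaf.sig) =
      fun Ai => Fml.sigs Ai.1 := by
    funext Ai
    exact leaves_sig _ _ _ _
  rw [this]
  have h2 := List.flatMap_map (f := (Prod.fst : Fml L × ℕ → Fml L)) (g := Fml.sigs) (l := Γ.zipIdx)
  rw [List.zipIdx_map_fst] at h2
  exact h2.symm

theorem leaves_sequent_name (Γ : Sequent L) : (leaves Γ).map Leaf.name = Γ.flatMap Fml.names := by
  have := congrArg (List.map Prod.fst) (leaves_sequent_sig Γ)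
  rw [List.map_map, List.map_flatMap] at this
  exact this

theorem mem_leaves {Γ : Sequent L} {o : Leaf L} :
    o ∈ leaves Γ ↔ ∃ (i : ℕ) (A : Fml L), Γ[i]? = some A ∧ o ∈ A.leaves i [] Sum.inl := by
  simp only [leaves, List.mem_flatMap, Prod.exists, List.mem_zipIdx_iff_getElem?]
  exact ⟨fun ⟨A, i, h⟩ => ⟨i, A, h⟩, fun ⟨i, A, h⟩ => ⟨A, i, h⟩⟩

theorem mem_sigs {A : Fml L} {l n : ℕ} {P : L.Relations n} :
    (l, (⟨n, P⟩ : Σ n, L.Relations n)) ∈ A.sigs ↔ ∃ ts, Sub (.atom l P ts) A := by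
  induction A with
  | atom m Q us =>
    simp only [Fml.sigs, List.mem_singleton, sub_atom]
    constructor
    · intro h
      simp only [Prod.mk.injEq, Sigma.mk.injEq] at h
      obtain ⟨rfl, rfl, h⟩ := h
      cases h
      exact ⟨us, rfl⟩
    · rintro ⟨ts, h⟩
      cases h
      rfl
  | tensor A B ihA ihB => simp [Fml.sigs, ihA, ihB, sub_tensor, exists_or]
  | par A B ihA ihB => simp [Fml.sigs, ihA, ihB, sub_par, exists_or]
  | all x A ih => simp [Fml.sigs, ih, sub_all]
  | ex x A ih => simp [Fml.sigs, ih, sub_ex]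

/-! ### Linkings, in terms of names and predicate symbols -/

/-- Dual predicate symbols. -/
def DualSig (D : Duality L) (o o' : Sig L) : Prop :=
  ∃ (n : ℕ) (P : L.Relations n), o.2 = ⟨n, P⟩ ∧ o'.2 = ⟨n, D.neg P⟩

theorem DualSig.symm {D : Duality L} {o o' : Sig L} (h : DualSig D o o') : DualSig D o' o := by
  obtain ⟨n, P, h, h'⟩ := h
  exact ⟨n, D.neg P, h', by rw [h, D.neg_neg]⟩

theorem DualSig.ne {D : Duality L} {o o' : Sig L} (h : DualSig D o o') : o ≠ o' := by
  rintro rfl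
  obtain ⟨n, P, h, h'⟩ := h
  rw [h] at h'
  simp only [Sigma.mk.injEq, heq_eq_eq, true_and] at h'
  exact D.neg_ne P h'.symm

theorem dualLeaves_iff {D : Duality L} {o o' : Leaf L} :
    DualLeaves D o o' ↔ DualSig D o.sig o'.sig := by
  constructor
  · rintro ⟨l, m, P, ts, us⟩
    exact ⟨_, P, rfl, rfl⟩
  · obtain ⟨l, n, P, ts⟩ := o
    obtain ⟨m, n', Q, us⟩ := o'
    rintro ⟨k, R, h, h'⟩
    simp only [Leaf.sig, Sigma.mk.injEq] at h h'
    obtain ⟨rfl, h⟩ := h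
    obtain ⟨rfl, h'⟩ := h'
    cases h
    cases h'
    constructor

/-- The conditions on a linking see only names and predicate symbols. The encoding of cuts does not
affect these, and a logical reduction merely permutes their list. -/
def IsSigLinking (D : Duality L) (S : List (Sig L)) (Λ : Finset (Sym2 ℕ)) : Prop :=
  (S.map Prod.fst).Nodup ∧
  (∀ e ∈ Λ, ∃ o ∈ S, ∃ o' ∈ S, DualSig D o o' ∧ e = s(o.1, o'.1)) ∧
  ∀ o ∈ S, ∃! e, e ∈ Λ ∧ o.1 ∈ e

theorem isLinking_iff {D : Duality L} {Γ : Sequent L} {Λ : Finset (Sym2 ℕ)} :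
    IsLinking D Γ Λ ↔ IsSigLinking D (Γ.flatMap Fml.sigs) Λ := by
  rw [IsSigLinking, ← leaves_sequent_sig, IsLinking, List.map_map]
  simp only [List.mem_map, exists_exists_and_eq_and, forall_exists_index, and_imp,
    forall_apply_eq_imp_iff₂, dualLeaves_iff]
  rfl

namespace IsSigLinking

variable {D : Duality L} {S : List (Sig L)} {Λ : Finset (Sym2 ℕ)}

theorem eq_of_fst (h : IsSigLinking D S Λ) {o o' : Sig L} (ho : o ∈ S) (ho' : o' ∈ S)
    (hoo : o.1 = o'.1) : o = o' :=
  List.inj_on_of_nodup_map h.1 ho ho' hoo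

/-- The ends of a link are dual leaves. -/
theorem dual (h : IsSigLinking D S Λ) {o o' : Sig L} (ho : o ∈ S) (ho' : o' ∈ S)
    (hl : s(o.1, o'.1) ∈ Λ) : DualSig D o o' := by
  obtain ⟨p, hp, p', hp', hd, he⟩ := h.2.1 _ hl
  rcases Sym2.eq_iff.1 he with ⟨h1, h2⟩ | ⟨h1, h2⟩
  · rw [h.eq_of_fst ho hp h1, h.eq_of_fst ho' hp' h2]
    exact hd
  · rw [h.eq_of_fst ho hp' h1, h.eq_of_fst ho' hp h2]
    exact hd.symm

theorem exists_left (h : IsSigLinking D S Λ) {l m : ℕ} (hl : s(l, m) ∈ Λ) : ∃ o ∈ S, o.1 = l := by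
  obtain ⟨p, hp, p', hp', hd, he⟩ := h.2.1 _ hl
  rcases Sym2.eq_iff.1 he with ⟨h1, h2⟩ | ⟨h1, h2⟩
  · exact ⟨p, hp, h1.symm⟩
  · exact ⟨p', hp', h1.symm⟩

theorem exists_right (h : IsSigLinking D S Λ) {l m : ℕ} (hl : s(l, m) ∈ Λ) : ∃ o ∈ S, o.1 = m :=
  h.exists_left (Sym2.eq_swap ▸ hl)

theorem ne (h : IsSigLinking D S Λ) {l m : ℕ} (hl : s(l, m) ∈ Λ) : l ≠ m := by
  rintro rfl
  obtain ⟨o, ho, rfl⟩ := h.exists_left hl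
  exact (h.dual ho ho hl).ne rfl

theorem eq_of_left (h : IsSigLinking D S Λ) {l m m' : ℕ} (hl : s(l, m) ∈ Λ) (hl' : s(l, m') ∈ Λ) :
    m = m' := by
  obtain ⟨o, ho, rfl⟩ := h.exists_left hl
  have := (h.2.2 o ho).unique ⟨hl, by simp⟩ ⟨hl', by simp⟩
  exact Sym2.congr_right.1 this

theorem eq_of_right (h : IsSigLinking D S Λ) {l l' m : ℕ} (hl : s(l, m) ∈ Λ) (hl' : s(l', m) ∈ Λ) :
    l = l' :=
  h.eq_of_left (Sym2.eq_swap ▸ hl) (Sym2.eq_swap ▸ hl')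

theorem exists_partner (h : IsSigLinking D S Λ) {o : Sig L} (ho : o ∈ S) :
    ∃ o' ∈ S, s(o.1, o'.1) ∈ Λ := by
  obtain ⟨e, ⟨he, hoe⟩, -⟩ := h.2.2 o ho
  obtain ⟨m, rfl⟩ := Sym2.mem_iff_exists.1 hoe
  obtain ⟨o', ho', rfl⟩ := h.exists_right he
  exact ⟨o', ho', he⟩

end IsSigLinking

/-- A linking, in terms of partners. -/
theorem isSigLinking_of {D : Duality L} {S : List (Sig L)} {Λ : Finset (Sym2 ℕ)}
    (hS : (S.map Prod.fst).Nodup)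
    (h1 : ∀ l m, s(l, m) ∈ Λ → ∃ o ∈ S, ∃ o' ∈ S, DualSig D o o' ∧ o.1 = l ∧ o'.1 = m)
    (h2 : ∀ o ∈ S, ∃ m, s(o.1, m) ∈ Λ)
    (h3 : ∀ l m m', s(l, m) ∈ Λ → s(l, m') ∈ Λ → m = m') : IsSigLinking D S Λ := by
  refine ⟨hS, ?_, ?_⟩
  · intro e he
    induction e with | h l m => ?_
    obtain ⟨o, ho, o', ho', hd, rfl, rfl⟩ := h1 l m he
    exact ⟨o, ho, o', ho', hd, rfl⟩
  · intro o ho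
    obtain ⟨m, hm⟩ := h2 o ho
    refine ⟨s(o.1, m), ⟨hm, by simp⟩, ?_⟩
    rintro e ⟨he, hoe⟩
    obtain ⟨m', rfl⟩ := Sym2.mem_iff_exists.1 hoe
    rw [h3 _ _ _ he hm]

/-! ### Cut sequents -/

def cutSigs (c : Fml L × Fml L) : List (Sig L) := c.1.sigs ++ c.2.sigs

def Net.sigs (θ : Net L) : List (Sig L) := θ.concl.flatMap Fml.sigs ++ θ.cuts.flatMap cutSigs

def cutNames (c : Fml L × Fml L) : List ℕ := c.1.names ++ c.2.names

def Net.names (θ : Net L) : List ℕ := θ.concl.flatMap Fml.names ++ θ.cuts.flatMap cutNames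

theorem map_fst_sigs (θ : Net L) : θ.sigs.map Prod.fst = θ.names := by
  simp only [Net.sigs, Net.names, List.map_append, List.map_flatMap]
  congr 2
  funext c
  simp [cutSigs, cutNames, Fml.names]

theorem sigs_chain (xs : List ℕ) (A : Fml L) : (xs.foldr Fml.ex A).sigs = A.sigs := by
  induction xs with
  | nil => rfl
  | cons x xs ih => simpa [Fml.sigs] using ih

theorem names_chain (xs : List ℕ) (A : Fml L) : (xs.foldr Fml.ex A).names = A.names := by
  rw [Fml.names, sigs_chain, Fml.names]

theorem encode_sigs (θ : Net L) : θ.encode.flatMap Fml.sigs = θ.sigs := by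
  simp only [Net.encode, Net.sigs, List.flatMap_append, List.flatMap_map]
  congr 2
  funext c
  simp [encodeCut, sigs_chain, Fml.sigs, cutSigs]

theorem encode_names (θ : Net L) : θ.encode.flatMap Fml.names = θ.names := by
  rw [← map_fst_sigs, ← encode_sigs, List.map_flatMap]
  rfl

/-- `R` is one of the formulas of a cut sequent. -/
def Root (θ : Net L) (R : Fml L) : Prop := R ∈ θ.concl ∨ ∃ c ∈ θ.cuts, R = c.1 ∨ R = c.2

theorem mem_net_sigs {θ : Net L} {o : Sig L} : o ∈ θ.sigs ↔ ∃ R, Root θ R ∧ o ∈ R.sigs := by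
  simp only [Net.sigs, List.mem_append, List.mem_flatMap, cutSigs, Root]
  constructor
  · rintro (⟨A, hA, h⟩ | ⟨c, hc, h | h⟩)
    · exact ⟨A, Or.inl hA, h⟩
    · exact ⟨c.1, Or.inr ⟨c, hc, Or.inl rfl⟩, h⟩
    · exact ⟨c.2, Or.inr ⟨c, hc, Or.inr rfl⟩, h⟩
  · rintro ⟨R, hR | ⟨c, hc, rfl | rfl⟩, h⟩
    · exact Or.inl ⟨R, hR, h⟩
    · exact Or.inr ⟨c, hc, Or.inl h⟩
    · exact Or.inr ⟨c, hc, Or.inr h⟩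

/-! ### Distinct names separate the formulas of a cut sequent -/

section Nodup

variable {θ : Net L}

theorem cut_unique (hθ : θ.names.Nodup) {c c' : Fml L × Fml L} (hc : c ∈ θ.cuts) (hc' : c' ∈ θ.cuts)
    {l : ℕ} (hl : l ∈ cutNames c) (hl' : l ∈ cutNames c') : c = c' :=
  eq_of_mem_of_nodup_flatMap (List.nodup_append.1 hθ).2.1 hc hc' hl hl'

theorem concl_cut_disjoint (hθ : θ.names.Nodup) {A : Fml L} {c : Fml L × Fml L} (hA : A ∈ θ.concl)
    (hc : c ∈ θ.cuts) {l : ℕ} (hl : l ∈ A.names) (hl' : l ∈ cutNames c) : False :=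
  (List.nodup_append.1 hθ).2.2 _ (List.mem_flatMap.2 ⟨A, hA, hl⟩) _
    (List.mem_flatMap.2 ⟨c, hc, hl'⟩) rfl

theorem cut_names_nodup (hθ : θ.names.Nodup) {c : Fml L × Fml L} (hc : c ∈ θ.cuts) :
    (cutNames c).Nodup :=
  (List.nodup_flatMap.1 (List.nodup_append.1 hθ).2.1).1 c hc

theorem cut_sides_disjoint (hθ : θ.names.Nodup) {c : Fml L × Fml L} (hc : c ∈ θ.cuts) {l : ℕ}
    (hl : l ∈ c.1.names) (hl' : l ∈ c.2.names) : False :=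
  (List.nodup_append.1 (cut_names_nodup hθ hc)).2.2 _ hl _ hl' rfl

theorem root_unique (hθ : θ.names.Nodup) {R R' : Fml L} (hR : Root θ R) (hR' : Root θ R') {l : ℕ}
    (hl : l ∈ R.names) (hl' : l ∈ R'.names) : R = R' := by
  have key : ∀ (A : Fml L) (c : Fml L × Fml L), A ∈ θ.concl → c ∈ θ.cuts → l ∈ A.names →
      l ∈ c.1.names ∨ l ∈ c.2.names → False := fun A c hA hc h h' =>
    concl_cut_disjoint hθ hA hc h (List.mem_append.2 h')
  rcases hR with hR | ⟨c, hc, hR⟩ <;> rcases hR' with hR' | ⟨c', hc', hR'⟩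
  · exact eq_of_mem_of_nodup_flatMap (List.nodup_append.1 hθ).1 hR hR' hl hl'
  · exact (key R c' hR hc' hl (by rcases hR' with rfl | rfl <;> simp [hl'])).elim
  · exact (key R' c hR' hc hl' (by rcases hR with rfl | rfl <;> simp [hl])).elim
  · have : c = c' := cut_unique hθ hc hc' (l := l)
      (by rcases hR with rfl | rfl <;> simp [cutNames, hl])
      (by rcases hR' with rfl | rfl <;> simp [cutNames, hl'])
    subst this
    rcases hR with rfl | rfl <;> rcases hR' with rfl | rfl
    · rfl
    · exact (cut_sides_disjoint hθ hc hl hl').elim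
    · exact (cut_sides_disjoint hθ hc hl' hl).elim
    · rfl

end Nodup

/-! ### The contracted graph of a net

The vertices of a cut sequent are identified with its subformulas, which is possible because the
names of its leaves are distinct. The quantifiers and the tensor which the encoding adds to a cut
are contracted to a single vertex, the hub of this cut. -/

/-- A subformula or the hub of a cut. -/
inductive GVert (L : FirstOrder.Language.{u, v}) : Type (max u v)
  | node (A : Fml L)
  | hub (c : Fml L × Fml L)

/-- A free variable, the variable bound by a quantifier, or a free variable of a cut. -/
inductive GVar (L : FirstOrder.Language.{u, v}) : Type (max u v)
  | free (x : ℕ)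
  | bound (A : Fml L)
  | cut (c : Fml L × Fml L) (x : ℕ)

/-- A leaf over the variables of the contracted graph. -/
structure GLeaf (L : FirstOrder.Language.{u, v}) where
  name : ℕ
  terms : List (L.Term (GVar L))

def Fml.gleaves : Fml L → (ℕ → GVar L) → List (GLeaf L)
  | .atom l _ ts, e => [⟨l, List.ofFn fun k => (ts k).relabel e⟩]
  | .tensor A B, e => A.gleaves e ++ B.gleaves e
  | .par A B, e => A.gleaves e ++ B.gleaves e
  | .all x A, e => A.gleaves (Function.update e x (.bound (.all x A)))
  | .ex x A, e => A.gleaves (Function.update e x (.bound (.ex x A)))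

def Net.gleaves (θ : Net L) : List (GLeaf L) :=
  (θ.concl.flatMap fun A => A.gleaves .free) ++
    θ.cuts.flatMap fun c => c.1.gleaves (.cut c) ++ c.2.gleaves (.cut c)

theorem mem_gleaves {θ : Net L} {o : GLeaf L} : o ∈ θ.gleaves ↔
    (∃ A ∈ θ.concl, o ∈ A.gleaves .free) ∨
      ∃ c ∈ θ.cuts, ∃ A, (A = c.1 ∨ A = c.2) ∧ o ∈ A.gleaves (.cut c) := by
  simp only [Net.gleaves, List.mem_append, List.mem_flatMap, or_and_right, exists_or,
    exists_eq_left]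

/-- The variable `v` occurs in a leaf of `θ`. -/
def GOccurs (θ : Net L) (v : GVar L) : Prop := ∃ o ∈ θ.gleaves, ∃ t ∈ o.terms, Occ v t

/-- The vertices of the contracted graph. -/
def GNode (θ : Net L) : GVert L → Prop
  | .node A => ∃ R, Root θ R ∧ Sub A R
  | .hub c => c ∈ θ.cuts

/-- `v` is a non-vacuous existential variable. -/
def GEx (θ : Net L) (v : GVar L) : Prop :=
  GOccurs θ v ∧ ((∃ x A, v = .bound (.ex x A)) ∨ ∃ c x, v = .cut c x)

/-- `A` is a universal quantifier. -/
def GAll (θ : Net L) (A : Fml L) : Prop := GNode θ (.node A) ∧ ∃ x B, A = .all x B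

structure GUnifier (θ : Net L) (τ : GVar L → L.Term (GVar L)) : Prop where
  fixes : ∀ v, ¬ GEx θ v → τ v = .var v
  range : ∀ v, GEx θ v → ∀ w, Occ w (τ v) → (∃ x, w = .free x) ∨ ∃ A, w = .bound A ∧ GAll θ A
  eq : ∀ o ∈ θ.gleaves, ∀ o' ∈ θ.gleaves, s(o.name, o'.name) ∈ θ.links →
    (o.terms.map fun t => t.subst τ) = o'.terms.map fun t => t.subst τ

/-- All unifiers assign to `v` a term that contains the variable of `A`. -/
def GPrecedes (θ : Net L) (v : GVar L) (A : Fml L) : Prop :=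
  GEx θ v ∧ GAll θ A ∧ ∀ τ, GUnifier θ τ → Occ (.bound A) (τ v)

/-- `IsVert v u`: the vertex `u` quantifies the variable `v`. -/
inductive IsVert : GVar L → GVert L → Prop
  | bound (A : Fml L) : IsVert (.bound A) (.node A)
  | cut (c : Fml L × Fml L) (x : ℕ) : IsVert (.cut c x) (.hub c)

/-- The directed edges of the contracted graph. -/
inductive GArc (θ : Net L) : GVert L → GVert L → Prop
  | child (A B : Fml L) : GNode θ (.node B) → Child A B → GArc θ (.node A) (.node B)
  | cut (A : Fml L) (c : Fml L × Fml L) : c ∈ θ.cuts → (A = c.1 ∨ A = c.2) →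
      GArc θ (.node A) (.hub c)
  | leap (v : GVar L) (u : GVert L) (A : Fml L) : GPrecedes θ v A → IsVert v u →
      GArc θ u (.node A)

def GLink (θ : Net L) (u v : GVert L) : Prop :=
  GNode θ u ∧ GNode θ v ∧ ∃ (l m : ℕ) (n n' : ℕ) (P : L.Relations n) (Q : L.Relations n')
    (ts : Fin n → L.Term ℕ) (us : Fin n' → L.Term ℕ),
    u = .node (.atom l P ts) ∧ v = .node (.atom m Q us) ∧ s(l, m) ∈ θ.links

/-- The vertices which a switching acts on. -/
inductive GSwitched : GVert L → Prop
  | par (A B : Fml L) : GSwitched (.node (.par A B))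
  | all (x : ℕ) (A : Fml L) : GSwitched (.node (.all x A))

def GSwitching (θ : Net L) (g : GVert L → GVert L) : Prop :=
  ∀ v, GNode θ v → GSwitched v → GArc θ (g v) v

/-- The edges of the switching `g`, those into `X` being deleted. -/
def GEdge (θ : Net L) (g : GVert L → GVert L) (X : Set (GVert L)) (u v : GVert L) : Prop :=
  GLink θ u v ∨ (GArc θ u v ∧ v ∉ X ∧ (GSwitched v → g v = u))

/-- Connectedness of two vertices in a switching, the directed edges into `X` being deleted. -/
def GConn (θ : Net L) (g : GVert L → GVert L) (X : Set (GVert L)) : GVert L → GVert L → Prop :=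
  Relation.EqvGen (GEdge θ g X)

/-- The linking is unifiable, and its switchings are connected. -/
def GConnected (θ : Net L) : Prop :=
  (∃ τ, GUnifier θ τ) ∧ ∀ g, GSwitching θ g → ∀ u v, GNode θ u → GNode θ v → GConn θ g ∅ u v

/-- Edges into switched vertices are bridges of the switching. -/
def GBridges (θ : Net L) : Prop :=
  ∀ g, GSwitching θ g → ∀ v, GNode θ v → GSwitched v → ¬ GConn θ g {v} (g v) v

/-! ### Basic facts on the contracted graph -/

theorem exists_of_occ_gleaves {A : Fml L} {e : ℕ → GVar L} {o : GLeaf L} (ho : o ∈ A.gleaves e)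
    {t : L.Term (GVar L)} (ht : t ∈ o.terms) {v : GVar L} (hv : Occ v t) :
    (∃ x ∈ A.freeVars, v = e x) ∨
      ∃ Q, v = .bound Q ∧ Sub Q A ∧ ((∃ x B, Q = .all x B) ∨ ∃ x B, Q = .ex x B) := by
  induction A generalizing e with
  | atom l P ts =>
    simp only [Fml.gleaves, List.mem_singleton] at ho
    subst ho
    obtain ⟨k, rfl⟩ := List.mem_ofFn.1 ht
    obtain ⟨x, hx, rfl⟩ := (occ_relabel _ _).1 hv
    refine Or.inl ⟨x, ?_, rfl⟩
    simp only [Fml.freeVars, Finset.mem_biUnion, Finset.mem_univ, true_and]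
    exact ⟨k, (mem_varFinset _).2 hx⟩
  | tensor A B ihA ihB =>
    rcases List.mem_append.1 ho with ho | ho
    · rcases ihA ho with ⟨x, hx, rfl⟩ | ⟨Q, h, hQ, hq⟩
      · exact Or.inl ⟨x, by simp [Fml.freeVars, hx], rfl⟩
      · exact Or.inr ⟨Q, h, sub_tensor.2 (Or.inr (Or.inl hQ)), hq⟩
    · rcases ihB ho with ⟨x, hx, rfl⟩ | ⟨Q, h, hQ, hq⟩
      · exact Or.inl ⟨x, by simp [Fml.freeVars, hx], rfl⟩
      · exact Or.inr ⟨Q, h, sub_tensor.2 (Or.inr (Or.inr hQ)), hq⟩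
  | par A B ihA ihB =>
    rcases List.mem_append.1 ho with ho | ho
    · rcases ihA ho with ⟨x, hx, rfl⟩ | ⟨Q, h, hQ, hq⟩
      · exact Or.inl ⟨x, by simp [Fml.freeVars, hx], rfl⟩
      · exact Or.inr ⟨Q, h, sub_par.2 (Or.inr (Or.inl hQ)), hq⟩
    · rcases ihB ho with ⟨x, hx, rfl⟩ | ⟨Q, h, hQ, hq⟩
      · exact Or.inl ⟨x, by simp [Fml.freeVars, hx], rfl⟩
      · exact Or.inr ⟨Q, h, sub_par.2 (Or.inr (Or.inr hQ)), hq⟩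
  | all x A ih =>
    rcases ih ho with ⟨z, hz, rfl⟩ | ⟨Q, h, hQ, hq⟩
    · by_cases hzx : z = x
      · subst hzx
        exact Or.inr ⟨_, by simp, .refl _, Or.inl ⟨_, _, rfl⟩⟩
      · exact Or.inl ⟨z, by simp [Fml.freeVars, hz, hzx], by simp [hzx]⟩
    · exact Or.inr ⟨Q, h, sub_all.2 (Or.inr hQ), hq⟩
  | ex x A ih =>
    rcases ih ho with ⟨z, hz, rfl⟩ | ⟨Q, h, hQ, hq⟩
    · by_cases hzx : z = x
      · subst hzx
        exact Or.inr ⟨_, by simp, .refl _, Or.inr ⟨_, _, rfl⟩⟩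
      · exact Or.inl ⟨z, by simp [Fml.freeVars, hz, hzx], by simp [hzx]⟩
    · exact Or.inr ⟨Q, h, sub_ex.2 (Or.inr hQ), hq⟩

theorem occ_gleaves_of_mem_freeVars {A : Fml L} {e : ℕ → GVar L} {x : ℕ} (hx : x ∈ A.freeVars) :
    ∃ o ∈ A.gleaves e, ∃ t ∈ o.terms, Occ (e x) t := by
  induction A generalizing e with
  | atom l P ts =>
    simp only [Fml.freeVars, Finset.mem_biUnion, Finset.mem_univ, true_and] at hx
    obtain ⟨k, hk⟩ := hx
    exact ⟨_, List.mem_singleton.2 rfl, _, List.mem_ofFn.2 ⟨k, rfl⟩,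
      (occ_relabel _ _).2 ⟨x, (mem_varFinset _).1 hk, rfl⟩⟩
  | tensor A B ihA ihB =>
    rcases Finset.mem_union.1 hx with hx | hx
    · obtain ⟨o, ho, h⟩ := ihA (e := e) hx
      exact ⟨o, List.mem_append_left _ ho, h⟩
    · obtain ⟨o, ho, h⟩ := ihB (e := e) hx
      exact ⟨o, List.mem_append_right _ ho, h⟩
  | par A B ihA ihB =>
    rcases Finset.mem_union.1 hx with hx | hx
    · obtain ⟨o, ho, h⟩ := ihA (e := e) hx
      exact ⟨o, List.mem_append_left _ ho, h⟩
    · obtain ⟨o, ho, h⟩ := ihB (e := e) hx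
      exact ⟨o, List.mem_append_right _ ho, h⟩
  | all y A ih =>
    obtain ⟨hxy, hx⟩ := Finset.mem_erase.1 hx
    obtain ⟨o, ho, h⟩ := ih (e := Function.update e y (.bound (.all y A))) hx
    rw [Function.update_of_ne hxy] at h
    exact ⟨o, ho, h⟩
  | ex y A ih =>
    obtain ⟨hxy, hx⟩ := Finset.mem_erase.1 hx
    obtain ⟨o, ho, h⟩ := ih (e := Function.update e y (.bound (.ex y A))) hx
    rw [Function.update_of_ne hxy] at h
    exact ⟨o, ho, h⟩

theorem GOccurs.cases {θ : Net L} {v : GVar L} (h : GOccurs θ v) :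
    (∃ x, v = .free x) ∨ (∃ c ∈ θ.cuts, ∃ x, v = .cut c x ∧ (x ∈ c.1.freeVars ∨ x ∈ c.2.freeVars)) ∨
      ∃ Q, v = .bound Q ∧ GNode θ (.node Q) ∧ ((∃ x B, Q = .all x B) ∨ ∃ x B, Q = .ex x B) := by
  obtain ⟨o, ho, t, ht, hv⟩ := h
  rcases mem_gleaves.1 ho with ⟨A, hA, ho⟩ | ⟨c, hc, A, hA, ho⟩
  · rcases exists_of_occ_gleaves ho ht hv with ⟨x, -, rfl⟩ | ⟨Q, h, hQ, hq⟩
    · exact Or.inl ⟨x, rfl⟩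
    · exact Or.inr (Or.inr ⟨Q, h, ⟨A, Or.inl hA, hQ⟩, hq⟩)
  · rcases exists_of_occ_gleaves ho ht hv with ⟨x, hx, rfl⟩ | ⟨Q, h, hQ, hq⟩
    · refine Or.inr (Or.inl ⟨c, hc, x, rfl, ?_⟩)
      rcases hA with rfl | rfl
      · exact Or.inl hx
      · exact Or.inr hx
    · exact Or.inr (Or.inr ⟨Q, h, ⟨A, Or.inr ⟨c, hc, hA⟩, hQ⟩, hq⟩)

theorem GEx.gnode {θ : Net L} {v : GVar L} {w : GVert L} (h : GEx θ v) (hw : IsVert v w) :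
    GNode θ w := by
  rcases h.1.cases with ⟨x, rfl⟩ | ⟨c, hc, x, rfl, -⟩ | ⟨Q, rfl, hQ, -⟩
  · cases hw
  · cases hw
    exact hc
  · cases hw
    exact hQ

theorem GNode.child {θ : Net L} {A B : Fml L} (hB : GNode θ (.node B)) (h : Child A B) :
    GNode θ (.node A) := by
  obtain ⟨R, hR, hB⟩ := hB
  exact ⟨R, hR, h.sub.trans hB⟩

theorem Root.gnode {θ : Net L} {R : Fml L} (h : Root θ R) : GNode θ (.node R) := ⟨R, h, .refl R⟩

theorem GArc.gnode_left {θ : Net L} {a b : GVert L} (h : GArc θ a b) : GNode θ a := by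
  cases h with
  | child A B hB h => exact hB.child h
  | cut A c hc h => exact ⟨A, Or.inr ⟨c, hc, h⟩, .refl A⟩
  | leap v u A h hv => exact h.1.gnode hv

theorem GArc.gnode_right {θ : Net L} {a b : GVert L} (h : GArc θ a b) : GNode θ b := by
  cases h with
  | child A B hB h => exact hB
  | cut A c hc h => exact hc
  | leap v u A h hv => exact h.2.1.1

/-- A parent of a root contains its leaves, so by distinctness of names it lies in that root itself,
against the sizes. -/
theorem not_child_root {θ : Net L} (hθ : θ.names.Nodup) {R B : Fml L} (hR : Root θ R)
    (hB : GNode θ (.node B)) : ¬ Child R B := by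
  intro h
  obtain ⟨R', hR', hB⟩ := hB
  obtain ⟨l, hl⟩ := exists_mem_names R
  have := root_unique hθ hR hR' hl (hB.names_subset (h.names_subset hl))
  subst this
  have := h.size_lt
  have := hB.size_le
  omega

/-! ### Switchings of the contracted graph -/

/-- Deleting the single edge chosen at `v₀` from a connected graph leaves every vertex connected to
one of its two ends. -/
theorem GSwitching.conn_or {θ : Net L} {g : GVert L → GVert L}
    (hcon : ∀ u v, GNode θ u → GNode θ v → GConn θ g ∅ u v) {v₀ : GVert L}
    (hv₀ : GNode θ v₀) (hs : GSwitched v₀) {u : GVert L} (hu : GNode θ u) :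
    GConn θ g {v₀} u v₀ ∨ GConn θ g {v₀} u (g v₀) := by
  have key : ∀ u v, GConn θ g ∅ u v → ((GConn θ g {v₀} u v₀ ∨ GConn θ g {v₀} u (g v₀)) ↔
      (GConn θ g {v₀} v v₀ ∨ GConn θ g {v₀} v (g v₀))) := by
    intro u v h
    induction h with
    | rel u v h =>
      by_cases hv : GEdge θ g {v₀} u v
      · have h1 : GConn θ g {v₀} u v := .rel _ _ hv
        exact ⟨fun h => h.imp (h1.symm.trans _ _ _) (h1.symm.trans _ _ _),
          fun h => h.imp (h1.trans _ _ _) (h1.trans _ _ _)⟩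
      · have : v = v₀ ∧ u = g v₀ := by
          by_contra hne
          rcases h with h | ⟨h, -, h'⟩
          · exact hv (Or.inl h)
          · refine hv (Or.inr ⟨h, fun hv' => hne ?_, h'⟩)
            cases hv'
            exact ⟨rfl, (h' hs).symm⟩
        rw [this.1, this.2]
        exact ⟨fun _ => Or.inl (.refl _), fun _ => Or.inr (.refl _)⟩
    | refl u => rfl
    | symm u v _ ih => exact ih.symm
    | trans u v w _ _ ih ih' => exact ih.trans ih'
  exact (key _ _ (hcon u v₀ hu hv₀)).2 (Or.inl (.refl _))

/-- Without the edge chosen by the switching at `v₀`, the sources of all edges into `v₀` are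
connected. -/
theorem GSwitching.conn_of_arc {θ : Net L} {g : GVert L → GVert L} (hg : GSwitching θ g)
    (hcon : ∀ g, GSwitching θ g → ∀ u v, GNode θ u → GNode θ v → GConn θ g ∅ u v)
    (hbr : GBridges θ) {v₀ u : GVert L} (hs : GSwitched v₀) (hu : GArc θ u v₀) :
    GConn θ g {v₀} (g v₀) u := by
  classical
  have hv₀ := hu.gnode_right
  -- Choosing `u` instead at `v₀` does not affect the graph without edges into `v₀`. As the new
  -- switching is connected, `g v₀` lies on the side of `v₀` or of `u`; the former is impossible,
  -- because the edge from `g v₀` is a bridge.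
  let g' := Function.update g v₀ u
  have hg' : GSwitching θ g' := by
    intro v hv hvs
    by_cases h : v = v₀
    · subst h
      simpa [g'] using hu
    · simpa [g', h] using hg v hv hvs
  have heq : GConn θ g' {v₀} = GConn θ g {v₀} := by
    have : GEdge θ g' {v₀} = GEdge θ g {v₀} := by
      funext a b
      by_cases h : b = v₀
      · simp [GEdge, h]
      · simp [GEdge, g', h]
    rw [GConn, GConn, this]
  have := GSwitching.conn_or (hcon g' hg') hv₀ hs (hg v₀ hv₀ hs).gnode_left
  rw [heq] at this
  rcases this with h | h
  · exact absurd h (hbr g hg v₀ hv₀ hs)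
  · simpa [g'] using h

/-- If the removal of a bridge separates from a set `H` a part of `a`, then this part is connected in
every graph which contains the edges that avoid `H`. -/
theorem eqvGen_of_avoid {V : Type*} {G N : V → V → Prop} {H : Set V} {p a : V}
    (hH : ∀ u ∈ H, EqvGen G u p)
    (hN : ∀ u v, G u v → u ∉ H → v ∉ H → EqvGen N u v)
    (hpa : ¬ EqvGen G a p) (v : V) (hv : EqvGen G a v) : EqvGen N v a := by
  have h1 : ∀ u v, EqvGen G u v → ¬ EqvGen G u p → EqvGen N u v := by
    intro u v h
    induction h with
    | rel u v h =>
      intro hu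
      refine hN u v h (fun hH' => hu (hH u hH')) fun hH' => hu ?_
      exact (EqvGen.rel _ _ h).trans _ _ _ (hH v hH')
    | refl u => exact fun _ => .refl u
    | symm u v h ih => exact fun hv => (ih fun hu => hv (h.symm.trans _ _ _ hu)).symm
    | trans u v w h _ ih ih' =>
      exact fun hu => (ih hu).trans _ _ _ (ih' fun hv => hu (h.trans _ _ _ hv))
  exact (h1 a v hv hpa).symm

/-- If all vertices are connected in `G` with the set `H` or with `a`, then they are connected with
`a` in every graph which contains the edges that avoid `H` and connects the neighbours of `H` with
`a`. -/
theorem eqvGen_of_contract {V : Type*} {G N : V → V → Prop} {H S : Set V} {p a : V} (hp : p ∈ H)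
    (hN : ∀ u v, G u v → u ∉ H → v ∉ H → EqvGen N u v)
    (ha : ∀ v, EqvGen G a v → EqvGen N v a)
    (hS : ∀ u ∈ S, EqvGen G u p ∨ EqvGen G u a)
    (hadj : ∀ u v, G u v ∨ G v u → u ∈ H → v ∉ H → EqvGen N v a) :
    ∀ u ∈ S, u ∉ H → EqvGen N u a := by
  have h3 : ∀ u v, EqvGen G u v → ((u ∈ H ∨ EqvGen N u a) ↔ (v ∈ H ∨ EqvGen N v a)) := by
    intro u v h
    induction h with
    | rel u v h =>
      by_cases hu : u ∈ H <;> by_cases hv : v ∈ H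
      · simp [hu, hv]
      · simp [hu, hadj u v (Or.inl h) hu hv]
      · simp [hv, hadj v u (Or.inr h) hv hu]
      · have := hN u v h hu hv
        simp only [hu, hv, false_or]
        exact ⟨this.symm.trans _ _ _, this.trans _ _ _⟩
    | refl u => rfl
    | symm u v _ ih => exact ih.symm
    | trans u v w _ _ ih ih' => exact ih.trans ih'
  intro u hu huH
  rcases hS u hu with h | h
  · exact ((h3 u p h).2 (Or.inl hp)).resolve_left huH
  · exact ha u h.symm

/-! ### Reduction of a cut between a non-switched and a switched formula -/

/-- The reduction of the cut `c₀` between the formula `T`, which is not switched, and the formula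
`P`, which is switched, to the cuts `cs`. -/
structure GReduction (θ θ' : Net L) (c₀ : Fml L × Fml L) (cs : List (Fml L × Fml L))
    (T P : Fml L) : Prop where
  nodup : θ.names.Nodup
  mem : c₀ ∈ θ.cuts
  sides : ∀ R, (R = c₀.1 ∨ R = c₀.2) ↔ R = T ∨ R = P
  not_switched : ¬ GSwitched (.node T)
  switched : GSwitched (.node P)
  not_atom : ∀ (l n : ℕ) (Q : L.Relations n) (ts : Fin n → L.Term ℕ), T ≠ .atom l Q ts
  node : ∀ Q, GNode θ' (.node Q) ↔ GNode θ (.node Q) ∧ Q ≠ T ∧ Q ≠ P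
  cuts : ∀ c, c ∈ θ'.cuts ↔ c ∈ cs ∨ (c ∈ θ.cuts ∧ c ≠ c₀)
  childP : ∀ c ∈ cs, ∃ Q, Child Q P ∧ (Q = c.1 ∨ Q = c.2)
  childT : ∀ Q, Child Q T → ∃ c ∈ cs, Q = c.1 ∨ Q = c.2
  links : θ'.links = θ.links

namespace GReduction

variable {θ θ' : Net L} {c₀ : Fml L × Fml L} {cs : List (Fml L × Fml L)} {T P : Fml L}

theorem rootT (h : GReduction θ θ' c₀ cs T P) : Root θ T :=
  Or.inr ⟨c₀, h.mem, (h.sides T).2 (Or.inl rfl)⟩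

theorem rootP (h : GReduction θ θ' c₀ cs T P) : Root θ P :=
  Or.inr ⟨c₀, h.mem, (h.sides P).2 (Or.inr rfl)⟩

theorem cut_eq (h : GReduction θ θ' c₀ cs T P) {R : Fml L} (hR : R = T ∨ R = P)
    {c : Fml L × Fml L} (hc : c ∈ θ.cuts) (hRc : R = c.1 ∨ R = c.2) : c = c₀ := by
  obtain ⟨l, hl⟩ := exists_mem_names R
  refine cut_unique h.nodup hc h.mem (l := l) ?_ ?_
  · rcases hRc with rfl | rfl <;> simp [cutNames, hl]
  · rcases (h.sides R).2 hR with rfl | rfl <;> simp [cutNames, hl]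

/-- The vertices which are contracted. -/
def core (_ : GReduction θ θ' c₀ cs T P) : Set (GVert L) := {.node T, .node P, .hub c₀}

theorem gnode_of_not_mem (h : GReduction θ θ' c₀ cs T P) {a : GVert L} (ha : GNode θ a)
    (hc : a ∉ h.core) : GNode θ' a := by
  cases a with
  | node Q => exact (h.node Q).2 ⟨ha, fun hQ => hc (by simp [core, hQ]), fun hQ => hc (by simp [core, hQ])⟩
  | hub c => exact (h.cuts c).2 (Or.inr ⟨ha, fun hQ => hc (by simp [core, hQ])⟩)

theorem gnode_of_gnode (h : GReduction θ θ' c₀ cs T P) {a : GVert L} (ha : GNode θ' a) :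
    (∃ c ∈ cs, a = .hub c) ∨ (GNode θ a ∧ a ∉ h.core) := by
  cases a with
  | node Q =>
    have := (h.node Q).1 ha
    exact Or.inr ⟨this.1, by simp [core, this.2.1, this.2.2]⟩
  | hub c =>
    rcases (h.cuts c).1 ha with hc | ⟨hc, hne⟩
    · exact Or.inl ⟨c, hc, rfl⟩
    · exact Or.inr ⟨hc, by simp [core, hne]⟩

/-- The reduction preserves connectedness of switchings, if the leaps of the reduct come from the
graph of the redex in the way described by `hleap`. -/
theorem connected (h : GReduction θ θ' c₀ cs T P)
    (hcon : ∀ g, GSwitching θ g → ∀ u v, GNode θ u → GNode θ v → GConn θ g ∅ u v)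
    (hbr : GBridges θ)
    (hleap : ∀ u v, GSwitched v → GArc θ' u v → ∃ s, GArc θ s v ∧
      ((s ∈ h.core ∧ ∃ c ∈ cs, u = .hub c) ∨ (s = u ∧ s ∉ h.core) ∨
        (s ∈ h.core ∧ u ∉ h.core ∧ GArc θ u (.node P))))
    (g' : GVert L → GVert L) (hg' : GSwitching θ' g') (u v : GVert L) (hu : GNode θ' u)
    (hv : GNode θ' v) : GConn θ' g' ∅ u v := by
  classical
  -- Any child will do as a base point, since all children of `P` are on the same side of the bridge
  -- into `P`.
  obtain ⟨A, hA⟩ : ∃ A, Child A P := by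
    have := h.switched
    generalize P = P at this
    cases this with
    | par A B => exact ⟨A, .parLeft _ _⟩
    | all x A => exact ⟨A, .all _ _⟩
  have hP := h.rootP.gnode
  -- `s v` is the source of an edge of the redex that accounts for the edge chosen by `g'` at `v`.
  -- The switching `g` of the redex is assembled from these sources.
  choose s hs using fun v : {v // GSwitched v ∧ GNode θ' v} =>
    hleap (g' v.1) v.1 v.2.1 (hg' v.1 v.2.2 v.2.1)
  let g : GVert L → GVert L := fun v =>
    if hv : GSwitched v ∧ GNode θ' v then s ⟨v, hv⟩ else .node A
  have hPn : ¬ GNode θ' (.node P) := fun hP' => ((h.node P).1 hP').2.2 rfl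
  have hgP : g (.node P) = .node A := dif_neg fun hv => hPn hv.2
  have hgs : ∀ v, GSwitched v → GNode θ v → v ≠ .node P → GNode θ' v := by
    intro v hvs hv hvP
    refine h.gnode_of_not_mem hv ?_
    rintro (rfl | rfl | rfl)
    · exact h.not_switched hvs
    · exact hvP rfl
    · cases hvs
  have hg : GSwitching θ g := by
    intro v hv hvs
    by_cases hvP : v = .node P
    · subst hvP
      rw [hgP]
      exact .child _ _ hP hA
    · have hv' := hgs v hvs hv hvP
      simp only [g]
      rw [dif_pos ⟨hvs, hv'⟩]
      exact (hs ⟨v, hvs, hv'⟩).1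
  have hedge : ∀ v, GSwitched v → GNode θ' v → GEdge θ' g' ∅ (g' v) v := fun v hvs hv =>
    Or.inr ⟨hg' v hv hvs, by simp, fun _ => rfl⟩
  have h1 := hg (.node P) hP h.switched
  rw [hgP] at h1
  have hbrP := hbr g hg (.node P) hP h.switched
  rw [hgP] at hbrP
  have hcP : ∀ R, (R = T ∨ R = P) → GEdge θ g {.node P} (.node R) (.hub c₀) := fun R hR =>
    Or.inr ⟨.cut R c₀ h.mem ((h.sides R).2 hR), by simp, by rintro ⟨⟩⟩
  have hS : ∀ u ∈ {u | GNode θ u}, GConn θ g {.node P} u (.node P) ∨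
      GConn θ g {.node P} u (.node A) := by
    intro u hu
    have := GSwitching.conn_or (hcon g hg) hP h.switched hu
    rwa [hgP] at this
  -- The path from `T` through the hub to `P` does not use an edge into `P`, so the whole core is on
  -- the side of `P`.
  have hH : ∀ u ∈ h.core, GConn θ g {.node P} u (.node P) := by
    have h0 := EqvGen.symm _ _ (.rel _ _ (hcP P (Or.inr rfl)))
    rintro u (rfl | rfl | rfl)
    · exact EqvGen.trans _ _ _ (.rel _ _ (hcP T (Or.inl rfl))) h0
    · exact .refl _
    · exact h0
  have hN : ∀ u v, GEdge θ g {.node P} u v → u ∉ h.core → v ∉ h.core → GConn θ' g' ∅ u v := by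
    intro u v huv hu hv
    refine .rel _ _ ?_
    rcases huv with ⟨hu', hv', hl⟩ | ⟨harc, -, hk⟩
    · left
      rw [← h.links] at hl
      exact ⟨h.gnode_of_not_mem hu' hu, h.gnode_of_not_mem hv' hv, hl⟩
    · have hv' := h.gnode_of_not_mem harc.gnode_right hv
      by_cases hvs : GSwitched v
      · have hk := hk hvs
        simp only [g] at hk
        rw [dif_pos ⟨hvs, hv'⟩] at hk
        obtain ⟨-, ⟨h2, -⟩ | ⟨h2, -⟩ | ⟨h2, -⟩⟩ := hs ⟨v, hvs, hv'⟩
        · exact absurd (hk ▸ h2) hu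
        · rw [hk] at h2
          rw [h2]
          exact hedge v hvs hv'
        · exact absurd (hk ▸ h2) hu
      · right
        refine ⟨?_, by simp, fun h => absurd h hvs⟩
        cases harc with
        | child A B hB hAB => exact .child A B hv' hAB
        | cut A c hc hA => exact .cut A c hv' hA
        | leap v u A hp _ =>
          obtain ⟨x, B, rfl⟩ := hp.2.1.2
          exact absurd (.all x B) hvs
  -- By the bridge property the side of `A` avoids the core, hence it survives in the reduct.
  have hA' := eqvGen_of_avoid hH hN fun hAP => hbrP hAP
  -- Each new cut has a child of `P` on one side, and this child is connected to `A`.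
  have hcs : ∀ c ∈ cs, GConn θ' g' ∅ (.hub c) (.node A) := by
    intro c hc
    obtain ⟨Q, hQ, hQc⟩ := h.childP c hc
    have h1 := hg.conn_of_arc hcon hbr h.switched (.child Q P hP hQ)
    rw [hgP] at h1
    refine EqvGen.trans _ _ _ (.symm _ _ (.rel _ _ (Or.inr ⟨.cut Q c ?_ hQc, by simp, ?_⟩)))
      (hA' _ h1)
    · exact (h.cuts c).2 (Or.inl hc)
    · rintro ⟨⟩
  -- The outside neighbours of the core are children of `T`, which now hang on a new hub, and
  -- targets of leaps. A target of a leap is attached by `g'` to a new hub or to the source of an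
  -- edge into `P`, hence to the side of `A`.
  have hadj : ∀ u v, GEdge θ g {.node P} u v ∨ GEdge θ g {.node P} v u → u ∈ h.core → v ∉ h.core →
        GConn θ' g' ∅ v (.node A) := by
    intro u v huv hu hv
    have hlk : ∀ w, ¬ GLink θ u w ∧ ¬ GLink θ w u := by
      intro w
      have : ∀ (l n : ℕ) (Q : L.Relations n) (ts : Fin n → L.Term ℕ), u ≠ .node (.atom l Q ts) := by
        rintro l n Q ts rfl
        rcases hu with hu | hu | hu
        · injection hu with hu
          exact h.not_atom _ _ _ _ hu.symm
        · injection hu with hu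
          have := h.switched
          rw [← hu] at this
          cases this
        · cases hu
      constructor
      · rintro ⟨-, -, l, m, n, n', P, Q, ts, us, h1, h2, -⟩
        exact this _ _ _ _ h1
      · rintro ⟨-, -, l, m, n, n', P, Q, ts, us, h1, h2, -⟩
        exact this _ _ _ _ h2
    have hout : ∀ (hvs : GSwitched v), GNode θ v → g v ∈ h.core → GConn θ' g' ∅ v (.node A) := by
      intro hvs hvn hgv
      have hv' := h.gnode_of_not_mem hvn hv
      simp only [g] at hgv
      rw [dif_pos ⟨hvs, hv'⟩] at hgv
      have he : GConn θ' g' ∅ v (g' v) := .symm _ _ (.rel _ _ (hedge v hvs hv'))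
      obtain ⟨-, ⟨-, c, hc, h2⟩ | ⟨-, h2⟩ | ⟨-, h2, h3⟩⟩ := hs ⟨v, hvs, hv'⟩
      · rw [h2] at he
        exact he.trans _ _ _ (hcs c hc)
      · exact absurd hgv h2
      · refine he.trans _ _ _ (hA' _ ?_)
        have := hg.conn_of_arc hcon hbr h.switched h3
        rwa [hgP] at this
    rcases huv with (hl | ⟨harc, hX, hk⟩) | (hl | ⟨harc, hX, hk⟩)
    · exact absurd hl (hlk v).1
    · have hroot : ∀ R, u = .node R → R = T ∨ R = P := by
        rintro R rfl
        rcases hu with hu | hu | hu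
        · injection hu with hu
          exact Or.inl hu
        · injection hu with hu
          exact Or.inr hu
        · cases hu
      cases harc with
      | child Q B hB hQB =>
        exfalso
        rcases hroot Q rfl with rfl | rfl
        · exact not_child_root h.nodup h.rootT hB hQB
        · exact not_child_root h.nodup h.rootP hB hQB
      | cut Q c hc hQ =>
        exact absurd (by rw [h.cut_eq (hroot Q rfl) hc hQ]; simp [core]) hv
      | leap w u Q hp hw =>
        obtain ⟨x, B, rfl⟩ := hp.2.1.2
        refine hout (.all x B) hp.2.1.1 ?_
        rw [hk (.all x B)]
        exact hu
    · exact absurd hl (hlk v).2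
    · rcases hu with rfl | rfl | rfl
      · cases harc with
        | child Q B hB hQB =>
          obtain ⟨c, hc, hQ⟩ := h.childT Q hQB
          refine EqvGen.trans _ _ _ (.rel _ _ (Or.inr ⟨.cut Q c ((h.cuts c).2 (Or.inl hc)) hQ,
            by simp, ?_⟩)) (hcs c hc)
          rintro ⟨⟩
        | leap w u Q hp hw =>
          obtain ⟨x, B, rfl⟩ := hp.2.1.2
          exact absurd (.all x B) h.not_switched
      · exact absurd rfl hX
      · cases harc with
        | cut Q c hc hQ =>
          refine absurd ?_ hv
          rcases (h.sides Q).1 hQ with rfl | rfl <;> simp [core]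
  have key : ∀ u, GNode θ' u → GConn θ' g' ∅ u (.node A) := by
    intro u hu
    rcases h.gnode_of_gnode hu with ⟨c, hc, rfl⟩ | ⟨hu, huc⟩
    · exact hcs c hc
    · have hp : GVert.node P ∈ h.core := by simp [core]
      exact eqvGen_of_contract hp hN hA' hS hadj u hu huc
  exact (key u hu).trans _ _ _ (key v hv).symm

end GReduction

/-! ### Replacing a cut -/

theorem rest_disjoint {Γ : List (Fml L)} {pre post : List (Fml L × Fml L)} {c₀ : Fml L × Fml L}
    {Λ : Finset (Sym2 ℕ)} (h : (Net.mk Γ (pre ++ c₀ :: post) Λ).names.Nodup) {c : Fml L × Fml L}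
    (hc : c ∈ pre ++ post) {l : ℕ} (hl : l ∈ cutNames c) (hl₀ : l ∈ cutNames c₀) : False := by
  have h1 := (List.nodup_append.1 h).2.1
  have h2 : ((c₀ :: (pre ++ post)).flatMap cutNames).Nodup :=
    (List.Perm.flatMap_right cutNames List.perm_middle).nodup_iff.1 h1
  rw [List.flatMap_cons, List.nodup_append] at h2
  exact h2.2.2 l hl₀ l (List.mem_flatMap.2 ⟨c, hc, hl⟩) rfl

theorem exists_mem_cutNames (c : Fml L × Fml L) : ∃ l, l ∈ cutNames c := by
  obtain ⟨l, hl⟩ := exists_mem_names c.1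
  exact ⟨l, List.mem_append_left _ hl⟩

/-- Only the two cut formulas and their hub disappear as vertices: by distinctness of names they
occur nowhere else, and their proper subformulas are those of the new cuts. -/
theorem GReduction.of_cuts {Γ : List (Fml L)} {pre post cs : List (Fml L × Fml L)}
    {c₀ : Fml L × Fml L} {Λ : Finset (Sym2 ℕ)} {T P : Fml L}
    (hnd : (Net.mk Γ (pre ++ c₀ :: post) Λ).names.Nodup)
    (hsides : c₀ = (T, P) ∨ c₀ = (P, T)) (hT : ¬ GSwitched (.node T)) (hP : GSwitched (.node P))
    (hTa : ∀ (l n : ℕ) (Q : L.Relations n) (ts : Fin n → L.Term ℕ), T ≠ .atom l Q ts)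
    (hcs : ∀ c ∈ cs, ∀ Q, (Q = c.1 ∨ Q = c.2) → Child Q T ∨ Child Q P)
    (hcP : ∀ c ∈ cs, ∃ Q, Child Q P ∧ (Q = c.1 ∨ Q = c.2))
    (hPc : ∀ Q, Child Q P → ∃ c ∈ cs, Q = c.1 ∨ Q = c.2)
    (hTc : ∀ Q, Child Q T → ∃ c ∈ cs, Q = c.1 ∨ Q = c.2) :
    GReduction ⟨Γ, pre ++ c₀ :: post, Λ⟩ ⟨Γ, pre ++ (cs ++ post), Λ⟩ c₀ cs T P := by
  have hs : ∀ R, (R = c₀.1 ∨ R = c₀.2) ↔ R = T ∨ R = P := by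
    intro R
    rcases hsides with rfl | rfl
    · rfl
    · exact or_comm
  have hmem : ∀ c, c ∈ pre ++ c₀ :: post ↔ c = c₀ ∨ c ∈ pre ++ post := fun c => by
    simp only [List.mem_append, List.mem_cons]; tauto
  have hmem' : ∀ c, c ∈ pre ++ (cs ++ post) ↔ c ∈ cs ∨ c ∈ pre ++ post := fun c => by
    simp only [List.mem_append]; tauto
  have hne : ∀ c ∈ pre ++ post, c ≠ c₀ := by
    rintro c hc rfl
    obtain ⟨l, hl⟩ := exists_mem_cutNames c
    exact rest_disjoint hnd hc hl hl
  have hTr : Root (Net.mk Γ (pre ++ c₀ :: post) Λ) T := Or.inr ⟨c₀, by simp, (hs T).2 (Or.inl rfl)⟩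
  have hPr : Root (Net.mk Γ (pre ++ c₀ :: post) Λ) P := Or.inr ⟨c₀, by simp, (hs P).2 (Or.inr rfl)⟩
  have hTP : T ≠ P := by
    rintro rfl
    exact hT hP
  have hrest : ∀ R, (R ∈ Γ ∨ ∃ c ∈ pre ++ post, R = c.1 ∨ R = c.2) → ∀ Q, Sub Q R → Q ≠ T ∧ Q ≠ P := by
    intro R hR Q hQ
    by_contra hne
    have hQ' : Q = c₀.1 ∨ Q = c₀.2 := by
      rw [hs]; tauto
    obtain ⟨l, hl⟩ := exists_mem_names Q
    have hl₀ : l ∈ cutNames c₀ := by rcases hQ' with rfl | rfl <;> simp [cutNames, hl]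
    have hl' := hQ.names_subset hl
    rcases hR with hR | ⟨c, hc, hR⟩
    · exact concl_cut_disjoint hnd hR (by simp) hl' hl₀
    · exact rest_disjoint hnd hc (l := l) (by rcases hR with rfl | rfl <;> simp [cutNames, hl']) hl₀
  refine ⟨hnd, by simp, hs, hT, hP, hTa, ?_, ?_, hcP, hTc, rfl⟩
  · intro Q
    constructor
    · rintro ⟨R, hR, hQ⟩
      have : (∃ c ∈ cs, R = c.1 ∨ R = c.2) ∨ (R ∈ Γ ∨ ∃ c ∈ pre ++ post, R = c.1 ∨ R = c.2) := by
        rcases hR with hR | ⟨c, hc, hR⟩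
        · exact Or.inr (Or.inl hR)
        · rcases (hmem' c).1 hc with hc | hc
          · exact Or.inl ⟨c, hc, hR⟩
          · exact Or.inr (Or.inr ⟨c, hc, hR⟩)
      rcases this with ⟨c, hc, hR⟩ | hR
      · have hRTP : ∃ X, Root (Net.mk Γ (pre ++ c₀ :: post) Λ) X ∧ Child R X := by
          rcases hcs c hc R hR with h | h
          · exact ⟨T, hTr, h⟩
          · exact ⟨P, hPr, h⟩
        obtain ⟨X, hX, hRX⟩ := hRTP
        have hsub := hQ.trans hRX.sub
        have hroot : ∀ Y, Root (Net.mk Γ (pre ++ c₀ :: post) Λ) Y → Q ≠ Y := by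
          rintro Y hY rfl
          obtain ⟨l, hl⟩ := exists_mem_names Q
          have := root_unique hnd hY hX hl (hsub.names_subset hl)
          subst this
          have := hQ.size_le
          have := hRX.size_lt
          omega
        exact ⟨⟨X, hX, hsub⟩, hroot T hTr, hroot P hPr⟩
      · refine ⟨⟨R, ?_, hQ⟩, hrest R hR Q hQ⟩
        rcases hR with hR | ⟨c, hc, hR⟩
        · exact Or.inl hR
        · exact Or.inr ⟨c, (hmem c).2 (Or.inr hc), hR⟩
    · rintro ⟨⟨R, hR | ⟨c, hc, hR⟩, hQ⟩, hQT, hQP⟩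
      · exact ⟨R, Or.inl hR, hQ⟩
      · rcases (hmem c).1 hc with rfl | hc
        · rcases sub_iff.1 hQ with rfl | ⟨B, hB, hQ⟩
          · rcases (hs _).1 hR with rfl | rfl
            · exact absurd rfl hQT
            · exact absurd rfl hQP
          · have : ∃ c ∈ cs, B = c.1 ∨ B = c.2 := by
              rcases (hs _).1 hR with rfl | rfl
              · exact hTc B hB
              · exact hPc B hB
            obtain ⟨c, hc, hB⟩ := this
            exact ⟨B, Or.inr ⟨c, (hmem' c).2 (Or.inl hc), hB⟩, hQ⟩
        · exact ⟨R, Or.inr ⟨c, (hmem' c).2 (Or.inr hc), hR⟩, hQ⟩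
  · intro c
    simp only [hmem, hmem']
    constructor
    · rintro (h | h)
      · exact Or.inl h
      · exact Or.inr ⟨Or.inr h, hne c h⟩
    · rintro (h | ⟨h | h, h'⟩)
      · exact Or.inl h
      · exact absurd h h'
      · exact Or.inr h

/-! ### Renaming variables -/

def GLeaf.map (f : GVar L → GVar L) (o : GLeaf L) : GLeaf L :=
  ⟨o.name, o.terms.map fun t => t.relabel f⟩

theorem relabel_subst {α β γ : Type*} (f : α → β) (σ : β → L.Term γ) (t : L.Term α) :
    (t.relabel f).subst σ = t.subst fun v => σ (f v) := by
  rw [relabel_eq_subst, subst_subst]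
  rfl

theorem relabel_congr {α β : Type*} {f g : α → β} (t : L.Term α)
    (h : ∀ v, Occ v t → f v = g v) : t.relabel f = t.relabel g := by
  rw [relabel_eq_subst, relabel_eq_subst]
  exact subst_congr t fun v hv => by rw [h v hv]

/-- A renaming that fixes the variables bound inside a formula acts on its leaves through the
environment alone. -/
theorem gleaves_map {f : GVar L → GVar L} {A : Fml L} {e e' : ℕ → GVar L}
    (he : ∀ x ∈ A.freeVars, f (e x) = e' x) (hf : ∀ Q, Sub Q A → f (.bound Q) = .bound Q) :
    (A.gleaves e).map (GLeaf.map f) = A.gleaves e' := by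
  induction A generalizing e e' with
  | atom l P ts =>
    simp only [Fml.gleaves, List.map_cons, List.map_nil, GLeaf.map, List.map_ofFn]
    congr 3
    funext k
    simp only [Function.comp, Term.relabel_relabel]
    refine relabel_congr _ fun v hv => he v ?_
    simp only [Fml.freeVars, Finset.mem_biUnion, Finset.mem_univ, true_and]
    exact ⟨k, (mem_varFinset _).2 hv⟩
  | tensor A B ihA ihB =>
    simp only [Fml.gleaves, List.map_append]
    rw [ihA (fun x hx => he x (by simp [Fml.freeVars, hx])) fun Q hQ => hf Q (sub_tensor.2 (by simp [hQ])),
      ihB (fun x hx => he x (by simp [Fml.freeVars, hx])) fun Q hQ => hf Q (sub_tensor.2 (by simp [hQ]))]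
  | par A B ihA ihB =>
    simp only [Fml.gleaves, List.map_append]
    rw [ihA (fun x hx => he x (by simp [Fml.freeVars, hx])) fun Q hQ => hf Q (sub_par.2 (by simp [hQ])),
      ihB (fun x hx => he x (by simp [Fml.freeVars, hx])) fun Q hQ => hf Q (sub_par.2 (by simp [hQ]))]
  | all x A ih =>
    refine ih (fun z hz => ?_) fun Q hQ => hf Q (sub_all.2 (Or.inr hQ))
    by_cases hzx : z = x
    · subst hzx; simpa using hf _ (.refl _)
    · simp [hzx, he z (by simp [Fml.freeVars, hz, hzx])]
  | ex x A ih =>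
    refine ih (fun z hz => ?_) fun Q hQ => hf Q (sub_ex.2 (Or.inr hQ))
    by_cases hzx : z = x
    · subst hzx; simpa using hf _ (.refl _)
    · simp [hzx, he z (by simp [Fml.freeVars, hz, hzx])]

theorem gleaves_child {A B : Fml L} (h : Child A B) (hB : (∃ A' B', B = .tensor A' B') ∨ ∃ A' B', B = .par A' B')
    {e : ℕ → GVar L} : A.gleaves e ⊆ B.gleaves e := by
  cases h <;> simp_all [Fml.gleaves]

/-- `f` embeds the unification problem of `θ'` into that of `θ`. -/
structure GPull (θ θ' : Net L) (f : GVar L → GVar L) : Prop where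
  free : ∀ x, f (.free x) = .free x
  bound : ∀ A, f (.bound A) = .bound A
  cut : ∀ c x, ∃ c', f (.cut c x) = .cut c' x
  leaf : ∀ o ∈ θ'.gleaves, o.map f ∈ θ.gleaves
  all : ∀ A, GAll θ' A ↔ GAll θ A
  eq : ∀ τ, GUnifier θ τ → ∀ o ∈ θ'.gleaves, ∀ o' ∈ θ'.gleaves, s(o.name, o'.name) ∈ θ'.links →
    ((o.map f).terms.map fun t => t.subst τ) = (o'.map f).terms.map fun t => t.subst τ

namespace GPull

variable {θ θ' : Net L} {f : GVar L → GVar L}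

theorem occurs (h : GPull θ θ' f) {v : GVar L} (hv : GOccurs θ' v) : GOccurs θ (f v) := by
  obtain ⟨o, ho, t, ht, hv⟩ := hv
  exact ⟨_, h.leaf o ho, _, List.mem_map_of_mem ht, (occ_relabel _ _).2 ⟨v, hv, rfl⟩⟩

theorem gex (h : GPull θ θ' f) {v : GVar L} (hv : GEx θ' v) : GEx θ (f v) := by
  refine ⟨h.occurs hv.1, ?_⟩
  rcases hv.2 with ⟨x, A, rfl⟩ | ⟨c, x, rfl⟩
  · exact Or.inl ⟨x, A, h.bound _⟩
  · obtain ⟨c', hc'⟩ := h.cut c x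
    exact Or.inr ⟨c', x, hc'⟩

-- Unifiers pull back along `f`, because every equation of `θ'` becomes under `f` an equation that
-- `τ` solves.
open Classical in
theorem unifier (h : GPull θ θ' f) {τ : GVar L → L.Term (GVar L)} (hτ : GUnifier θ τ) :
    GUnifier θ' fun v => if GEx θ' v then τ (f v) else .var v := by
  refine ⟨fun v hv => if_neg hv, ?_, ?_⟩
  · intro v hv w hw
    rw [if_pos hv] at hw
    simpa only [h.all] using hτ.range _ (h.gex hv) w hw
  · have key : ∀ o ∈ θ'.gleaves, (o.terms.map fun t => t.subst fun v =>
        if GEx θ' v then τ (f v) else .var v) = (o.map f).terms.map fun t => t.subst τ := by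
      intro o ho
      simp only [GLeaf.map, List.map_map]
      refine List.map_congr_left fun t ht => ?_
      simp only [Function.comp, relabel_subst]
      refine subst_congr t fun v hv => ?_
      split_ifs with hvx
      · rfl
      · have hocc : GOccurs θ' v := ⟨o, ho, t, ht, hv⟩
        rcases hocc.cases with ⟨x, rfl⟩ | ⟨c, hc, x, rfl, -⟩ | ⟨Q, rfl, -, ⟨x, B, rfl⟩ | ⟨x, B, rfl⟩⟩
        · rw [h.free, hτ.fixes]
          rintro ⟨-, ⟨_, _, h⟩ | ⟨_, _, h⟩⟩ <;> cases h
        · exact absurd ⟨hocc, Or.inr ⟨c, x, rfl⟩⟩ hvx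
        · rw [h.bound, hτ.fixes]
          rintro ⟨-, ⟨_, _, h⟩ | ⟨_, _, h⟩⟩ <;> cases h
        · exact absurd ⟨hocc, Or.inl ⟨x, B, rfl⟩⟩ hvx
    intro o ho o' ho' hl
    rw [key o ho, key o' ho']
    exact h.eq τ hτ o ho o' ho' hl

/-- A leap quantifies over all unifiers. As unifiers of `θ` pull back to `θ'`, leaps of `θ'` push
forward to `θ`. -/
theorem precedes (h : GPull θ θ' f) {v : GVar L} {A : Fml L} (hv : GPrecedes θ' v A) :
    GPrecedes θ (f v) A := by
  refine ⟨h.gex hv.1, (h.all A).1 hv.2.1, fun τ hτ => ?_⟩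
  have := hv.2.2 _ (h.unifier hτ)
  rwa [if_pos hv.1] at this

end GPull

/-! ### The multiplicative reduction -/

theorem GReduction.rest_ne {θ θ' : Net L} {c₀ : Fml L × Fml L} {cs : List (Fml L × Fml L)}
    {T P : Fml L} (h : GReduction θ θ' c₀ cs T P)
    (hcs : ∀ c ∈ cs, ∃ Q, (Q = c.1 ∨ Q = c.2) ∧ (Child Q T ∨ Child Q P)) {c : Fml L × Fml L} (hc : c ∈ θ.cuts) :
    c ∉ cs := by
  intro hmem
  obtain ⟨Q, hQ, hQ'⟩ := hcs c hmem
  have hr : Root θ Q := Or.inr ⟨c, hc, hQ⟩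
  rcases hQ' with hQ' | hQ'
  · exact not_child_root h.nodup hr h.rootT.gnode hQ'
  · exact not_child_root h.nodup hr h.rootP.gnode hQ'

/-- Of the two formulas that disappear, `T` is not switched, so only `P` can be universal. -/
theorem GReduction.gall_iff {θ θ' : Net L} {c₀ : Fml L × Fml L} {cs : List (Fml L × Fml L)}
    {T P : Fml L} (h : GReduction θ θ' c₀ cs T P) {Q : Fml L} : GAll θ' Q ↔ GAll θ Q ∧ Q ≠ P := by
  constructor
  · rintro ⟨h1, h2⟩
    have := (h.node Q).1 h1
    exact ⟨⟨this.1, h2⟩, this.2.2⟩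
  · rintro ⟨⟨h1, x, B, rfl⟩, h3⟩
    refine ⟨(h.node _).2 ⟨h1, ?_, h3⟩, x, B, rfl⟩
    rintro rfl
    exact h.not_switched (.all x B)

/-- The multiplicative reduction preserves unifiability and connectedness. -/
theorem GReduction.gconnected_mul {θ θ' : Net L} {c₀ : Fml L × Fml L} {cs : List (Fml L × Fml L)}
    {A B A' B' : Fml L} (h : GReduction θ θ' c₀ cs (.tensor A B) (.par A' B'))
    (hconcl : θ'.concl = θ.concl)
    (hcs : ∀ c ∈ cs, ∀ Q, (Q = c.1 ∨ Q = c.2) → Child Q (.tensor A B) ∨ Child Q (.par A' B'))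
    (hθ : GConnected θ) (hbr : GBridges θ) : GConnected θ' := by
  classical
  -- Each new cut has its own copy of the free variables of the old cut; `f` merges the copies. The
  -- reduct thus has weaker constraints than the redex.
  let f : GVar L → GVar L := fun
    | .free x => .free x
    | .bound A => .bound A
    | .cut c x => if c ∈ cs then .cut c₀ x else .cut c x
  have hT : (Fml.tensor A B) = c₀.1 ∨ Fml.tensor A B = c₀.2 := (h.sides _).2 (Or.inl rfl)
  have hP : (Fml.par A' B') = c₀.1 ∨ Fml.par A' B' = c₀.2 := (h.sides _).2 (Or.inr rfl)
  have hrest : ∀ c ∈ θ.cuts, c ∉ cs := fun c hc =>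
    h.rest_ne (fun c hc => ⟨c.1, Or.inl rfl, hcs c hc _ (Or.inl rfl)⟩) hc
  have hleaf : ∀ o ∈ θ'.gleaves, o.map f ∈ θ.gleaves := by
    · intro o ho
      rcases mem_gleaves.1 ho with ⟨R, hR, ho⟩ | ⟨c, hc, R, hR, ho⟩
      · refine mem_gleaves.2 (Or.inl ⟨R, hconcl ▸ hR, ?_⟩)
        rw [← gleaves_map (f := f) (e := .free) (fun x _ => rfl) fun Q _ => rfl]
        exact List.mem_map_of_mem ho
      · refine mem_gleaves.2 (Or.inr ?_)
        have ho' := List.mem_map_of_mem (f := GLeaf.map f) ho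
        rcases (h.cuts c).1 hc with hc | ⟨hc, hne⟩
        · rw [gleaves_map (f := f) (e := .cut c) (e' := .cut c₀) (fun x _ => if_pos hc) fun Q _ => rfl] at ho'
          rcases hcs c hc R hR with hR | hR
          · exact ⟨c₀, h.mem, _, hT, gleaves_child hR (Or.inl ⟨_, _, rfl⟩) ho'⟩
          · exact ⟨c₀, h.mem, _, hP, gleaves_child hR (Or.inr ⟨_, _, rfl⟩) ho'⟩
        · rw [gleaves_map (f := f) (e := .cut c) (e' := .cut c) (fun x _ => if_neg (hrest c hc)) fun Q _ => rfl] at ho'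
          exact ⟨c, hc, R, hR, ho'⟩
  have hpull : GPull θ θ' f := by
    refine ⟨fun _ => rfl, fun _ => rfl, fun c x => ?_, hleaf, fun Q => ?_, ?_⟩
    · by_cases hc : c ∈ cs
      · exact ⟨c₀, if_pos hc⟩
      · exact ⟨c, if_neg hc⟩
    · rw [h.gall_iff]
      refine ⟨fun h => h.1, fun h => ⟨h, ?_⟩⟩
      obtain ⟨-, x, C, rfl⟩ := h
      simp
    · intro τ hτ o ho o' ho' hl
      exact hτ.eq _ (hleaf o ho) _ (hleaf o' ho') (h.links ▸ hl)
  obtain ⟨⟨τ, hτ⟩, hcon⟩ := hθ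
  refine ⟨⟨_, hpull.unifier hτ⟩, h.connected hcon hbr fun u v hvs harc => ?_⟩
  have hcore : (∀ c ∈ cs, u ≠ .hub c) → u ∉ h.core := fun hu => by
    rcases h.gnode_of_gnode harc.gnode_left with ⟨c, hc, h⟩ | ⟨-, h⟩
    · exact absurd h (hu c hc)
    · exact h
  cases harc with
  | child Q R hR hQR =>
    exact ⟨_, .child Q R ((h.node R).1 hR).1 hQR, Or.inr (Or.inl ⟨rfl, hcore fun c _ => by simp⟩)⟩
  | cut Q c hc hQ => cases hvs
  | leap w u Q hp hw =>
    have hp' := hpull.precedes hp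
    cases hw with
    | bound R =>
      exact ⟨_, .leap _ _ Q hp' (.bound R), Or.inr (Or.inl ⟨rfl, hcore fun c _ => by simp⟩)⟩
    | cut c x =>
      by_cases hc : c ∈ cs
      · have hfc : f (.cut c x) = .cut c₀ x := if_pos hc
        rw [hfc] at hp'
        exact ⟨_, .leap _ _ Q hp' (.cut c₀ x), Or.inl ⟨by simp [core], c, hc, rfl⟩⟩
      · have hfc : f (.cut c x) = .cut c x := if_neg hc
        rw [hfc] at hp'
        refine ⟨_, .leap _ _ Q hp' (.cut c x), Or.inr (Or.inl ⟨rfl, hcore fun c' hc' h => hc ?_⟩)⟩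
        injection h with h
        rwa [h]

/-! ### The quantifier reduction -/

/-- A unifier which contains universal variables only where all unifiers do. -/
def GPrincipal (θ : Net L) : Prop :=
  ∃ τ, GUnifier θ τ ∧ ∀ v A, GEx θ v → GAll θ A → Occ (.bound A) (τ v) → GPrecedes θ v A

/-- The quantifier reduction preserves unifiability and connectedness. -/
theorem GReduction.gconnected_quant {θ θ' : Net L} {c₀ c₁ : Fml L × Fml L} {x : ℕ} {A A' : Fml L}
    (h : GReduction θ θ' c₀ [c₁] (.ex x A) (.all x A'))
    (hconcl : θ'.concl = θ.concl) (hc₁ : c₁ = (A, A') ∨ c₁ = (A', A))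
    (hfv : A.freeVars = A'.freeVars)
    (hθ : GConnected θ) (hpr : GPrincipal θ) (hbr : GBridges θ) : GConnected θ' := by
  classical
  obtain ⟨-, hcon⟩ := hθ
  obtain ⟨τ, hτ, hprec⟩ := hpr
  set X := Fml.ex x A with hX
  set Y := Fml.all x A' with hY
  have hXr := h.rootT
  have hYr := h.rootP
  have hXs : X = c₀.1 ∨ X = c₀.2 := (h.sides _).2 (Or.inl rfl)
  have hYs : Y = c₀.1 ∨ Y = c₀.2 := (h.sides _).2 (Or.inr rfl)
  have hs₁ : ∀ R, (R = c₁.1 ∨ R = c₁.2) ↔ R = A ∨ R = A' := by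
    intro R
    rcases hc₁ with rfl | rfl
    · rfl
    · exact or_comm
  have hc₁n : c₁ ∉ θ.cuts := fun hc => by
    refine h.rest_ne (fun c hc => ?_) hc (List.mem_singleton.2 rfl)
    rw [List.mem_singleton.1 hc]
    exact ⟨A, (hs₁ A).2 (Or.inl rfl), Or.inl (.ex x A)⟩
  have hY_all : GAll θ Y := ⟨hYr.gnode, x, A', rfl⟩
  -- Otherwise a switching may choose a leap from `X` to `Y`, and the path from `X` through the hub
  -- to `Y` bypasses this bridge.
  have hXY : ¬ Occ (.bound Y) (τ (.bound X)) ∨ ¬ GEx θ (.bound X) := by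
    by_contra hcon'
    push Not at hcon'
    have harc : GArc θ (.node X) (.node Y) := .leap _ _ Y (hprec _ Y hcon'.2 hY_all hcon'.1) (.bound X)
    let g₀ : GVert L → GVert L := fun v =>
      if h : v ≠ .node Y ∧ ∃ u, GArc θ u v then h.2.choose else .node X
    have hgY : g₀ (.node Y) = .node X := dif_neg fun h => h.1 rfl
    have hg₀ : GSwitching θ g₀ := by
      intro v hv hvs
      by_cases hvY : v = .node Y
      · subst hvY
        rwa [hgY]
      · have : ∃ u, GArc θ u v := by
          cases hvs with
          | par B C => exact ⟨_, .child B _ hv (.parLeft B C)⟩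
          | all z B => exact ⟨_, .child B _ hv (.all z B)⟩
        simp only [g₀]
        rw [dif_pos ⟨hvY, this⟩]
        exact this.choose_spec
    refine hbr g₀ hg₀ _ hYr.gnode h.switched ?_
    rw [hgY]
    have hcut : ∀ R, (R = c₀.1 ∨ R = c₀.2) → GEdge θ g₀ {.node Y} (.node R) (.hub c₀) := fun R hR =>
      Or.inr ⟨.cut R c₀ h.mem hR, by simp, by rintro ⟨⟩⟩
    exact .trans _ _ _ (.rel _ _ (hcut X hXs)) (.symm _ _ (.rel _ _ (hcut Y hYs)))
  -- In the reduct the variables of both quantifiers become one free variable of the cut `c₁`.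
  let ψ : GVar L → GVar L := fun v =>
    if v = .bound X ∨ v = .bound Y then .cut c₁ x else
      match v with
      | .cut c z => if c = c₀ then .cut c₁ z else .cut c z
      | v => v
  -- `f` goes back along `ψ` and picks `X` rather than `Y`: the merged variable inherits the value
  -- of the existential variable.
  let f : GVar L → GVar L := fun
    | .cut c z => if c = c₁ then (if z = x then .bound X else .cut c₀ z) else .cut c z
    | v => v
  -- If `X` is vacuous, `τ` leaves it as a bound variable, which must not enter a unifier of the
  -- reduct; a free variable is an arbitrary substitute.
  let T : L.Term (GVar L) := if GEx θ (.bound X) then τ (.bound X) else .var (.free 0)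
  -- The universal variable is instantiated with the value of the existential one. Since `Y` does
  -- not occur in that value, one substitution eliminates it.
  let ρ : GVar L → L.Term (GVar L) := fun v => if v = .bound Y then T else .var v
  have hxX : x ∈ A.freeVars → GEx θ (.bound X) := by
    intro hx
    refine ⟨?_, Or.inl ⟨x, A, rfl⟩⟩
    obtain ⟨o, ho, t, ht, hocc⟩ := occ_gleaves_of_mem_freeVars
      (e := Function.update (.cut c₀) x (.bound X)) hx
    rw [Function.update_self] at hocc
    exact ⟨o, mem_gleaves.2 (Or.inr ⟨c₀, h.mem, X, hXs, ho⟩), t, ht, hocc⟩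
  have hψc₀ : ∀ z, ψ (.cut c₀ z) = .cut c₁ z := fun z => by simp [ψ]
  have hψc : ∀ c z, c ≠ c₀ → ψ (.cut c z) = .cut c z := fun c z hc => by simp [ψ, hc]
  have hψX : ψ (.bound X) = .cut c₁ x := by simp [ψ]
  have hψY : ψ (.bound Y) = .cut c₁ x := by simp [ψ]
  have hψb : ∀ Q, Q ≠ X → Q ≠ Y → ψ (.bound Q) = .bound Q := fun Q hQX hQY => by
    simp [ψ, hQX, hQY]
  have hψinv : ∀ w Q, ψ w = .bound Q → w = .bound Q := by
    intro w Q hw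
    by_cases hwX : w = .bound X ∨ w = .bound Y
    · simp only [ψ] at hw
      rw [if_pos hwX] at hw
      cases hw
    · simp only [ψ] at hw
      rw [if_neg hwX] at hw
      cases w with
      | free z => exact hw
      | bound B => exact hw
      | cut c z =>
        dsimp only at hw
        split_ifs at hw
  have hfx : f (.cut c₁ x) = .bound X := by simp [f]
  have hfz : ∀ z, z ≠ x → f (.cut c₁ z) = .cut c₀ z := fun z hz => by simp [f, hz]
  have hfc : ∀ c z, c ≠ c₁ → f (.cut c z) = .cut c z := fun c z hc => by simp [f, hc]
  have hfv₁ : ∀ z, z ∈ c₁.1.freeVars ∨ z ∈ c₁.2.freeVars → z ∈ A.freeVars := by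
    intro z hz
    rcases hc₁ with rfl | rfl <;> simpa [← hfv] using hz
  have hcutocc : ∀ c ∈ θ.cuts, ∀ z, z ∈ c.1.freeVars ∨ z ∈ c.2.freeVars → GOccurs θ (.cut c z) := by
    rintro c hc z (hz | hz)
    · obtain ⟨o, ho, t, ht, h⟩ := occ_gleaves_of_mem_freeVars (e := .cut c) hz
      exact ⟨o, mem_gleaves.2 (Or.inr ⟨c, hc, _, Or.inl rfl, ho⟩), t, ht, h⟩
    · obtain ⟨o, ho, t, ht, h⟩ := occ_gleaves_of_mem_freeVars (e := .cut c) hz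
      exact ⟨o, mem_gleaves.2 (Or.inr ⟨c, hc, _, Or.inr rfl, ho⟩), t, ht, h⟩
  have hleaf : ∀ o' ∈ θ'.gleaves, ∃ o ∈ θ.gleaves, o.map ψ = o' := by
    intro o' ho'
    have hsub : ∀ R, Root θ' R → ∀ Q, Sub Q R → ψ (.bound Q) = .bound Q := fun R hR Q hQ => by
      have := (h.node Q).1 ⟨R, hR, hQ⟩
      exact hψb Q this.2.1 this.2.2
    rcases mem_gleaves.1 ho' with ⟨R, hR, ho⟩ | ⟨c, hc, R, hR, ho⟩
    · rw [← gleaves_map (f := ψ) (e := .free) (fun z _ => by simp [ψ])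
        (hsub R (Or.inl hR)), List.mem_map] at ho
      obtain ⟨o, ho, rfl⟩ := ho
      exact ⟨o, mem_gleaves.2 (Or.inl ⟨R, hconcl ▸ hR, ho⟩), rfl⟩
    · have hsub := hsub R (Or.inr ⟨c, hc, hR⟩)
      rcases (h.cuts c).1 hc with hc | ⟨hc, hne⟩
      · rw [List.mem_singleton.1 hc] at hR ho
        rcases (hs₁ R).1 hR with rfl | rfl
        · rw [← gleaves_map (f := ψ) (e := Function.update (.cut c₀) x (.bound X)) ?_ hsub,
            List.mem_map] at ho
          · obtain ⟨o, ho, rfl⟩ := ho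
            exact ⟨o, mem_gleaves.2 (Or.inr ⟨c₀, h.mem, X, hXs, ho⟩), rfl⟩
          · intro z _
            by_cases hz : z = x
            · subst hz
              rw [Function.update_self, hψX]
            · rw [Function.update_of_ne hz, hψc₀]
        · rw [← gleaves_map (f := ψ) (e := Function.update (.cut c₀) x (.bound Y)) ?_ hsub,
            List.mem_map] at ho
          · obtain ⟨o, ho, rfl⟩ := ho
            exact ⟨o, mem_gleaves.2 (Or.inr ⟨c₀, h.mem, Y, hYs, ho⟩), rfl⟩
          · intro z _
            by_cases hz : z = x
            · subst hz
              rw [Function.update_self, hψY]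
            · rw [Function.update_of_ne hz, hψc₀]
      · rw [← gleaves_map (f := ψ) (e := .cut c) (fun z _ => hψc c z hne) hsub, List.mem_map] at ho
        obtain ⟨o, ho, rfl⟩ := ho
        exact ⟨o, mem_gleaves.2 (Or.inr ⟨c, hc, R, hR, ho⟩), rfl⟩
  have hnex : ∀ (η : Net L) (z : ℕ), ¬ GEx η (.free z) := by
    rintro η z ⟨-, ⟨_, _, h⟩ | ⟨_, _, h⟩⟩ <;> cases h
  have hnall : ∀ (η : Net L) (z : ℕ) (B : Fml L), ¬ GEx η (.bound (.all z B)) := by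
    rintro η z B ⟨-, ⟨_, _, h⟩ | ⟨_, _, h⟩⟩ <;> cases h
  have hTX : GEx θ (.bound X) → (τ (.bound X)).subst ρ = τ (.bound X) ∧ T = τ (.bound X) := by
    intro hX
    refine ⟨?_, if_pos hX⟩
    conv_rhs => rw [← subst_var (τ (.bound X))]
    refine subst_congr _ fun v hv => if_neg ?_
    rintro rfl
    exact hXY.elim (fun h => h hv) fun h => h hX
  have hgex : ∀ v, GEx θ' v → GEx θ (f v) := by
    intro v hv
    rcases hv.1.cases with ⟨z, rfl⟩ | ⟨c, hc, z, rfl, hz⟩ | ⟨Q, rfl, hQ, hq⟩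
    · exact absurd hv (hnex _ _)
    · by_cases hc' : c = c₁
      · subst hc'
        have hz := hfv₁ z hz
        by_cases hzx : z = x
        · subst hzx
          rw [hfx]
          exact hxX hz
        · rw [hfz z hzx]
          refine ⟨hcutocc c₀ h.mem z ?_, Or.inr ⟨_, _, rfl⟩⟩
          have : z ∈ X.freeVars := by simp [hX, Fml.freeVars, hz, hzx]
          rcases hXs with h | h <;> rw [h] at this
          · exact Or.inl this
          · exact Or.inr this
      · rw [hfc c z hc']
        refine ⟨hcutocc c ?_ z hz, Or.inr ⟨_, _, rfl⟩⟩
        exact (((h.cuts c).1 hc).resolve_left fun h => hc' (List.mem_singleton.1 h)).1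
    · refine ⟨?_, ?_⟩
      · obtain ⟨o', ho', t', ht', hocc⟩ := hv.1
        obtain ⟨o, ho, rfl⟩ := hleaf o' ho'
        obtain ⟨t, ht, rfl⟩ := List.mem_map.1 ht'
        obtain ⟨w, hw, hwQ⟩ := (occ_relabel _ _).1 hocc
        rw [hψinv w Q hwQ] at hw
        exact ⟨o, ho, t, ht, hw⟩
      · exact hv.2
  let τ' : GVar L → L.Term (GVar L) := fun v => if GEx θ' v then (τ (f v)).subst ρ else .var v
  have hkey : ∀ o ∈ θ.gleaves, o.map ψ ∈ θ'.gleaves →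
      ((o.map ψ).terms.map fun t => t.subst τ') = (o.terms.map fun t => t.subst τ).map fun t => t.subst ρ := by
    intro o ho ho'
    simp only [GLeaf.map, List.map_map]
    refine List.map_congr_left fun t ht => ?_
    simp only [Function.comp, relabel_subst, subst_subst]
    refine subst_congr t fun v hv => ?_
    have hocc : GOccurs θ v := ⟨o, ho, t, ht, hv⟩
    have hocc' : GOccurs θ' (ψ v) :=
      ⟨_, ho', _, List.mem_map_of_mem ht, (occ_relabel _ _).2 ⟨v, hv, rfl⟩⟩
    have hpos : ∀ w, GEx θ' w → τ' w = (τ (f w)).subst ρ := fun w hw => if_pos hw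
    have hneg : ∀ w, ¬ GEx θ' w → τ' w = .var w := fun w hw => if_neg hw
    rcases hocc.cases with ⟨z, rfl⟩ | ⟨c, hc, z, rfl, hz⟩ | ⟨Q, rfl, hQ, ⟨z, B, hB⟩ | ⟨z, B, hB⟩⟩
    · have : ψ (.free z) = .free z := by simp [ψ]
      rw [this, hneg _ (hnex _ _), hτ.fixes _ (hnex _ _)]
      simp [Term.subst, ρ]
    · by_cases hcc : c = c₀
      · subst hcc
        have hzx : z ≠ x := by
          rintro rfl
          rcases (h.sides c.1).1 (Or.inl rfl) with h1 | h1 <;>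
          rcases (h.sides c.2).1 (Or.inr rfl) with h2 | h2 <;>
          rw [h1, h2] at hz <;> simp [hX, hY, Fml.freeVars] at hz
        rw [hψc₀] at hocc' ⊢
        rw [hpos _ ⟨hocc', Or.inr ⟨_, _, rfl⟩⟩, hfz z hzx]
      · rw [hψc c z hcc] at hocc' ⊢
        rw [hpos _ ⟨hocc', Or.inr ⟨_, _, rfl⟩⟩, hfc c z fun h => hc₁n (h ▸ hc)]
    · have hτQ : τ (.bound Q) = .var (.bound Q) := hτ.fixes _ (hB ▸ hnall _ _ _)
      by_cases hQY : Q = Y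
      · rw [hQY, hψY] at hocc' ⊢
        rw [hpos _ ⟨hocc', Or.inr ⟨_, _, rfl⟩⟩, hfx]
        have hx : x ∈ A.freeVars := by
          rcases hocc'.cases with ⟨z, h⟩ | ⟨c, hc, z, h, hz⟩ | ⟨Q, h, -⟩
          · cases h
          · cases h
            exact hfv₁ _ hz
          · cases h
        obtain ⟨h1, h2⟩ := hTX (hxX hx)
        rw [hQY] at hτQ
        rw [h1, hτQ]
        simp only [Term.subst, ρ]
        rw [if_pos trivial, h2]
      · have hQX : Q ≠ X := by
          rw [hB, hX]
          simp
        rw [hψb Q hQX hQY, hneg _ (hB ▸ hnall _ _ _), hτQ]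
        simp only [Term.subst, ρ]
        rw [if_neg (by simp [hQY])]
    · by_cases hQX : Q = X
      · rw [hQX, hψX] at hocc' ⊢
        rw [hpos _ ⟨hocc', Or.inr ⟨_, _, rfl⟩⟩, hfx]
      · have hQY : Q ≠ Y := by
          rw [hB, hY]
          simp
        rw [hψb Q hQX hQY] at hocc' ⊢
        rw [hpos _ ⟨hocc', Or.inl ⟨z, B, by rw [hB]⟩⟩]
  have hocc' : ∀ v w, GEx θ' v → Occ w (τ' v) → (Occ w (τ (f v)) ∧ w ≠ .bound Y) ∨
      (Occ (.bound Y) (τ (f v)) ∧ Occ w T) := by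
    intro v w hv hw
    have : τ' v = (τ (f v)).subst ρ := if_pos hv
    rw [this, occ_subst] at hw
    obtain ⟨u, hu, hw⟩ := hw
    by_cases huY : u = .bound Y
    · subst huY
      refine Or.inr ⟨hu, ?_⟩
      simpa [ρ] using hw
    · simp only [ρ] at hw
      rw [if_neg huY, occ_var] at hw
      subst hw
      exact Or.inl ⟨hu, huY⟩
  have hToccY : ∀ w, Occ w T → w = .free 0 ∨ (GEx θ (.bound X) ∧ Occ w (τ (.bound X)) ∧ w ≠ .bound Y) := by
    intro w hw
    by_cases hX : GEx θ (.bound X)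
    · rw [(hTX hX).2] at hw
      refine Or.inr ⟨hX, hw, ?_⟩
      rintro rfl
      exact hXY.elim (fun h => h hw) fun h => h hX
    · simp only [T] at hw
      rw [if_neg hX, occ_var] at hw
      exact Or.inl hw.symm
  have hτ' : GUnifier θ' τ' := by
    refine ⟨fun v hv => if_neg hv, ?_, ?_⟩
    · intro v hv w hw
      have hrange : ∀ u, GEx θ u → Occ w (τ u) → w ≠ .bound Y →
          (∃ x, w = .free x) ∨ ∃ A, w = .bound A ∧ GAll θ' A := by
        intro u hu hw hwY
        rcases hτ.range u hu w hw with h1 | ⟨B, rfl, hB⟩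
        · exact Or.inl h1
        · exact Or.inr ⟨B, rfl, h.gall_iff.2 ⟨hB, fun h => hwY (by rw [h])⟩⟩
      rcases hocc' v w hv hw with ⟨h1, h2⟩ | ⟨-, h1⟩
      · exact hrange _ (hgex v hv) h1 h2
      · rcases hToccY w h1 with h1 | ⟨h1, h2, h3⟩
        · exact Or.inl ⟨0, h1⟩
        · exact hrange _ h1 h2 h3
    · intro o₁ ho₁ o₂ ho₂ hl
      obtain ⟨o, ho, rfl⟩ := hleaf o₁ ho₁
      obtain ⟨o', ho', rfl⟩ := hleaf o₂ ho₂
      rw [hkey o ho ho₁, hkey o' ho' ho₂, hτ.eq o ho o' ho' (h.links ▸ hl)]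
  refine ⟨⟨τ', hτ'⟩, h.connected hcon hbr fun u v hvs harc => ?_⟩
  have hcore : u ≠ .hub c₁ → u ∉ h.core := fun hu => by
    rcases h.gnode_of_gnode harc.gnode_left with ⟨c, hc, h⟩ | ⟨-, h⟩
    · exact absurd (List.mem_singleton.1 hc ▸ h) hu
    · exact h
  cases harc with
  | child Q R hR hQR =>
    exact ⟨_, .child Q R ((h.node R).1 hR).1 hQR, Or.inr (Or.inl ⟨rfl, hcore (by simp)⟩)⟩
  | cut Q c hc hQ => cases hvs
  | leap w u Q hp hw =>
    have hQ := (h.gall_iff.1 hp.2.1).1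
    -- An occurrence of `Q` in the new unifier was present before, or it came with the term
    -- substituted for `Y`. In the second case it is the composite of a leap into `Y` and a leap
    -- from `X`.
    have hlp : GPrecedes θ (f w) Q ∨ (GPrecedes θ (f w) Y ∧ GPrecedes θ (.bound X) Q) := by
      rcases hocc' w _ hp.1 (hp.2.2 τ' hτ') with ⟨h1, -⟩ | ⟨h1, h2⟩
      · exact Or.inl (hprec _ _ (hgex w hp.1) hQ h1)
      · rcases hToccY _ h2 with h2 | ⟨h2, h3, -⟩
        · cases h2
        · exact Or.inr ⟨hprec _ _ (hgex w hp.1) hY_all h1, hprec _ _ h2 hQ h3⟩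
    have hXcore : GVert.node X ∈ h.core := by simp [core]
    have hother : f w = w → u ≠ .hub c₁ → ∃ s, GArc θ s (.node Q) ∧
        ((s ∈ h.core ∧ ∃ c ∈ [c₁], u = .hub c) ∨ (s = u ∧ s ∉ h.core) ∨
          (s ∈ h.core ∧ u ∉ h.core ∧ GArc θ u (.node Y))) := by
      intro hfw hu
      rw [hfw] at hlp
      rcases hlp with hlp | ⟨h1, h2⟩
      · exact ⟨u, .leap _ _ _ hlp hw, Or.inr (Or.inl ⟨rfl, hcore hu⟩)⟩
      · exact ⟨_, .leap _ _ _ h2 (.bound X), Or.inr (Or.inr ⟨hXcore, hcore hu, .leap _ _ _ h1 hw⟩)⟩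
    cases hw with
    | bound R => exact hother rfl (by simp)
    | cut c z =>
      by_cases hc : c = c₁
      · subst hc
        have : ∃ s ∈ h.core, GArc θ s (.node Q) := by
          rcases hlp with hlp | ⟨h1, h2⟩
          · by_cases hz : z = x
            · subst hz
              rw [hfx] at hlp
              exact ⟨_, hXcore, .leap _ _ _ hlp (.bound X)⟩
            · rw [hfz z hz] at hlp
              exact ⟨.hub c₀, by simp [core], .leap _ _ _ hlp (.cut _ z)⟩
          · exact ⟨_, hXcore, .leap _ _ _ h2 (.bound X)⟩
        obtain ⟨s, hs, harc⟩ := this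
        exact ⟨s, harc, Or.inl ⟨hs, c, List.mem_singleton.2 rfl, rfl⟩⟩
      · exact hother (hfc c z hc) (by simpa using hc)

/-! ### The atomic reduction -/

/-- Subformulas are subtrees, and subtrees with a common leaf are nested. -/
theorem sub_or_sub {A B R : Fml L} (hR : R.names.Nodup) (hA : Sub A R) (hB : Sub B R) {l : ℕ}
    (hlA : l ∈ A.names) (hlB : l ∈ B.names) : Sub A B ∨ Sub B A := by
  have key : ∀ R₁ R₂ : Fml L, (R₁.names ++ R₂.names).Nodup → (Sub A R₁ → Sub B R₁ → Sub A B ∨ Sub B A) →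
      (Sub A R₂ → Sub B R₂ → Sub A B ∨ Sub B A) → (Sub A R₁ ∨ Sub A R₂) → (Sub B R₁ ∨ Sub B R₂) →
      Sub A B ∨ Sub B A := by
    intro R₁ R₂ hnd h1 h2 hA hB
    rcases hA with hA | hA <;> rcases hB with hB | hB
    · exact h1 hA hB
    · exact ((List.nodup_append.1 hnd).2.2 _ (hA.names_subset hlA) _ (hB.names_subset hlB) rfl).elim
    · exact ((List.nodup_append.1 hnd).2.2 _ (hB.names_subset hlB) _ (hA.names_subset hlA) rfl).elim
    · exact h2 hA hB
  induction R with
  | atom m P ts =>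
    rw [sub_atom] at hA hB
    subst hA
    subst hB
    exact Or.inl (.refl _)
  | tensor R₁ R₂ ih1 ih2 =>
    rw [names_tensor] at hR
    rcases sub_tensor.1 hA with rfl | hA'
    · exact Or.inr hB
    · rcases sub_tensor.1 hB with rfl | hB'
      · exact Or.inl hA
      · exact key R₁ R₂ hR (ih1 (List.nodup_append.1 hR).1) (ih2 (List.nodup_append.1 hR).2.1) hA' hB'
  | par R₁ R₂ ih1 ih2 =>
    rw [names_par] at hR
    rcases sub_par.1 hA with rfl | hA'
    · exact Or.inr hB
    · rcases sub_par.1 hB with rfl | hB'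
      · exact Or.inl hA
      · exact key R₁ R₂ hR (ih1 (List.nodup_append.1 hR).1) (ih2 (List.nodup_append.1 hR).2.1) hA' hB'
  | all x R ih =>
    rcases sub_all.1 hA with rfl | hA'
    · exact Or.inr hB
    · rcases sub_all.1 hB with rfl | hB'
      · exact Or.inl hA
      · exact ih hR hA' hB'
  | ex x R ih =>
    rcases sub_ex.1 hA with rfl | hA'
    · exact Or.inr hB
    · rcases sub_ex.1 hB with rfl | hB'
      · exact Or.inl hA
      · exact ih hR hA' hB'

theorem Root.names_nodup {θ : Net L} (hθ : θ.names.Nodup) {R : Fml L} (hR : Root θ R) :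
    R.names.Nodup := by
  rcases hR with hR | ⟨c, hc, rfl | rfl⟩
  · exact (List.nodup_flatMap.1 (List.nodup_append.1 hθ).1).1 R hR
  · exact (List.nodup_append.1 (cut_names_nodup hθ hc)).1
  · exact (List.nodup_append.1 (cut_names_nodup hθ hc)).2.1

theorem gnode_atom_unique {θ : Net L} (hθ : θ.names.Nodup) {l n n' : ℕ} {P : L.Relations n}
    {Q : L.Relations n'} {ts : Fin n → L.Term ℕ} {us : Fin n' → L.Term ℕ}
    (h : GNode θ (.node (.atom l P ts))) (h' : GNode θ (.node (.atom l Q us))) :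
    Fml.atom l P ts = Fml.atom l Q us := by
  obtain ⟨R, hR, h⟩ := h
  obtain ⟨R', hR', h'⟩ := h'
  have := root_unique hθ hR hR' (h.names_subset (List.mem_singleton.2 rfl))
    (h'.names_subset (List.mem_singleton.2 rfl))
  subst this
  rcases sub_or_sub (hR.names_nodup hθ) h h' (List.mem_singleton.2 rfl) (List.mem_singleton.2 rfl)
    with h | h
  · exact sub_atom.1 h
  · exact (sub_atom.1 h).symm

theorem exists_gnode_atom {θ : Net L} {o : Sig L} (ho : o ∈ θ.sigs) :
    ∃ (n : ℕ) (P : L.Relations n) (ts : Fin n → L.Term ℕ), GNode θ (.node (.atom o.1 P ts)) := by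
  obtain ⟨R, hR, ho⟩ := mem_net_sigs.1 ho
  obtain ⟨l, n, P⟩ := o
  obtain ⟨ts, hs⟩ := mem_sigs.1 ho
  exact ⟨n, P, ts, R, hR, hs⟩

theorem GLink.symm {θ : Net L} {a b : GVert L} (h : GLink θ a b) : GLink θ b a := by
  obtain ⟨ha, hb, l, m, n, n', P, Q, ts, us, h1, h2, h3⟩ := h
  exact ⟨hb, ha, m, l, n', n, Q, P, us, ts, h2, h1, Sym2.eq_swap ▸ h3⟩

theorem IsSigLinking.names_nodup {D : Duality L} {θ : Net L} {Λ : Finset (Sym2 ℕ)}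
    (h : IsSigLinking D θ.sigs Λ) : θ.names.Nodup :=
  map_fst_sigs θ ▸ h.1

section Atomic

variable {D : Duality L} {Γ : List (Fml L)} {pre post : List (Fml L × Fml L)} {Λ : Finset (Sym2 ℕ)}
  {a i j d n : ℕ} {P : L.Relations n} {ts : Fin n → L.Term ℕ}

/-- A link has distinct ends, a leaf has only one link and the two links differ; together with the
distinct names of the cut leaves this separates all four leaves. -/
theorem atomic_names_ne (h : IsSigLinking D (Net.mk Γ
      (pre ++ (.atom i P ts, .atom j (D.neg P) ts) :: post) Λ).sigs Λ)
    (hai : s(a, i) ∈ Λ) (hjd : s(j, d) ∈ Λ) (hne : s(a, i) ≠ s(j, d)) :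
    i ≠ j ∧ a ≠ i ∧ a ≠ j ∧ d ≠ i ∧ d ≠ j ∧ a ≠ d := by
  have hnd := h.names_nodup
  have hij : i ≠ j := by
    rintro rfl
    have := cut_names_nodup hnd (c := (.atom i P ts, .atom i (D.neg P) ts)) (by simp)
    simp [cutNames] at this
  have hjd' : s(d, j) ∈ Λ := Sym2.eq_swap ▸ hjd
  have hai' : s(i, a) ∈ Λ := Sym2.eq_swap ▸ hai
  refine ⟨hij, h.ne hai, ?_, ?_, (h.ne hjd).symm, ?_⟩
  · rintro rfl
    exact hne (by rw [h.eq_of_left hai hjd])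
  · rintro rfl
    exact hne (by rw [h.eq_of_right hai hjd])
  · rintro rfl
    exact hij (h.eq_of_left hai hjd')

/-- The atomic reduction preserves unifiability and connectedness. -/
theorem gconnected_atomic (h : IsSigLinking D (Net.mk Γ
      (pre ++ (.atom i P ts, .atom j (D.neg P) ts) :: post) Λ).sigs Λ)
    (hai : s(a, i) ∈ Λ) (hjd : s(j, d) ∈ Λ) (hne : s(a, i) ≠ s(j, d))
    (hθ : GConnected (Net.mk Γ (pre ++ (.atom i P ts, .atom j (D.neg P) ts) :: post) Λ)) :
    GConnected (Net.mk Γ (pre ++ post) (insert s(a, d) ((Λ.erase s(a, i)).erase s(j, d)))) := by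
  classical
  have hnd := h.names_nodup
  obtain ⟨hij, hai', haj, hdi, hdj, had⟩ := atomic_names_ne h hai hjd hne
  set Λ' := insert s(a, d) ((Λ.erase s(a, i)).erase s(j, d)) with hΛ'
  set I : Fml L := .atom i P ts with hI
  set J : Fml L := .atom j (D.neg P) ts with hJ
  set c₀ := (I, J) with hc₀
  set θ : Net L := ⟨Γ, pre ++ c₀ :: post, Λ⟩ with hθd
  set θ' : Net L := ⟨Γ, pre ++ post, Λ'⟩ with hθd'
  have hmem : c₀ ∈ θ.cuts := by simp [hθd]
  have hIr : Root θ I := Or.inr ⟨c₀, hmem, Or.inl rfl⟩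
  have hJr : Root θ J := Or.inr ⟨c₀, hmem, Or.inr rfl⟩
  have hcuts : ∀ c, c ∈ θ.cuts ↔ c = c₀ ∨ c ∈ θ'.cuts := fun c => by
    simp only [hθd, hθd', List.mem_append, List.mem_cons]; tauto
  have hc₀' : c₀ ∉ θ'.cuts := fun hc =>
    rest_disjoint hnd hc (l := i) (by simp [hc₀, hI, cutNames]) (by simp [hc₀, hI, cutNames])
  have hroot : ∀ R, Root θ R ↔ R = I ∨ R = J ∨ Root θ' R := by
    intro R
    constructor
    · rintro (hR | ⟨c, hc, hR⟩)
      · exact Or.inr (Or.inr (Or.inl hR))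
      · rcases (hcuts c).1 hc with rfl | hc
        · rcases hR with hR | hR
          · exact Or.inl hR
          · exact Or.inr (Or.inl hR)
        · exact Or.inr (Or.inr (Or.inr ⟨c, hc, hR⟩))
    · rintro (rfl | rfl | hR | ⟨c, hc, hR⟩)
      · exact hIr
      · exact hJr
      · exact Or.inl hR
      · exact Or.inr ⟨c, (hcuts c).2 (Or.inr hc), hR⟩
  have hroot' : ∀ R, Root θ' R → i ∉ R.names ∧ j ∉ R.names := by
    intro R hR
    have : ∀ l, l ∈ cutNames c₀ → l ∉ R.names := by
      intro l hl hlR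
      rcases hR with hR | ⟨c, hc, hR⟩
      · exact concl_cut_disjoint hnd hR hmem hlR hl
      · exact rest_disjoint hnd hc (l := l) (by rcases hR with rfl | rfl <;> simp [cutNames, hlR]) hl
    exact ⟨this i (by simp [hc₀, hI, cutNames]), this j (by simp [hc₀, hJ, cutNames])⟩
  have hnode : ∀ Q, GNode θ' (.node Q) ↔ GNode θ (.node Q) ∧ Q ≠ I ∧ Q ≠ J := by
    intro Q
    constructor
    · rintro ⟨R, hR, hQ⟩
      refine ⟨⟨R, (hroot R).2 (Or.inr (Or.inr hR)), hQ⟩, ?_, ?_⟩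
      · rintro rfl
        exact (hroot' R hR).1 (hQ.names_subset (by simp [hI]))
      · rintro rfl
        exact (hroot' R hR).2 (hQ.names_subset (by simp [hJ]))
    · rintro ⟨⟨R, hR, hQ⟩, hQI, hQJ⟩
      rcases (hroot R).1 hR with rfl | rfl | hR
      · exact absurd (sub_atom.1 hQ) hQI
      · exact absurd (sub_atom.1 hQ) hQJ
      · exact ⟨R, hR, hQ⟩
  let core : Set (GVert L) := {.node I, .node J, .hub c₀}
  have hcore : ∀ w, GNode θ' w ↔ GNode θ w ∧ w ∉ core := by
    rintro (Q | c)
    · rw [hnode]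
      simp [core]
    · change c ∈ θ'.cuts ↔ c ∈ θ.cuts ∧ _
      rw [hcuts]
      simp only [core, Set.mem_insert_iff, reduceCtorEq, Set.mem_singleton_iff, GVert.hub.injEq,
        false_or]
      constructor
      · intro hc
        exact ⟨Or.inr hc, fun h => hc₀' (h ▸ hc)⟩
      · rintro ⟨rfl | hc, h⟩
        · exact absurd rfl h
        · exact hc
  have hIs : ¬ GSwitched (.node I) := by
    rw [hI]
    rintro ⟨⟩
  have hJs : ¬ GSwitched (.node J) := by
    rw [hJ]
    rintro ⟨⟩
  have hcoresw : ∀ w, GSwitched w → w ∉ core := by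
    rintro w hw (rfl | rfl | rfl)
    · exact hIs hw
    · exact hJs hw
    · cases hw
  have hleaf : ∀ o ∈ θ'.gleaves, o ∈ θ.gleaves := by
    intro o ho
    rcases mem_gleaves.1 ho with ⟨R, hR, ho⟩ | ⟨c, hc, R, hR, ho⟩
    · exact mem_gleaves.2 (Or.inl ⟨R, hR, ho⟩)
    · exact mem_gleaves.2 (Or.inr ⟨c, (hcuts c).2 (Or.inr hc), R, hR, ho⟩)
  have hid : ∀ o : GLeaf L, o.map id = o := by
    rintro ⟨l, us⟩
    simp [GLeaf.map, Term.relabel_id_eq_id]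
  -- The equations of the two deleted links compose to the equation of the new one, because the two
  -- cut leaves carry the same terms over the same hub variables.
  have hpull : GPull θ θ' id := by
    refine ⟨fun _ => rfl, fun _ => rfl, fun c x => ⟨c, rfl⟩, fun o ho => ?_, fun Q => ?_, ?_⟩
    · rw [hid]
      exact hleaf o ho
    · simp only [GAll, hnode]
      constructor
      · rintro ⟨h1, h2⟩
        exact ⟨h1.1, h2⟩
      · rintro ⟨h1, x, B, rfl⟩
        exact ⟨⟨h1, by simp [hI], by simp [hJ]⟩, x, B, rfl⟩
    · intro τ hτ o ho o' ho' hl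
      rw [hid, hid]
      have key : ∀ o ∈ θ.gleaves, ∀ o' ∈ θ.gleaves, o.name = a → o'.name = d →
          (o.terms.map fun t => t.subst τ) = o'.terms.map fun t => t.subst τ := by
        intro o₁ ho₁ o₂ ho₂ h₁ h₂
        subst h₁
        subst h₂
        let oi : GLeaf L := ⟨i, List.ofFn fun k => (ts k).relabel (.cut c₀)⟩
        let oj : GLeaf L := ⟨j, List.ofFn fun k => (ts k).relabel (.cut c₀)⟩
        have h1 := hτ.eq o₁ ho₁ oi
          (mem_gleaves.2 (Or.inr ⟨c₀, hmem, I, Or.inl rfl, List.mem_singleton.2 rfl⟩)) hai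
        have h2 := hτ.eq oj
          (mem_gleaves.2 (Or.inr ⟨c₀, hmem, J, Or.inr rfl, List.mem_singleton.2 rfl⟩)) o₂ ho₂ hjd
        exact h1.trans h2
      rcases Finset.mem_insert.1 hl with hl | hl
      · rcases Sym2.eq_iff.1 hl with ⟨h1, h2⟩ | ⟨h1, h2⟩
        · exact key o (hleaf o ho) o' (hleaf o' ho') h1 h2
        · exact (key o' (hleaf o' ho') o (hleaf o ho) h2 h1).symm
      · exact hτ.eq o (hleaf o ho) o' (hleaf o' ho') (Finset.mem_of_mem_erase (Finset.mem_of_mem_erase hl))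
  obtain ⟨⟨τ, hτ⟩, hcon⟩ := hθ
  refine ⟨⟨_, hpull.unifier hτ⟩, fun g hg => ?_⟩
  have harc : ∀ u v, GArc θ' u v → GArc θ u v := by
    intro u v huv
    cases huv with
    | child A B hB hAB => exact .child A B ((hcore _).1 hB).1 hAB
    | cut A c hc hA => exact .cut A c ((hcore (.hub c)).1 hc).1 hA
    | leap w u A hp hw => exact .leap w u A (hpull.precedes hp) hw
  -- All edges of the reduct are edges of the redex and nothing switched is deleted, so `g` serves
  -- as a switching of both.
  have hg' : GSwitching θ g := fun v hv hvs =>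
    harc _ _ (hg v ((hcore v).2 ⟨hv, hcoresw v hvs⟩) hvs)
  obtain ⟨oa, hoa, hoa'⟩ := h.exists_left hai
  obtain ⟨od, hod, hod'⟩ := h.exists_right hjd
  obtain ⟨na, Pa, ta, hAa⟩ := exists_gnode_atom hoa
  obtain ⟨nd, Pd, td, hAd⟩ := exists_gnode_atom hod
  rw [hoa'] at hAa
  rw [hod'] at hAd
  have hAa' : GNode θ' (.node (.atom a Pa ta)) := (hnode _).2 ⟨hAa, by simp [hI, hai'], by simp [hJ, haj]⟩
  have hAd' : GNode θ' (.node (.atom d Pd td)) := (hnode _).2 ⟨hAd, by simp [hI, hdi], by simp [hJ, hdj]⟩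
  set Aa : GVert L := .node (.atom a Pa ta) with hAad
  have hda : GConn θ' g ∅ (.node (.atom d Pd td)) Aa :=
    .symm _ _ (.rel _ _ (Or.inl ⟨hAa', hAd', a, d, _, _, _, _, _, _, rfl, rfl,
      Finset.mem_insert_self _ _⟩))
  have hIname : ∀ {m : ℕ} {Q : L.Relations m} {us : Fin m → L.Term ℕ},
      GNode θ (.node (.atom i Q us)) → GVert.node (.atom i Q us) ∈ core := fun hQ => by
    rw [gnode_atom_unique hnd hQ hIr.gnode]
    simp [core, hI]
  have hJname : ∀ {m : ℕ} {Q : L.Relations m} {us : Fin m → L.Term ℕ},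
      GNode θ (.node (.atom j Q us)) → GVert.node (.atom j Q us) ∈ core := fun hQ => by
    rw [gnode_atom_unique hnd hQ hJr.gnode]
    simp [core, hJ]
  -- Links leave the core only towards `a` and `d`, which the new link joins.
  have hlink : ∀ u v, GLink θ u v → u ∈ core → GConn θ' g ∅ v Aa := by
    rintro u v ⟨hu, hv, l, m, n₁, n₂, P₁, P₂, t₁, t₂, rfl, rfl, hl⟩ huc
    rcases huc with huc | huc | huc
    · injection huc with huc
      injection huc with hli
      rw [hli] at hl
      have hma : m = a := h.eq_of_left hl (Sym2.eq_swap ▸ hai)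
      subst hma
      rw [gnode_atom_unique hnd hv hAa]
      exact .refl _
    · injection huc with huc
      injection huc with hlj
      rw [hlj] at hl
      have hmd : m = d := h.eq_of_left hl hjd
      subst hmd
      rw [gnode_atom_unique hnd hv hAd]
      exact hda
    · cases huc
  have hout : ∀ u v, GEdge θ g ∅ u v → u ∈ core → v ∉ core → GConn θ' g ∅ v Aa := by
    rintro u v (hl | ⟨huv, -, hk⟩) hu hv
    · exact hlink u v hl hu
    · exfalso
      have hroot : ∀ R, GVert.node R ∈ core → R = I ∨ R = J := by
        rintro R hR
        simpa [core] using hR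
      cases huv with
      | child A B hB hAB =>
        rcases hroot A hu with rfl | rfl
        · exact not_child_root hnd hIr hB hAB
        · exact not_child_root hnd hJr hB hAB
      | cut A c hc hA =>
        rcases (hcuts c).1 hc with rfl | hc
        · exact hv (by simp [core])
        · have : Root θ' A := Or.inr ⟨c, hc, hA⟩
          rcases hroot A hu with rfl | rfl
          · exact (hroot' _ this).1 (by simp [hI])
          · exact (hroot' _ this).2 (by simp [hJ])
      -- There may be leaps from the hub, but `g` selects edges of the reduct, whose sources lie
      -- outside the core.
      | leap w u A hp hw =>
        obtain ⟨x, B, rfl⟩ := hp.2.1.2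
        have h1 := hg _ ((hcore _).2 ⟨hp.2.1.1, hv⟩) (.all x B)
        rw [hk (.all x B)] at h1
        exact ((hcore u).1 h1.gnode_left).2 hu
  have hin : ∀ u v, GEdge θ g ∅ u v → v ∈ core → u ∉ core → GConn θ' g ∅ u Aa := by
    rintro u v (hl | ⟨huv, -, -⟩) hv hu
    · exact hlink v u hl.symm hv
    · exfalso
      rcases hv with rfl | rfl | rfl
      · cases huv with
        | child A B hB hAB => exact not_child_atom hAB
        | leap w u A hp hw =>
          obtain ⟨x, B, h⟩ := hp.2.1.2
          exact hIs (h ▸ .all x B)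
      · cases huv with
        | child A B hB hAB => exact not_child_atom hAB
        | leap w u A hp hw =>
          obtain ⟨x, B, h⟩ := hp.2.1.2
          exact hJs (h ▸ .all x B)
      · cases huv with
        | cut A c hc hA => exact hu (by rcases hA with rfl | rfl <;> simp [core, hc₀])
  have hboth : ∀ u v, GEdge θ g ∅ u v → u ∉ core → v ∉ core → GConn θ' g ∅ u v := by
    rintro u v (⟨hu', hv', l, m, n₁, n₂, P₁, P₂, t₁, t₂, rfl, rfl, hl⟩ | ⟨huv, -, hk⟩) hu hv
    · refine .rel _ _ (Or.inl ⟨(hcore _).2 ⟨hu', hu⟩, (hcore _).2 ⟨hv', hv⟩, l, m, n₁, n₂, P₁, P₂, t₁,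
        t₂, rfl, rfl, ?_⟩)
      refine Finset.mem_insert_of_mem (Finset.mem_erase.2 ⟨?_, Finset.mem_erase.2 ⟨?_, hl⟩⟩)
      · intro he
        rcases Sym2.eq_iff.1 he with ⟨h1, -⟩ | ⟨-, h1⟩
        · subst h1
          exact hu (hJname hu')
        · subst h1
          exact hv (hJname hv')
      · intro he
        rcases Sym2.eq_iff.1 he with ⟨-, h1⟩ | ⟨h1, -⟩
        · subst h1
          exact hv (hIname hv')
        · subst h1
          exact hu (hIname hu')
    · have hv' : GNode θ' v := (hcore v).2 ⟨huv.gnode_right, hv⟩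
      refine .rel _ _ (Or.inr ⟨?_, by simp, hk⟩)
      by_cases hvs : GSwitched v
      · rw [← hk hvs]
        exact hg v hv' hvs
      · cases huv with
        | child A B hB hAB => exact .child A B hv' hAB
        | cut A c hc hA => exact .cut A c hv' hA
        | leap w u A hp hw =>
          obtain ⟨x, B, rfl⟩ := hp.2.1.2
          exact absurd (.all x B) hvs
  have hclosed : ∀ u v, GConn θ g ∅ u v →
      ((u ∈ core ∨ GConn θ' g ∅ u Aa) ↔ (v ∈ core ∨ GConn θ' g ∅ v Aa)) := by
    intro u v h
    induction h with
    | rel u v h =>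
      by_cases hu : u ∈ core <;> by_cases hv : v ∈ core
      · simp [hu, hv]
      · simp [hu, hout u v h hu hv]
      · simp [hv, hin u v h hv hu]
      · have := hboth u v h hu hv
        simp only [hu, hv, false_or]
        exact ⟨this.symm.trans _ _ _, this.trans _ _ _⟩
    | refl u => rfl
    | symm u v _ ih => exact ih.symm
    | trans u v w _ _ ih ih' => exact ih.trans ih'
  have key : ∀ u, GNode θ' u → GConn θ' g ∅ u Aa := by
    intro u hu
    obtain ⟨hu, huc⟩ := (hcore u).1 hu
    exact ((hclosed u Aa (hcon g hg' u Aa hu hAa)).2 (Or.inr (.refl _))).resolve_left huc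
  exact fun u v hu hv => (key u hu).trans _ _ _ (key v hv).symm

end Atomic

/-! ### The encoding and the contracted graph -/

/-- The variables which the encoding of a cut quantifies. -/
def cutVars (c : Fml L × Fml L) : List ℕ := c.1.freeVars.sort (· ≤ ·)

theorem cutVars_nodup (c : Fml L × Fml L) : (cutVars c).Nodup := Finset.sort_nodup _ _

/-- `Q` is the tensor of the encoding of the cut `c` or one of the quantifiers above it. -/
def IsHub (c : Fml L × Fml L) (Q : Fml L) : Prop :=
  ∃ xs ys, cutVars c = xs ++ ys ∧ Q = ys.foldr Fml.ex (.tensor c.1 c.2)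

/-- `Q` is the quantifier of the encoding of the cut `c` which binds `x`. -/
def IsHubVar (c : Fml L × Fml L) (x : ℕ) (Q : Fml L) : Prop :=
  ∃ xs ys, cutVars c = xs ++ x :: ys ∧ Q = .ex x (ys.foldr Fml.ex (.tensor c.1 c.2))

theorem IsHubVar.isHub {c : Fml L × Fml L} {x : ℕ} {Q : Fml L} (h : IsHubVar c x Q) : IsHub c Q := by
  obtain ⟨xs, ys, h, rfl⟩ := h
  exact ⟨xs, x :: ys, h, rfl⟩

theorem IsHub.names {c : Fml L × Fml L} {Q : Fml L} (h : IsHub c Q) : Q.names = cutNames c := by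
  obtain ⟨xs, ys, -, rfl⟩ := h
  rw [names_chain, names_tensor, cutNames]

theorem IsHub.cases {c : Fml L × Fml L} {Q : Fml L} (h : IsHub c Q) :
    Q = .tensor c.1 c.2 ∨ ∃ x B, Q = .ex x B ∧ IsHub c B ∧ IsHubVar c x Q := by
  obtain ⟨xs, ys, h, rfl⟩ := h
  cases ys with
  | nil => exact Or.inl rfl
  | cons y ys => exact Or.inr ⟨y, _, rfl, ⟨xs ++ [y], ys, by simp [h], rfl⟩, ⟨xs, ys, h, rfl⟩⟩

theorem isHub_encodeCut (c : Fml L × Fml L) : IsHub c (encodeCut c) := ⟨[], _, rfl, rfl⟩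

theorem isHub_tensor (c : Fml L × Fml L) : IsHub c (.tensor c.1 c.2) := ⟨cutVars c, [], by simp, rfl⟩

theorem sub_chain {xs : List ℕ} {T Q : Fml L} :
    Sub Q (xs.foldr Fml.ex T) ↔ (∃ ys zs, xs = ys ++ zs ∧ Q = zs.foldr Fml.ex T) ∨ Sub Q T := by
  induction xs with
  | nil =>
    refine ⟨Or.inr, ?_⟩
    rintro (⟨ys, zs, h, rfl⟩ | h)
    · obtain ⟨-, rfl⟩ := List.append_eq_nil_iff.1 h.symm
      exact .refl _
    · exact h
  | cons x xs ih =>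
    rw [List.foldr_cons, sub_ex, ih]
    constructor
    · rintro (rfl | ⟨ys, zs, rfl, rfl⟩ | h)
      · exact Or.inl ⟨[], x :: xs, rfl, rfl⟩
      · exact Or.inl ⟨x :: ys, zs, rfl, rfl⟩
      · exact Or.inr h
    · rintro (⟨ys, zs, h, rfl⟩ | h)
      · cases ys with
        | nil =>
          rw [List.nil_append] at h
          subst h
          exact Or.inl rfl
        | cons y ys =>
          rw [List.cons_append, List.cons.injEq] at h
          exact Or.inr (Or.inl ⟨ys, zs, h.2, rfl⟩)
      · exact Or.inr (Or.inr h)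

theorem sub_encodeCut {c : Fml L × Fml L} {Q : Fml L} :
    Sub Q (encodeCut c) ↔ IsHub c Q ∨ Sub Q c.1 ∨ Sub Q c.2 := by
  rw [encodeCut, sub_chain, sub_tensor]
  constructor
  · rintro (h | rfl | h)
    · exact Or.inl h
    · exact Or.inl (isHub_tensor c)
    · exact Or.inr h
  · rintro (h | h)
    · exact Or.inl h
    · exact Or.inr (Or.inr h)

theorem exists_subAt {Γ : Sequent L} {Q : Fml L} :
    (∃ a, subAt Γ a = some Q) ↔ ∃ A ∈ Γ, Sub Q A := by
  constructor
  · rintro ⟨⟨i, p⟩, h⟩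
    obtain ⟨A, hA, h⟩ := Option.bind_eq_some_iff.1 h
    exact ⟨A, List.mem_of_getElem? hA, p, h⟩
  · rintro ⟨A, hA, p, h⟩
    obtain ⟨i, hi⟩ := List.mem_iff_getElem?.1 hA
    exact ⟨(i, p), Option.bind_eq_some_iff.2 ⟨A, hi, h⟩⟩

theorem exists_subAt_encode {θ : Net L} {Q : Fml L} :
    (∃ a, subAt θ.encode a = some Q) ↔ GNode θ (.node Q) ∨ ∃ c ∈ θ.cuts, IsHub c Q := by
  rw [exists_subAt]
  simp only [Net.encode, List.mem_append, List.mem_map, GNode, Root]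
  constructor
  · rintro ⟨A, hA | ⟨c, hc, rfl⟩, h⟩
    · exact Or.inl ⟨A, Or.inl hA, h⟩
    · rcases sub_encodeCut.1 h with h | h | h
      · exact Or.inr ⟨c, hc, h⟩
      · exact Or.inl ⟨c.1, Or.inr ⟨c, hc, Or.inl rfl⟩, h⟩
      · exact Or.inl ⟨c.2, Or.inr ⟨c, hc, Or.inr rfl⟩, h⟩
  · rintro (⟨R, hR | ⟨c, hc, rfl | rfl⟩, h⟩ | ⟨c, hc, h⟩)
    · exact ⟨R, Or.inl hR, h⟩
    · exact ⟨_, Or.inr ⟨c, hc, rfl⟩, sub_encodeCut.2 (Or.inr (Or.inl h))⟩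
    · exact ⟨_, Or.inr ⟨c, hc, rfl⟩, sub_encodeCut.2 (Or.inr (Or.inr h))⟩
    · exact ⟨_, Or.inr ⟨c, hc, rfl⟩, sub_encodeCut.2 (Or.inl h)⟩

open Classical in
/-- The vertex of the contracted graph for a subformula of the encoding. -/
noncomputable def toVert (θ : Net L) (Q : Fml L) : GVert L :=
  if h : ∃ c ∈ θ.cuts, IsHub c Q then .hub h.choose else .node Q

open Classical in
/-- The variable of the contracted graph for a quantifier of the encoding. -/
noncomputable def toVar (θ : Net L) (Q : Fml L) : GVar L :=
  if h : ∃ c : (Fml L × Fml L) × ℕ, c.1 ∈ θ.cuts ∧ IsHubVar c.1 c.2 Q then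
    .cut h.choose.1 h.choose.2
  else .bound Q

/-! ### Hubs and quantifiers of the encoding as vertices and variables -/

section

variable {θ : Net L}

theorem toVert_eq_hub {Q : Fml L} {c : Fml L × Fml L} (h : toVert θ Q = .hub c) :
    c ∈ θ.cuts ∧ IsHub c Q := by
  rw [toVert] at h
  split_ifs at h with h'
  injection h with h
  exact h ▸ h'.choose_spec

theorem toVert_eq_node {Q A : Fml L} (h : toVert θ Q = .node A) : Q = A := by
  rw [toVert] at h
  split_ifs at h with h'
  injection h with h

theorem quant_cases {Q : Fml L} {a : Addr} (ha : subAt θ.encode a = some Q)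
    (hq : (∃ x B, Q = .all x B) ∨ ∃ x B, Q = .ex x B) :
    GNode θ (.node Q) ∨ ∃ c ∈ θ.cuts, ∃ x, IsHubVar c x Q := by
  rcases exists_subAt_encode.1 ⟨a, ha⟩ with h | ⟨c, hc, h⟩
  · exact Or.inl h
  · rcases h.cases with rfl | ⟨x, B, -, -, h⟩
    · rcases hq with ⟨x, B, h⟩ | ⟨x, B, h⟩ <;> cases h
    · exact Or.inr ⟨c, hc, x, h⟩

variable (hθ : θ.names.Nodup)
include hθ

theorem hub_unique {Q : Fml L} {c c' : Fml L × Fml L} (hc : c ∈ θ.cuts) (hc' : c' ∈ θ.cuts)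
    (h : IsHub c Q) (h' : IsHub c' Q) : c = c' := by
  obtain ⟨l, hl⟩ := exists_mem_names Q
  exact cut_unique hθ hc hc' (h.names ▸ hl) (h'.names ▸ hl)

/-- A formula contracted to a hub has the leaves of both sides of the cut, whereas a subformula of
the cut sequent stays within one side. -/
theorem not_isHub {Q : Fml L} {c : Fml L × Fml L} (hc : c ∈ θ.cuts) (hQ : GNode θ (.node Q)) :
    ¬ IsHub c Q := by
  intro h
  obtain ⟨R, hR, hQ⟩ := hQ
  have hsub := hQ.names_subset
  rw [h.names] at hsub
  obtain ⟨l, hl⟩ := exists_mem_names c.1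
  obtain ⟨m, hm⟩ := exists_mem_names c.2
  have h1 := root_unique hθ hR (Or.inr ⟨c, hc, Or.inl rfl⟩) (hsub (List.mem_append_left _ hl)) hl
  have h2 := hsub (List.mem_append_right _ hm)
  rw [h1] at h2
  exact cut_sides_disjoint hθ hc h2 hm

theorem toVert_of_isHub {Q : Fml L} {c : Fml L × Fml L} (hc : c ∈ θ.cuts) (h : IsHub c Q) :
    toVert θ Q = .hub c := by
  have h' : ∃ c ∈ θ.cuts, IsHub c Q := ⟨c, hc, h⟩
  rw [toVert, dif_pos h', hub_unique hθ h'.choose_spec.1 hc h'.choose_spec.2 h]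

theorem toVert_of_gnode {Q : Fml L} (hQ : GNode θ (.node Q)) : toVert θ Q = .node Q :=
  dif_neg fun ⟨_, hc, h⟩ => not_isHub hθ hc hQ h

theorem toVar_of_isHubVar {Q : Fml L} {c : Fml L × Fml L} {x : ℕ} (hc : c ∈ θ.cuts)
    (h : IsHubVar c x Q) : toVar θ Q = .cut c x := by
  have h' : ∃ c : (Fml L × Fml L) × ℕ, c.1 ∈ θ.cuts ∧ IsHubVar c.1 c.2 Q := ⟨(c, x), hc, h⟩
  have h1 := hub_unique hθ h'.choose_spec.1 hc h'.choose_spec.2.isHub h.isHub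
  have h2 : h'.choose.2 = x := by
    obtain ⟨xs, ys, -, hQ⟩ := h'.choose_spec.2
    obtain ⟨xs', ys', -, hQ'⟩ := h
    rw [hQ] at hQ'
    injection hQ'
  rw [toVar, dif_pos h', h1, h2]

theorem toVar_of_gnode {Q : Fml L} (hQ : GNode θ (.node Q)) : toVar θ Q = .bound Q :=
  dif_neg fun ⟨_, hc, h⟩ => not_isHub hθ hc hQ h.isHub

/-- The chain of a cut binds each variable once, so the bound variable determines the quantifier
within its hub. -/
theorem toVar_inj {Q Q' : Fml L} (hQ : GNode θ (.node Q) ∨ ∃ c ∈ θ.cuts, ∃ x, IsHubVar c x Q)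
    (hQ' : GNode θ (.node Q') ∨ ∃ c ∈ θ.cuts, ∃ x, IsHubVar c x Q') (h : toVar θ Q = toVar θ Q') :
    Q = Q' := by
  rcases hQ with hQ | ⟨c, hc, x, hQ⟩ <;> rcases hQ' with hQ' | ⟨c', hc', x', hQ'⟩
  · rw [toVar_of_gnode hθ hQ, toVar_of_gnode hθ hQ'] at h
    injection h
  · rw [toVar_of_gnode hθ hQ, toVar_of_isHubVar hθ hc' hQ'] at h
    cases h
  · rw [toVar_of_isHubVar hθ hc hQ, toVar_of_gnode hθ hQ'] at h
    cases h
  · rw [toVar_of_isHubVar hθ hc hQ, toVar_of_isHubVar hθ hc' hQ'] at h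
    injection h with h1 h2
    subst h1
    subst h2
    obtain ⟨xs, ys, h1, rfl⟩ := hQ
    obtain ⟨xs', ys', h2, rfl⟩ := hQ'
    have hnd := cutVars_nodup c
    rw [h1, List.nodup_append, List.nodup_cons] at hnd
    rw [((List.append_cons_inj_of_notMem (fun hx => hnd.2.2 x hx x (by simp) rfl) hnd.2.1.1).1
      (h1.symm.trans h2)).2.2]

end

/-! ### Leaves of the encoding -/

/-- A leaf of a sequent as a leaf over the variables of the contracted graph. -/
def Leaf.toG (f : Var → GVar L) (o : Leaf L) : GLeaf L :=
  ⟨o.name, o.terms.map fun t => t.relabel f⟩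

theorem leaves_toG {f : Var → GVar L} {A : Fml L} {i : ℕ} {p : List Bool} {e : ℕ → Var}
    {e' : ℕ → GVar L} (he : ∀ x ∈ A.freeVars, f (e x) = e' x)
    (hf : ∀ q Q, A.sub q = some Q → f (Sum.inr (i, p ++ q)) = .bound Q) :
    (A.leaves i p e).map (Leaf.toG f) = A.gleaves e' := by
  induction A generalizing p e e' with
  | atom l P ts =>
    simp only [Fml.leaves, Fml.gleaves, List.map_cons, List.map_nil, Leaf.toG, Leaf.terms, List.map_ofFn]
    congr 3
    funext k
    simp only [Function.comp, Term.relabel_relabel]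
    refine relabel_congr _ fun v hv => he v ?_
    simp only [Fml.freeVars, Finset.mem_biUnion, Finset.mem_univ, true_and]
    exact ⟨k, (mem_varFinset _).2 hv⟩
  | tensor A B ihA ihB =>
    simp only [Fml.leaves, Fml.gleaves, List.map_append]
    rw [ihA (fun x hx => he x (by simp [Fml.freeVars, hx])) fun q Q hq => ?_,
      ihB (fun x hx => he x (by simp [Fml.freeVars, hx])) fun q Q hq => ?_]
    · simpa using hf (true :: q) Q hq
    · simpa using hf (false :: q) Q hq
  | par A B ihA ihB =>
    simp only [Fml.leaves, Fml.gleaves, List.map_append]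
    rw [ihA (fun x hx => he x (by simp [Fml.freeVars, hx])) fun q Q hq => ?_,
      ihB (fun x hx => he x (by simp [Fml.freeVars, hx])) fun q Q hq => ?_]
    · simpa using hf (true :: q) Q hq
    · simpa using hf (false :: q) Q hq
  | all x A ih =>
    refine ih (fun z hz => ?_) fun q Q hq => by simpa using hf (false :: q) Q hq
    by_cases hzx : z = x
    · subst hzx
      simpa using hf [] _ rfl
    · simp [hzx, he z (by simp [Fml.freeVars, hz, hzx])]
  | ex x A ih =>
    refine ih (fun z hz => ?_) fun q Q hq => by simpa using hf (false :: q) Q hq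
    by_cases hzx : z = x
    · subst hzx
      simpa using hf [] _ rfl
    · simp [hzx, he z (by simp [Fml.freeVars, hz, hzx])]

/-- `xs` is the part of the chain still to come: by `he`, a free variable of the cut is bound by it
or denotes a hub variable already. -/
theorem leaves_chain_toG {f : Var → GVar L} {F : Fml L → GVar L} {c : Fml L × Fml L} {i : ℕ}
    {xs : List ℕ} {p : List Bool} {e : ℕ → Var}
    (he : ∀ x, (x ∈ c.1.freeVars ∨ x ∈ c.2.freeVars) → x ∈ xs ∨ f (e x) = .cut c x)
    (hf : ∀ q Q, (xs.foldr Fml.ex (.tensor c.1 c.2)).sub q = some Q → f (Sum.inr (i, p ++ q)) = F Q)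
    (hF : ∀ ys x zs, xs = ys ++ x :: zs → F (.ex x (zs.foldr Fml.ex (.tensor c.1 c.2))) = .cut c x)
    (hF' : ∀ Q, Sub Q c.1 ∨ Sub Q c.2 → F Q = .bound Q) :
    ((xs.foldr Fml.ex (.tensor c.1 c.2)).leaves i p e).map (Leaf.toG f) =
      c.1.gleaves (.cut c) ++ c.2.gleaves (.cut c) := by
  induction xs generalizing p e with
  | nil =>
    simp only [List.foldr_nil, Fml.leaves, List.map_append]
    rw [leaves_toG (e' := .cut c) (fun x hx => (he x (Or.inl hx)).resolve_left (by simp)) fun q Q hq => ?_,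
      leaves_toG (e' := .cut c) (fun x hx => (he x (Or.inr hx)).resolve_left (by simp)) fun q Q hq => ?_]
    · rw [← hF' Q (Or.inr ⟨q, hq⟩)]
      simpa using hf (true :: q) Q hq
    · rw [← hF' Q (Or.inl ⟨q, hq⟩)]
      simpa using hf (false :: q) Q hq
  | cons x xs ih =>
    refine ih (fun z hz => ?_) (fun q Q hq => ?_) fun ys z zs h => hF (x :: ys) z zs (by rw [h]; rfl)
    · by_cases hzx : z = x
      · subst hzx
        right
        rw [Function.update_self, ← hF [] z xs rfl]
        simpa using hf [] _ rfl
      · rw [Function.update_of_ne hzx]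
        exact (he z hz).imp_left fun h => (List.mem_cons.1 h).resolve_left hzx
    · simpa using hf (false :: q) Q hq

theorem exists_of_occ_leaves {A : Fml L} {i : ℕ} {p : List Bool} {e : ℕ → Var} {o : Leaf L}
    (ho : o ∈ A.leaves i p e) {k : Fin o.arity} {v : Var} (hv : Occ v (o.args k)) :
    (∃ x, v = e x) ∨ ∃ q Q, v = Sum.inr (i, p ++ q) ∧ A.sub q = some Q ∧
      ((∃ x B, Q = .all x B) ∨ ∃ x B, Q = .ex x B) := by
  induction A generalizing p e with
  | atom l P ts =>
    simp only [Fml.leaves, List.mem_singleton] at ho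
    subst ho
    obtain ⟨x, hx, rfl⟩ := (occ_relabel _ _).1 hv
    exact Or.inl ⟨x, rfl⟩
  | tensor A B ihA ihB =>
    rcases List.mem_append.1 ho with ho | ho
    · rcases ihA ho with h | ⟨q, Q, rfl, hq, h⟩
      · exact Or.inl h
      · exact Or.inr ⟨false :: q, Q, by simp, hq, h⟩
    · rcases ihB ho with h | ⟨q, Q, rfl, hq, h⟩
      · exact Or.inl h
      · exact Or.inr ⟨true :: q, Q, by simp, hq, h⟩
  | par A B ihA ihB =>
    rcases List.mem_append.1 ho with ho | ho
    · rcases ihA ho with h | ⟨q, Q, rfl, hq, h⟩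
      · exact Or.inl h
      · exact Or.inr ⟨false :: q, Q, by simp, hq, h⟩
    · rcases ihB ho with h | ⟨q, Q, rfl, hq, h⟩
      · exact Or.inl h
      · exact Or.inr ⟨true :: q, Q, by simp, hq, h⟩
  | all x A ih =>
    rcases ih ho with ⟨z, rfl⟩ | ⟨q, Q, rfl, hq, h⟩
    · by_cases hzx : z = x
      · subst hzx
        exact Or.inr ⟨[], _, by simp, Fml.sub_nil _, Or.inl ⟨_, _, rfl⟩⟩
      · exact Or.inl ⟨z, by simp [hzx]⟩
    · exact Or.inr ⟨false :: q, Q, by simp, hq, h⟩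
  | ex x A ih =>
    rcases ih ho with ⟨z, rfl⟩ | ⟨q, Q, rfl, hq, h⟩
    · by_cases hzx : z = x
      · subst hzx
        exact Or.inr ⟨[], _, by simp, Fml.sub_nil _, Or.inr ⟨_, _, rfl⟩⟩
      · exact Or.inl ⟨z, by simp [hzx]⟩
    · exact Or.inr ⟨false :: q, Q, by simp, hq, h⟩

theorem Occurs.quant {Γ : Sequent L} {a : Addr} (h : Occurs Γ (Sum.inr a)) :
    ∃ Q, subAt Γ a = some Q ∧ ((∃ x B, Q = .all x B) ∨ ∃ x B, Q = .ex x B) := by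
  obtain ⟨o, ho, k, hk⟩ := h
  obtain ⟨i, A, hA, ho⟩ := mem_leaves.1 ho
  rcases exists_of_occ_leaves ho hk with ⟨x, h⟩ | ⟨q, Q, h, hq, hQ⟩
  · cases h
  · cases h
    exact ⟨Q, Option.bind_eq_some_iff.2 ⟨A, hA, hq⟩, hQ⟩

/-- The variable of the contracted graph for a variable of the encoding. -/
noncomputable def renameVar (θ : Net L) : Var → GVar L
  | .inl x => .free x
  | .inr a => ((subAt θ.encode a).map (toVar θ)).getD (.free 0)

theorem renameVar_inr {θ : Net L} {a : Addr} {Q : Fml L} (h : subAt θ.encode a = some Q) :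
    renameVar θ (Sum.inr a) = toVar θ Q := by
  simp [renameVar, h]

/-! ### Leaves and variables of the encoding versus the contracted graph -/

section

variable {θ : Net L} (hθ : θ.names.Nodup)
  (hfv : ∀ c ∈ θ.cuts, c.1.freeVars = c.2.freeVars)
include hθ hfv

/-- The chain lists the free variables of the first formula only. As the second formula has the same
ones, no variable of the cut remains unbound. -/
theorem leaves_encode_toG {i : ℕ} {A : Fml L} (hA : θ.encode[i]? = some A) :
    (∃ B ∈ θ.concl, (A.leaves i [] Sum.inl).map (Leaf.toG (renameVar θ)) = B.gleaves .free ∧ A = B) ∨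
      ∃ c ∈ θ.cuts, (A.leaves i [] Sum.inl).map (Leaf.toG (renameVar θ)) =
        c.1.gleaves (.cut c) ++ c.2.gleaves (.cut c) ∧ A = encodeCut c := by
  have hf : ∀ q Q, A.sub q = some Q → renameVar θ (Sum.inr (i, q)) = toVar θ Q := fun q Q hq =>
    renameVar_inr (Option.bind_eq_some_iff.2 ⟨A, hA, hq⟩)
  have hmem := List.mem_of_getElem? hA
  simp only [Net.encode, List.mem_append, List.mem_map] at hmem
  rcases hmem with hmem | ⟨c, hc, rfl⟩
  · refine Or.inl ⟨A, hmem, leaves_toG (fun x _ => rfl) fun q Q hq => ?_, rfl⟩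
    rw [← toVar_of_gnode hθ ⟨A, Or.inl hmem, q, hq⟩]
    exact hf q Q hq
  · refine Or.inr ⟨c, hc, leaves_chain_toG (F := toVar θ) (fun x hx => Or.inl ?_) hf ?_ ?_, rfl⟩
    · rw [← hfv c hc, or_self] at hx
      simpa using hx
    · exact fun ys x zs h => toVar_of_isHubVar hθ hc ⟨ys, zs, h, rfl⟩
    · rintro Q (h | h)
      · exact toVar_of_gnode hθ ⟨_, Or.inr ⟨c, hc, Or.inl rfl⟩, h⟩
      · exact toVar_of_gnode hθ ⟨_, Or.inr ⟨c, hc, Or.inr rfl⟩, h⟩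

theorem mem_gleaves_iff {o' : GLeaf L} :
    o' ∈ θ.gleaves ↔ ∃ o ∈ leaves θ.encode, o.toG (renameVar θ) = o' := by
  constructor
  · intro h
    rcases mem_gleaves.1 h with ⟨A, hA, h⟩ | ⟨c, hc, A, hA, h⟩
    · obtain ⟨i, hi⟩ := List.mem_iff_getElem?.1 (show A ∈ θ.encode from List.mem_append_left _ hA)
      rcases leaves_encode_toG hθ hfv hi with ⟨B, hB, h1, rfl⟩ | ⟨c, hc, h1, rfl⟩
      · rw [← h1] at h
        obtain ⟨o, ho, rfl⟩ := List.mem_map.1 h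
        exact ⟨o, mem_leaves.2 ⟨i, A, hi, ho⟩, rfl⟩
      · obtain ⟨l, hl⟩ := exists_mem_names (encodeCut c)
        exact (concl_cut_disjoint hθ hA hc hl ((isHub_encodeCut c).names ▸ hl)).elim
    · obtain ⟨i, hi⟩ := List.mem_iff_getElem?.1
        (show encodeCut c ∈ θ.encode from List.mem_append_right _ (List.mem_map_of_mem hc))
      obtain ⟨l, hl⟩ := exists_mem_names (encodeCut c)
      rcases leaves_encode_toG hθ hfv hi with ⟨B, hB, h1, h2⟩ | ⟨c', hc', h1, h2⟩
      · exact (concl_cut_disjoint hθ hB hc (h2 ▸ hl) ((isHub_encodeCut c).names ▸ hl)).elim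
      · have : c = c' := cut_unique hθ hc hc' (l := l) ((isHub_encodeCut c).names ▸ hl)
          ((isHub_encodeCut c').names ▸ h2 ▸ hl)
        subst this
        have : o' ∈ c.1.gleaves (.cut c) ++ c.2.gleaves (.cut c) := by
          rcases hA with rfl | rfl <;> simp [h]
        rw [← h1] at this
        obtain ⟨o, ho, rfl⟩ := List.mem_map.1 this
        exact ⟨o, mem_leaves.2 ⟨i, _, hi, ho⟩, rfl⟩
  · rintro ⟨o, ho, rfl⟩
    obtain ⟨i, A, hA, ho⟩ := mem_leaves.1 ho
    have ho := List.mem_map_of_mem (f := Leaf.toG (renameVar θ)) ho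
    rcases leaves_encode_toG hθ hfv hA with ⟨B, hB, h1, rfl⟩ | ⟨c, hc, h1, rfl⟩
    · rw [h1] at ho
      exact mem_gleaves.2 (Or.inl ⟨A, hB, ho⟩)
    · rw [h1] at ho
      rcases List.mem_append.1 ho with ho | ho
      · exact mem_gleaves.2 (Or.inr ⟨c, hc, _, Or.inl rfl, ho⟩)
      · exact mem_gleaves.2 (Or.inr ⟨c, hc, _, Or.inr rfl, ho⟩)

theorem gOccurs_iff {v : GVar L} :
    GOccurs θ v ↔ ∃ w, Occurs θ.encode w ∧ renameVar θ w = v := by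
  constructor
  · rintro ⟨o', ho', t', ht', hv⟩
    obtain ⟨o, ho, rfl⟩ := (mem_gleaves_iff hθ hfv).1 ho'
    obtain ⟨t, ht, rfl⟩ := List.mem_map.1 ht'
    obtain ⟨k, rfl⟩ := List.mem_ofFn.1 ht
    obtain ⟨w, hw, rfl⟩ := (occ_relabel _ _).1 hv
    exact ⟨w, ⟨o, ho, k, hw⟩, rfl⟩
  · rintro ⟨w, ⟨o, ho, k, hw⟩, rfl⟩
    exact ⟨_, (mem_gleaves_iff hθ hfv).2 ⟨o, ho, rfl⟩, _,
      List.mem_map_of_mem (List.mem_ofFn.2 ⟨k, rfl⟩), (occ_relabel _ _).2 ⟨w, hw, rfl⟩⟩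

omit hfv in
theorem renameVar_inj {a b : Addr} {Q Q' : Fml L} (ha : subAt θ.encode a = some Q)
    (hb : subAt θ.encode b = some Q') (hQ : (∃ x B, Q = .all x B) ∨ ∃ x B, Q = .ex x B)
    (hQ' : (∃ x B, Q' = .all x B) ∨ ∃ x B, Q' = .ex x B)
    (h : renameVar θ (Sum.inr a) = renameVar θ (Sum.inr b)) : a = b := by
  rw [renameVar_inr ha, renameVar_inr hb] at h
  have := toVar_inj hθ (quant_cases ha hQ) (quant_cases hb hQ') h
  subst this
  exact subAt_inj (encode_names θ ▸ hθ) ha hb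

omit hfv in
omit hθ in
theorem isAllVar_iff {a : Addr} {Q : Fml L} (ha : subAt θ.encode a = some Q) :
    IsAllVar θ.encode a ↔ GAll θ Q := by
  constructor
  · rintro ⟨z, A, h⟩
    rw [ha] at h
    cases h
    refine ⟨?_, z, A, rfl⟩
    rcases quant_cases ha (Or.inl ⟨z, A, rfl⟩) with h | ⟨c, hc, x, xs, ys, -, h⟩
    · exact h
    · cases h
  · rintro ⟨-, x, B, rfl⟩
    exact ⟨x, B, ha⟩

theorem IsExVar.gex {a : Addr} (ha : IsExVar θ.encode a) : GEx θ (renameVar θ (Sum.inr a)) := by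
  obtain ⟨⟨z, A, hs⟩, hocc⟩ := isExVar_iff.1 ha
  refine ⟨(gOccurs_iff hθ hfv).2 ⟨_, hocc, rfl⟩, ?_⟩
  rw [renameVar_inr hs]
  rcases quant_cases hs (Or.inr ⟨z, A, rfl⟩) with h | ⟨c, hc, x, h⟩
  · exact Or.inl ⟨z, A, toVar_of_gnode hθ h⟩
  · exact Or.inr ⟨c, x, toVar_of_isHubVar hθ hc h⟩

omit hfv in
theorem renameVar_all {a : Addr} {x : ℕ} {B : Fml L} (ha : subAt θ.encode a = some (.all x B)) :
    renameVar θ (Sum.inr a) = .bound (.all x B) := by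
  rw [renameVar_inr ha, toVar_of_gnode hθ ((isAllVar_iff ha).1 ⟨x, B, ha⟩).1]

theorem GEx.exists_isExVar {v : GVar L} (hv : GEx θ v) :
    ∃ a, IsExVar θ.encode a ∧ renameVar θ (Sum.inr a) = v := by
  obtain ⟨w, hw, rfl⟩ := (gOccurs_iff hθ hfv).1 hv.1
  cases w with
  | inl z => obtain ⟨-, ⟨_, _, h⟩ | ⟨_, _, h⟩⟩ := hv <;> cases h
  | inr a =>
    obtain ⟨Q, ha, ⟨x, B, rfl⟩ | ⟨x, B, rfl⟩⟩ := hw.quant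
    · rw [renameVar_all hθ ha] at hv
      obtain ⟨-, ⟨_, _, h⟩ | ⟨_, _, h⟩⟩ := hv <;> cases h
    · exact ⟨a, isExVar_iff.2 ⟨⟨x, B, ha⟩, hw⟩, rfl⟩

end

/-! ### Unifiers of the encoding and of the contracted graph -/

section

variable {θ : Net L} (hθ : θ.names.Nodup)
  (hfv : ∀ c ∈ θ.cuts, c.1.freeVars = c.2.freeVars)
include hθ

/-- The renaming is injective on quantifiers, so it cannot make another variable look like that of
`B`. -/
theorem occ_relabel_renameVar {t : L.Term Var} {b : Addr} {B : Fml L}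
    (ht : ∀ y, Occ (Sum.inr y) t → IsAllVar θ.encode y) (hb : subAt θ.encode b = some B)
    (hB : ∃ x B', B = .all x B') (h : Occ (.bound B) (t.relabel (renameVar θ))) :
    Occ (Sum.inr b) t := by
  obtain ⟨v, hv, h⟩ := (occ_relabel _ _).1 h
  cases v with
  | inl z => cases h
  | inr y =>
    obtain ⟨z, A, hy⟩ := ht y hv
    have : y = b := by
      refine renameVar_inj hθ hy hb (Or.inl ⟨z, A, rfl⟩) (Or.inl hB) ?_
      obtain ⟨x, B', rfl⟩ := hB
      rw [h, renameVar_all hθ hb]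
    exact this ▸ hv

include hfv

open Classical in
/-- A unifier of the contracted graph from a unifier of the encoding. -/
theorem IsUnifier.exists_gUnifier {σ : Var → L.Term Var} (hσ : IsUnifier θ.encode θ.links σ) :
    ∃ τ, GUnifier θ τ ∧ ∀ a, IsExVar θ.encode a →
      τ (renameVar θ (Sum.inr a)) = (σ (Sum.inr a)).relabel (renameVar θ) := by
  let τ : GVar L → L.Term (GVar L) := fun w =>
    if h : ∃ a, IsExVar θ.encode a ∧ renameVar θ (Sum.inr a) = w then
      (σ (Sum.inr h.choose)).relabel (renameVar θ) else .var w
  have hτ : ∀ a, IsExVar θ.encode a →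
      τ (renameVar θ (Sum.inr a)) = (σ (Sum.inr a)).relabel (renameVar θ) := by
    intro a ha
    have h : ∃ a', IsExVar θ.encode a' ∧ renameVar θ (Sum.inr a') = renameVar θ (Sum.inr a) :=
      ⟨a, ha, rfl⟩
    obtain ⟨⟨z, A, hs⟩, -⟩ := ha
    obtain ⟨⟨z', A', hs'⟩, -⟩ := h.choose_spec.1
    have := renameVar_inj hθ hs' hs (Or.inr ⟨_, _, rfl⟩) (Or.inr ⟨_, _, rfl⟩) h.choose_spec.2
    simp only [τ]
    rw [dif_pos h, this]
  have hτ' : ∀ w, ¬ GEx θ w → τ w = .var w := fun w hw =>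
    dif_neg fun ⟨a, ha, h⟩ => hw (h ▸ ha.gex hθ hfv)
  have key : ∀ v, Occurs θ.encode v → τ (renameVar θ v) = (σ v).relabel (renameVar θ) := by
    intro v hv
    cases v with
    | inl z =>
      rw [hσ.1, hτ']
      · rfl
      · rintro ⟨-, ⟨_, _, h⟩ | ⟨_, _, h⟩⟩ <;> cases h
    | inr a =>
      obtain ⟨Q, ha, ⟨x, B, rfl⟩ | ⟨x, B, rfl⟩⟩ := hv.quant
      · have hna : ¬ IsExVar θ.encode a := fun ⟨⟨z, A, h⟩, _⟩ => by
          rw [ha] at h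
          cases h
        rw [hσ.2.1 a hna, hτ']
        · rfl
        · rw [renameVar_all hθ ha]
          rintro ⟨-, ⟨_, _, h⟩ | ⟨_, _, h⟩⟩ <;> cases h
      · exact hτ a (isExVar_iff.2 ⟨⟨x, B, ha⟩, hv⟩)
  refine ⟨τ, ⟨hτ', ?_, ?_⟩, hτ⟩
  · intro v hv w hw
    obtain ⟨a, ha, rfl⟩ := GEx.exists_isExVar hθ hfv hv
    rw [hτ a ha] at hw
    obtain ⟨v, hv, rfl⟩ := (occ_relabel _ _).1 hw
    cases v with
    | inl z => exact Or.inl ⟨z, rfl⟩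
    | inr y =>
      have hy := hσ.2.2.1 a ha y ((mem_varFinset _).2 hv)
      obtain ⟨z, A, hs⟩ := hy
      exact Or.inr ⟨_, renameVar_all hθ hs, (isAllVar_iff hs).1 ⟨z, A, hs⟩⟩
  · have hk : ∀ o ∈ leaves θ.encode, ((o.toG (renameVar θ)).terms.map fun t => t.subst τ) =
        (List.ofFn fun k => (o.args k).subst σ).map fun t => t.relabel (renameVar θ) := by
      intro o ho
      rw [Leaf.ofFn_subst, Leaf.toG, List.map_map, List.map_map]
      refine List.map_congr_left fun t ht => ?_
      obtain ⟨k, rfl⟩ := List.mem_ofFn.1 ht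
      simp only [Function.comp, relabel_subst, relabel_eq_subst _ (Term.subst _ _), subst_subst]
      refine subst_congr _ fun v hv => ?_
      rw [key v ⟨o, ho, k, hv⟩, relabel_eq_subst]
    intro o ho o' ho' hl
    obtain ⟨o, ho₁, rfl⟩ := (mem_gleaves_iff hθ hfv).1 ho
    obtain ⟨o', ho₂, rfl⟩ := (mem_gleaves_iff hθ hfv).1 ho'
    rw [hk o ho₁, hk o' ho₂, hσ.2.2.2 o ho₁ o' ho₂ hl]

open Classical in
/-- A unifier of the encoding from a unifier of the contracted graph. -/
theorem GUnifier.exists_isUnifier {τ : GVar L → L.Term (GVar L)} (hτ : GUnifier θ τ) :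
    ∃ σ, IsUnifier θ.encode θ.links σ ∧ ∀ a y, IsExVar θ.encode a → Occ (Sum.inr y) (σ (Sum.inr a)) →
      ∃ B, subAt θ.encode y = some B ∧ Occ (.bound B) (τ (renameVar θ (Sum.inr a))) := by
  -- The values of a unifier at existential variables contain no hub variables, so the value of `g`
  -- on them is a dummy.
  let g : GVar L → Var := fun w => match w with
    | .free z => .inl z
    | .cut _ _ => .inl 0
    | .bound B => if h : ∃ b, subAt θ.encode b = some B ∧ IsAllVar θ.encode b then .inr h.choose
        else .inl 0
  have hg : ∀ w y, g w = .inr y → ∃ B, w = .bound B ∧ subAt θ.encode y = some B ∧ IsAllVar θ.encode y := by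
    intro w y h
    cases w with
    | free z => cases h
    | cut c z => cases h
    | bound B =>
      simp only [g] at h
      split_ifs at h with h'
      cases h
      exact ⟨B, rfl, h'.choose_spec⟩
  let σ : Var → L.Term Var := fun v => match v with
    | .inl z => .var (.inl z)
    | .inr a => if IsExVar θ.encode a then (τ (renameVar θ (.inr a))).relabel g else .var (.inr a)
  have hσ : ∀ a, IsExVar θ.encode a → σ (.inr a) = (τ (renameVar θ (.inr a))).relabel g :=
    fun a ha => if_pos ha
  have key : ∀ v, Occurs θ.encode v → (τ (renameVar θ v)).relabel g = σ v := by
    intro v hv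
    cases v with
    | inl z =>
      rw [hτ.fixes]
      · rfl
      · rintro ⟨-, ⟨_, _, h⟩ | ⟨_, _, h⟩⟩ <;> cases h
    | inr a =>
      obtain ⟨Q, ha, ⟨x, B, rfl⟩ | ⟨x, B, rfl⟩⟩ := hv.quant
      · have h1 : σ (.inr a) = .var (.inr a) :=
          if_neg fun ⟨⟨z, A, h⟩, _⟩ => by
            rw [ha] at h
            cases h
        rw [h1, renameVar_all hθ ha, hτ.fixes]
        · have h : ∃ b, subAt θ.encode b = some (.all x B) ∧ IsAllVar θ.encode b := ⟨a, ha, x, B, ha⟩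
          have : g (.bound (.all x B)) = .inr a := by
            simp only [g]
            rw [dif_pos h, subAt_inj (encode_names θ ▸ hθ) h.choose_spec.1 ha]
          rw [← this]
          rfl
        · rintro ⟨-, ⟨_, _, h⟩ | ⟨_, _, h⟩⟩ <;> cases h
      · exact (hσ a (isExVar_iff.2 ⟨⟨x, B, ha⟩, hv⟩)).symm
  refine ⟨σ, ⟨fun z => rfl, fun a ha => if_neg ha, ?_, ?_⟩, ?_⟩
  · intro a ha y hy
    rw [mem_varFinset, hσ a ha] at hy
    obtain ⟨w, -, hw⟩ := (occ_relabel _ _).1 hy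
    obtain ⟨B, -, -, h⟩ := hg w y hw
    exact h
  · have hk : ∀ o ∈ leaves θ.encode, (List.ofFn fun k => (o.args k).subst σ) =
        ((o.toG (renameVar θ)).terms.map fun t => t.subst τ).map fun t => t.relabel g := by
      intro o ho
      rw [Leaf.ofFn_subst, Leaf.toG, List.map_map, List.map_map]
      refine List.map_congr_left fun t ht => ?_
      obtain ⟨k, rfl⟩ := List.mem_ofFn.1 ht
      simp only [Function.comp, relabel_subst, relabel_eq_subst _ (Term.subst _ _), subst_subst]
      refine subst_congr _ fun v hv => ?_
      rw [← key v ⟨o, ho, k, hv⟩, relabel_eq_subst]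
    intro o ho o' ho' hl
    rw [hk o ho, hk o' ho', hτ.eq _ ((mem_gleaves_iff hθ hfv).2 ⟨o, ho, rfl⟩) _
      ((mem_gleaves_iff hθ hfv).2 ⟨o', ho', rfl⟩) hl]
  · intro a y ha hy
    rw [hσ a ha] at hy
    obtain ⟨w, hw, h⟩ := (occ_relabel _ _).1 hy
    obtain ⟨B, rfl, hB, -⟩ := hg w y h
    exact ⟨B, hB, hw⟩

theorem unifiable_iff : (∃ τ, GUnifier θ τ) ↔ ∃ σ, IsUnifier θ.encode θ.links σ :=
  ⟨fun ⟨_, h⟩ => (h.exists_isUnifier hθ hfv).imp fun _ h => h.1,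
    fun ⟨_, h⟩ => (IsUnifier.exists_gUnifier hθ hfv h).imp fun _ h => h.1⟩

/-- A unifier of the contracted graph translates to the encoding without new occurrences of
universal variables, so an occurrence forced there is already present here. -/
theorem Precedes.gprecedes (hu : ∃ σ, IsUnifier θ.encode θ.links σ) {a b : Addr}
    (h : Precedes θ.encode θ.links a b) :
    ∃ B, subAt θ.encode b = some B ∧ GPrecedes θ (renameVar θ (Sum.inr a)) B := by
  obtain ⟨ha, hb, h⟩ := (precedes_iff hu).1 h
  obtain ⟨x, B, hB⟩ := hb
  refine ⟨_, hB, ha.gex hθ hfv, (isAllVar_iff hB).1 ⟨x, B, hB⟩, fun τ hτ => ?_⟩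
  obtain ⟨σ, hσ, hocc⟩ := hτ.exists_isUnifier hθ hfv
  obtain ⟨B', hB', hocc⟩ := hocc a b ha (h σ hσ)
  rw [hB, Option.some.injEq] at hB'
  exact hB' ▸ hocc

theorem GPrecedes.precedes (hu : ∃ σ, IsUnifier θ.encode θ.links σ) {a b : Addr} {B : Fml L}
    (ha : IsExVar θ.encode a) (hb : subAt θ.encode b = some B)
    (h : GPrecedes θ (renameVar θ (Sum.inr a)) B) : Precedes θ.encode θ.links a b := by
  refine (precedes_iff hu).2 ⟨ha, (isAllVar_iff hb).2 h.2.1, fun σ hσ => ?_⟩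
  obtain ⟨τ, hτ, hστ⟩ := IsUnifier.exists_gUnifier hθ hfv hσ
  have := h.2.2 τ hτ
  rw [hστ a ha] at this
  exact occ_relabel_renameVar hθ (fun y hy => hσ.2.2.1 a ha y ((mem_varFinset _).2 hy)) hb h.2.1.2 this

/-- The witness is a translated most general unifier: a universal variable occurs in it only because
of a leap. -/
theorem gprincipal (hu : ∃ σ, IsUnifier θ.encode θ.links σ) : GPrincipal θ := by
  obtain ⟨σ, hσ⟩ := exists_isMGU hu
  obtain ⟨τ, hτ, hστ⟩ := IsUnifier.exists_gUnifier hθ hfv hσ.1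
  refine ⟨τ, hτ, fun v A hv hA h => ?_⟩
  obtain ⟨a, ha, rfl⟩ := GEx.exists_isExVar hθ hfv hv
  obtain ⟨b, hb⟩ := exists_subAt_encode.2 (Or.inl hA.1)
  rw [hστ a ha] at h
  have := occ_relabel_renameVar hθ (fun y hy => hσ.1.2.2.1 a ha y ((mem_varFinset _).2 hy)) hb hA.2 h
  obtain ⟨B, hB, h⟩ := Precedes.gprecedes hθ hfv hu
    ⟨ha, (isAllVar_iff hb).2 hA, σ, hσ, (mem_varFinset _).2 this⟩
  rw [hb, Option.some.injEq] at hB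
  exact hB ▸ h

end

/-! ### Vertices of the encoding and of the contracted graph -/

/-- The subformula at a vertex. -/
def Vertex.val {Γ : Sequent L} (a : Vertex Γ) : Fml L := (subAt Γ a.1).get a.2

theorem Vertex.subAt_eq {Γ : Sequent L} (a : Vertex Γ) : subAt Γ a.1 = some a.val :=
  (Option.some_get a.2).symm

theorem exists_vertex {Γ : Sequent L} {a : Addr} {Q : Fml L} (h : subAt Γ a = some Q) :
    ∃ b : Vertex Γ, b.1 = a ∧ b.val = Q := by
  refine ⟨⟨a, by rw [h]; rfl⟩, rfl, ?_⟩
  simp [Vertex.val, h]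

theorem Vertex.ext_val {Γ : Sequent L} (hΓ : (Γ.flatMap Fml.names).Nodup) {a b : Vertex Γ}
    (h : a.val = b.val) : a = b :=
  Subtype.ext (subAt_inj hΓ a.subAt_eq (h ▸ b.subAt_eq))

theorem child_of_addr {Γ : Sequent L} {a b : Vertex Γ} (h : a.1.1 = b.1.1 ∧ ∃ d, a.1.2 = b.1.2 ++ [d]) :
    Child a.val b.val := by
  obtain ⟨h1, d, h2⟩ := h
  refine child_iff_sub.2 ⟨d, ?_⟩
  have ha := a.subAt_eq
  have hb := b.subAt_eq
  obtain ⟨A, hA, hb⟩ := Option.bind_eq_some_iff.1 hb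
  obtain ⟨A', hA', ha⟩ := Option.bind_eq_some_iff.1 ha
  rw [h1, hA, Option.some.injEq] at hA'
  subst hA'
  rw [h2, sub_append, hb] at ha
  exact ha

theorem exists_child_vertex {Γ : Sequent L} {b : Vertex Γ} {Q : Fml L} (h : Child Q b.val) :
    ∃ a : Vertex Γ, a.val = Q ∧ a.1.1 = b.1.1 ∧ ∃ d, a.1.2 = b.1.2 ++ [d] := by
  obtain ⟨d, hd⟩ := child_iff_sub.1 h
  obtain ⟨A, hA, hb⟩ := Option.bind_eq_some_iff.1 b.subAt_eq
  obtain ⟨a, ha, hQ⟩ := exists_vertex (Γ := Γ) (a := (b.1.1, b.1.2 ++ [d])) (Q := Q)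
    (Option.bind_eq_some_iff.2 ⟨A, hA, by rw [sub_append, hb]; exact hd⟩)
  exact ⟨a, hQ, by rw [ha], d, by rw [ha]⟩

theorem isSwitched_iff {Γ : Sequent L} {b : Vertex Γ} :
    IsSwitched Γ b ↔ (∃ A B, b.val = .par A B) ∨ ∃ x A, b.val = .all x A := by
  simp only [IsSwitched, b.subAt_eq, Option.some.injEq]

theorem linked_iff {Γ : Sequent L} {Λ : Finset (Sym2 ℕ)} {a b : Vertex Γ} :
    Linked Γ Λ a b ↔ ∃ (l m : ℕ) (n n' : ℕ) (P : L.Relations n) (Q : L.Relations n')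
      (ts : Fin n → L.Term ℕ) (us : Fin n' → L.Term ℕ),
      a.val = .atom l P ts ∧ b.val = .atom m Q us ∧ s(l, m) ∈ Λ := by
  simp only [Linked, Vertex.subAt_eq, Option.some.injEq]

theorem Linked.not_switched {Γ : Sequent L} {Λ : Finset (Sym2 ℕ)} {a b : Vertex Γ}
    (h : Linked Γ Λ a b) : ¬ IsSwitched Γ a ∧ ¬ IsSwitched Γ b := by
  obtain ⟨l, m, n, n', P, Q, ts, us, h1, h2, -⟩ := linked_iff.1 h
  simp [isSwitched_iff, h1, h2]

/-- The projection of the vertices of the encoding to the contracted graph. -/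
noncomputable def proj (θ : Net L) (a : Vertex θ.encode) : GVert L := toVert θ a.val

section

variable {θ : Net L} (hθ : θ.names.Nodup)
  (hfv : ∀ c ∈ θ.cuts, c.1.freeVars = c.2.freeVars)

theorem proj_eq_node {a : Vertex θ.encode} {A : Fml L} (h : proj θ a = .node A) : a.val = A :=
  toVert_eq_node h

theorem vertex_cases (a : Vertex θ.encode) : GNode θ (.node a.val) ∨ ∃ c ∈ θ.cuts, IsHub c a.val :=
  exists_subAt_encode.1 ⟨_, a.subAt_eq⟩

include hθ

theorem gnode_proj (a : Vertex θ.encode) : GNode θ (proj θ a) := by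
  rcases vertex_cases a with h | ⟨c, hc, h⟩
  · rw [proj, toVert_of_gnode hθ h]
    exact h
  · rw [proj, toVert_of_isHub hθ hc h]
    exact hc

theorem exists_proj_eq {u : GVert L} (hu : GNode θ u) : ∃ a, proj θ a = u := by
  cases u with
  | node A =>
    obtain ⟨a, ha⟩ := exists_subAt_encode.2 (Or.inl hu)
    obtain ⟨b, -, rfl⟩ := exists_vertex ha
    exact ⟨b, toVert_of_gnode hθ hu⟩
  | hub c =>
    obtain ⟨a, ha⟩ := exists_subAt_encode.2 (Or.inr ⟨c, hu, isHub_encodeCut c⟩)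
    obtain ⟨b, -, hb⟩ := exists_vertex ha
    exact ⟨b, toVert_of_isHub hθ hu (hb ▸ isHub_encodeCut c)⟩

theorem proj_eq_node_inj {a b : Vertex θ.encode} {A : Fml L} (ha : proj θ a = .node A)
    (hb : proj θ b = .node A) : a = b :=
  Vertex.ext_val (encode_names θ ▸ hθ) ((proj_eq_node ha).trans (proj_eq_node hb).symm)

theorem gswitched_proj {b : Vertex θ.encode} : GSwitched (proj θ b) ↔ IsSwitched θ.encode b := by
  rw [isSwitched_iff]
  constructor
  · intro h
    generalize hu : proj θ b = u at h
    cases h with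
    | par A B => exact Or.inl ⟨A, B, proj_eq_node hu⟩
    | all x A => exact Or.inr ⟨x, A, proj_eq_node hu⟩
  · intro h
    rcases vertex_cases b with hb | ⟨c, hc, hb⟩
    · rw [proj, toVert_of_gnode hθ hb]
      rcases h with ⟨A, B, h⟩ | ⟨x, A, h⟩ <;> rw [h] <;> constructor
    · rcases hb.cases with hb | ⟨x, B, hb, -⟩ <;> simp [hb] at h

/-- The contraction merges only tensors and existential quantifiers. Being injective on switched
vertices, it lets switchings be transferred both ways. -/
theorem eq_of_isSwitched {a b : Vertex θ.encode} (hb : IsSwitched θ.encode b)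
    (h : proj θ a = proj θ b) : a = b := by
  have hsw := (gswitched_proj hθ).2 hb
  generalize hv : proj θ b = v at hsw
  cases hsw <;> exact proj_eq_node_inj hθ (h.trans hv) hv

theorem glink_proj {a b : Vertex θ.encode} :
    GLink θ (proj θ a) (proj θ b) ↔ Linked θ.encode θ.links a b := by
  rw [linked_iff]
  constructor
  · rintro ⟨-, -, l, m, n, n', P, Q, ts, us, h1, h2, h⟩
    exact ⟨l, m, n, n', P, Q, ts, us, proj_eq_node h1, proj_eq_node h2, h⟩
  · rintro ⟨l, m, n, n', P, Q, ts, us, h1, h2, h⟩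
    have key : ∀ (a : Vertex θ.encode) (l n : ℕ) (P : L.Relations n) (ts : Fin n → L.Term ℕ),
        a.val = .atom l P ts → proj θ a = .node (.atom l P ts) := by
      intro a l n P ts h
      rcases vertex_cases a with ha | ⟨c, hc, ha⟩
      · rw [proj, toVert_of_gnode hθ ha, h]
      · rcases ha.cases with hb | ⟨x, B, hb, -⟩ <;> simp [hb] at h
    exact ⟨gnode_proj hθ a, gnode_proj hθ b, l, m, n, n', P, Q, ts, us, key _ _ _ _ _ h1, key _ _ _ _ _ h2, h⟩

theorem isVert_proj {a : Vertex θ.encode} (h : IsExVar θ.encode a.1) :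
    IsVert (renameVar θ (Sum.inr a.1)) (proj θ a) := by
  obtain ⟨⟨z, A, h⟩, -⟩ := h
  rw [a.subAt_eq, Option.some.injEq] at h
  rw [renameVar_inr a.subAt_eq]
  rcases quant_cases a.subAt_eq (Or.inr ⟨z, A, h⟩) with h | ⟨c, hc, x, h⟩
  · rw [toVar_of_gnode hθ h, proj, toVert_of_gnode hθ h]
    constructor
  · rw [toVar_of_isHubVar hθ hc h, proj, toVert_of_isHub hθ hc h.isHub]
    constructor

theorem arc_or_hub_of_child {a b : Vertex θ.encode} (h : Child a.val b.val) :
    (∃ c, proj θ a = .hub c ∧ proj θ b = .hub c) ∨ GArc θ (proj θ a) (proj θ b) := by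
  rcases vertex_cases b with hb | ⟨c, hc, hb⟩
  · right
    rw [proj, proj, toVert_of_gnode hθ hb, toVert_of_gnode hθ (hb.child h)]
    exact GArc.child _ _ hb h
  · have hpb : proj θ b = .hub c := toVert_of_isHub hθ hc hb
    rcases hb.cases with hb | ⟨x, B, hb, hB, -⟩
    · right
      rw [hb] at h
      have h := child_tensor.1 h
      rw [hpb, proj, toVert_of_gnode hθ (Root.gnode (Or.inr ⟨c, hc, h⟩))]
      exact GArc.cut _ _ hc h
    · left
      rw [hb] at h
      have h := child_ex.1 h
      exact ⟨c, toVert_of_isHub hθ hc (h ▸ hB), hpb⟩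

include hfv

theorem arc_proj (hu : ∃ σ, IsUnifier θ.encode θ.links σ) {a b : Vertex θ.encode}
    (h : Arc θ.encode θ.links a b) :
    (∃ c, proj θ a = .hub c ∧ proj θ b = .hub c) ∨ GArc θ (proj θ a) (proj θ b) := by
  rcases h with h | h
  · exact arc_or_hub_of_child hθ (child_of_addr h)
  · right
    have ha := ((precedes_iff hu).1 h).1
    obtain ⟨B, hB, h⟩ := h.gprecedes hθ hfv hu
    rw [b.subAt_eq, Option.some.injEq] at hB
    subst hB
    rw [proj.eq_def θ b, toVert_of_gnode hθ h.2.1.1]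
    exact GArc.leap _ _ _ h (isVert_proj hθ ha)

theorem exists_arc (hu : ∃ σ, IsUnifier θ.encode θ.links σ) {u v : GVert L} (h : GArc θ u v) :
    ∃ a b, proj θ a = u ∧ proj θ b = v ∧ Arc θ.encode θ.links a b := by
  cases h with
  | child A B hB h =>
    obtain ⟨b, hb⟩ := exists_proj_eq hθ hB
    rw [← proj_eq_node hb] at h
    obtain ⟨a, ha, h'⟩ := exists_child_vertex h
    refine ⟨a, b, ?_, hb, Or.inl h'⟩
    rw [proj_eq_node hb] at h
    rw [proj, ha, toVert_of_gnode hθ (hB.child h)]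
  | cut A c hc h =>
    obtain ⟨b₀, hb⟩ := exists_subAt_encode.2 (Or.inr ⟨c, hc, isHub_tensor c⟩)
    obtain ⟨b, -, hb⟩ := exists_vertex hb
    obtain ⟨a, ha, h'⟩ := exists_child_vertex (hb ▸ child_tensor.2 h)
    refine ⟨a, b, ?_, ?_, Or.inl h'⟩
    · rw [proj, ha, toVert_of_gnode hθ (Root.gnode (Or.inr ⟨c, hc, h⟩))]
    · rw [proj, hb, toVert_of_isHub hθ hc (isHub_tensor c)]
  | leap v u A h hv =>
    obtain ⟨b, hb⟩ := exists_proj_eq hθ h.2.1.1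
    obtain ⟨a₀, ha, rfl⟩ := GEx.exists_isExVar hθ hfv h.1
    obtain ⟨⟨z, B, hs⟩, -⟩ := id ha
    obtain ⟨a, rfl, -⟩ := exists_vertex hs
    refine ⟨a, b, ?_, hb, Or.inr (h.precedes hθ hfv hu ha ?_)⟩
    · have := isVert_proj hθ ha
      generalize renameVar θ (Sum.inr a.1) = v at this hv
      generalize proj θ a = u' at this
      cases this <;> cases hv <;> rfl
    · rw [b.subAt_eq, proj_eq_node hb]

-- Fibres of the projection are connected: within a chain, argument edges into existential
-- quantifiers, which no switching deletes, lead down to the tensor.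
omit hfv in
theorem reachable_of_hub {w : Vertex θ.encode → Vertex θ.encode} {H : SimpleGraph (Vertex θ.encode)}
    (hH : ∀ a b, Kept θ.encode θ.links w a b → (∃ c, proj θ b = .hub c) → H.Reachable a b)
    {a b : Vertex θ.encode} (h : proj θ a = proj θ b) : H.Reachable a b := by
  cases hv : proj θ b with
  | node B => rw [proj_eq_node_inj hθ (h.trans hv) hv]
  | hub c =>
    have key : ∀ n (a : Vertex θ.encode), a.val.size = n → proj θ a = .hub c →
        ∃ t : Vertex θ.encode, t.val = .tensor c.1 c.2 ∧ H.Reachable a t := by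
      intro n
      induction n using Nat.strong_induction_on with
      | _ n ih =>
        intro a hn ha
        obtain ⟨hc, hac⟩ := toVert_eq_hub ha
        rcases hac.cases with hac | ⟨x, B, hac, hB, -⟩
        · exact ⟨a, hac, .refl a⟩
        · obtain ⟨a', ha', h'⟩ := exists_child_vertex (b := a) (Q := B) (hac ▸ child_ex.2 rfl)
          have hpa' : proj θ a' = .hub c := toVert_of_isHub hθ hc (ha' ▸ hB)
          obtain ⟨t, ht, hat⟩ := ih _ (by rw [← hn, hac, ha']; simp [Fml.size]) a' rfl hpa'
          refine ⟨t, ht, (hH a' a ⟨Or.inl h', fun hsw => ?_⟩ ⟨c, ha⟩).symm.trans hat⟩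
          simp [isSwitched_iff, hac] at hsw
    obtain ⟨t, ht, hat⟩ := key _ a rfl (h.trans hv)
    obtain ⟨t', ht', hbt⟩ := key _ b rfl hv
    rw [Vertex.ext_val (encode_names θ ▸ hθ) (ht.trans ht'.symm)] at hat
    exact hat.trans hbt.symm

/-- Connections in the contracted graph lift to the encoding. -/
theorem GConn.reachable (hu : ∃ σ, IsUnifier θ.encode θ.links σ)
    {w : Vertex θ.encode → Vertex θ.encode} {g : GVert L → GVert L} {X : Set (GVert L)}
    {H : SimpleGraph (Vertex θ.encode)} (hw : IsSwitching θ.encode θ.links w)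
    (hwg : ∀ b, IsSwitched θ.encode b → proj θ (w b) = g (proj θ b)) (hX : ∀ c, .hub c ∉ X)
    (hlink : ∀ a b, Linked θ.encode θ.links a b → H.Reachable a b)
    (hkept : ∀ a b, Kept θ.encode θ.links w a b → proj θ b ∉ X → H.Reachable a b)
    {u v : GVert L} (h : GConn θ g X u v) :
    (GNode θ u ↔ GNode θ v) ∧ ∀ a b, proj θ a = u → proj θ b = v → H.Reachable a b := by
  have hfib : ∀ {a b}, proj θ a = proj θ b → H.Reachable a b := fun h =>
    reachable_of_hub hθ (fun a b hab ⟨c, hc⟩ => hkept a b hab (hc ▸ hX c)) h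
  induction h with
  | rel u v h =>
    rcases h with h | ⟨h, hvX, hsw⟩
    · refine ⟨iff_of_true h.1 h.2.1, ?_⟩
      rintro a b rfl rfl
      exact hlink a b ((glink_proj hθ).1 h)
    · refine ⟨iff_of_true h.gnode_left h.gnode_right, ?_⟩
      rintro a b rfl rfl
      obtain ⟨a₀, b₀, ha₀, hb₀, h₀⟩ := exists_arc hθ hfv hu h
      -- At a switched vertex the surviving edge comes from `w b`, which lies over the source `u`.
      -- Edges into other vertices survive in every switching.
      by_cases hb : IsSwitched θ.encode b
      · have h1 := hkept (w b) b ⟨hw b hb, fun _ => rfl⟩ hvX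
        exact (hfib ((hsw ((gswitched_proj hθ).2 hb)).symm.trans (hwg b hb).symm)).trans h1
      · have h1 := hkept a₀ b₀ ⟨h₀, fun h => absurd ((gswitched_proj hθ).2 h)
          (hb₀ ▸ fun h => hb ((gswitched_proj hθ).1 h))⟩ (hb₀ ▸ hvX)
        exact ((hfib ha₀.symm).trans h1).trans (hfib hb₀)
  | refl u => exact ⟨Iff.rfl, fun a b ha hb => hfib (ha.trans hb.symm)⟩
  | symm u v _ ih => exact ⟨ih.1.symm, fun a b ha hb => (ih.2 b a hb ha).symm⟩
  | trans u v x _ _ ih ih' =>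
    refine ⟨ih.1.trans ih'.1, ?_⟩
    rintro a b rfl rfl
    obtain ⟨c, hc⟩ := exists_proj_eq hθ (ih.1.1 (gnode_proj hθ a))
    exact (ih.2 a c rfl hc).trans (ih'.2 c b hc rfl)

open Classical in
/-- Every switching of the contracted graph lifts to the encoding. -/
theorem GSwitching.exists_isSwitching (hu : ∃ σ, IsUnifier θ.encode θ.links σ) {g : GVert L → GVert L}
    (hg : GSwitching θ g) : ∃ w, IsSwitching θ.encode θ.links w ∧
      ∀ b, IsSwitched θ.encode b → proj θ (w b) = g (proj θ b) := by
  have key : ∀ b, ∃ a, IsSwitched θ.encode b → Arc θ.encode θ.links a b ∧ proj θ a = g (proj θ b) := by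
    intro b
    by_cases hb : IsSwitched θ.encode b
    · have hsw := (gswitched_proj hθ).2 hb
      obtain ⟨a, b', ha, hb', h⟩ := exists_arc hθ hfv hu (hg _ (gnode_proj hθ b) hsw)
      exact ⟨a, fun _ => ⟨eq_of_isSwitched hθ hb hb' ▸ h, ha⟩⟩
    · exact ⟨b, fun h => absurd h hb⟩
  choose w hw using key
  exact ⟨w, fun b hb => (hw b hb).1, fun b hb => (hw b hb).2⟩

/-- An edge of the encoding projects to an edge of the contracted graph or collapses inside a hub.
-/
theorem gedge_of_adj (hu : ∃ σ, IsUnifier θ.encode θ.links σ)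
    {w : Vertex θ.encode → Vertex θ.encode} {g : GVert L → GVert L}
    (hwg : ∀ b, IsSwitched θ.encode b → proj θ (w b) = g (proj θ b))
    {a b : Vertex θ.encode} (h : (switchGraph θ.encode θ.links w).Reachable a b) :
    GConn θ g ∅ (proj θ a) (proj θ b) := by
  have key : ∀ a b : Vertex θ.encode, Linked θ.encode θ.links a b ∨ Kept θ.encode θ.links w a b →
      GConn θ g ∅ (proj θ a) (proj θ b) := by
    rintro a b (h | ⟨h, hsw⟩)
    · exact .rel _ _ (Or.inl ((glink_proj hθ).2 h))
    · rcases arc_proj hθ hfv hu h with ⟨c, h1, h2⟩ | h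
      · rw [h1, h2]
        exact .refl _
      · refine .rel _ _ (Or.inr ⟨h, Set.notMem_empty _, fun hb => ?_⟩)
        have hb := (gswitched_proj hθ).1 hb
        rw [← hwg b hb, hsw hb]
  obtain ⟨p⟩ := h
  induction p with
  | nil => exact .refl _
  | cons hadj _ ih =>
    rcases (SimpleGraph.fromRel_adj _ _ _).1 hadj with ⟨-, h | h⟩
    · exact .trans _ _ _ (key _ _ h) ih
    · exact .trans _ _ _ (.symm _ _ (key _ _ h)) ih

/-- The contracted graph of a correct linking. -/
theorem IsCorrect.contract (h : IsCorrect θ.encode θ.links) :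
    GConnected θ ∧ GPrincipal θ ∧ GBridges θ := by
  obtain ⟨hu, h⟩ := h
  refine ⟨⟨(unifiable_iff hθ hfv).2 hu, fun g hg u v hu' hv => ?_⟩, gprincipal hθ hfv hu, ?_⟩
  · obtain ⟨w, hw, hwg⟩ := hg.exists_isSwitching hθ hfv hu
    obtain ⟨a, rfl⟩ := exists_proj_eq hθ hu'
    obtain ⟨b, rfl⟩ := exists_proj_eq hθ hv
    exact gedge_of_adj hθ hfv hu hwg ((h w hw).1.1.preconnected a b)
  · intro g hg v hv hsw hcon
    obtain ⟨w, hw, hwg⟩ := hg.exists_isSwitching hθ hfv hu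
    obtain ⟨b, rfl⟩ := exists_proj_eq hθ hv
    have hb := (gswitched_proj hθ).1 hsw
    obtain ⟨htree, hpar⟩ := h w hw
    have hk : Kept θ.encode θ.links w (w b) b := ⟨hw b hb, fun _ => rfl⟩
    -- A loop would count as a pair of parallel edges.
    have hne : w b ≠ b := fun h => hpar (w b) b ⟨hk, by rw [h] at hk ⊢; exact hk⟩
    have hadj : (switchGraph θ.encode θ.links w).Adj (w b) b :=
      (SimpleGraph.fromRel_adj _ _ _).2 ⟨hne, Or.inl (Or.inr hk)⟩
    have hbr := SimpleGraph.isBridge_iff.1 (SimpleGraph.isAcyclic_iff_forall_adj_isBridge.1 htree.2 hadj)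
    -- Deleting the edges into `v` from the contracted switching corresponds to deleting the single
    -- edge from `w b` to `b`. A connection that avoids them would lift to a path that avoids a
    -- bridge of the tree.
    refine hbr ?_
    refine (GConn.reachable hθ hfv hu hw hwg (fun c h => ?_) ?_ ?_ hcon).2 _ _ (hwg b hb) rfl
    · rw [Set.mem_singleton_iff] at h
      rw [← h] at hsw
      cases hsw
    · intro a a' h
      by_cases haa : a = a'
      · rw [haa]
      refine SimpleGraph.Adj.reachable ?_
      rw [SimpleGraph.deleteEdges_adj]
      refine ⟨(SimpleGraph.fromRel_adj _ _ _).2 ⟨haa, Or.inl (Or.inl h)⟩, fun hs => ?_⟩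
      rcases Sym2.eq_iff.1 (Set.mem_singleton_iff.1 hs) with ⟨-, rfl⟩ | ⟨rfl, -⟩
      · exact h.not_switched.2 hb
      · exact h.not_switched.1 hb
    · intro a a' h hX
      by_cases haa : a = a'
      · rw [haa]
      refine SimpleGraph.Adj.reachable ?_
      rw [SimpleGraph.deleteEdges_adj]
      refine ⟨(SimpleGraph.fromRel_adj _ _ _).2 ⟨haa, Or.inl (Or.inr h)⟩, fun hs => ?_⟩
      rcases Sym2.eq_iff.1 (Set.mem_singleton_iff.1 hs) with ⟨-, rfl⟩ | ⟨rfl, rfl⟩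
      · exact hX rfl
      -- The deleted edge could only reappear as an edge kept in the opposite direction, which would
      -- be parallel to it.
      · exact hpar _ _ ⟨h, hk⟩

open Classical in
/-- If the contracted graph is connected, then so are the switchings of the encoding. -/
theorem GConnected.preconnected (h : GConnected θ) :
    (∃ σ, IsUnifier θ.encode θ.links σ) ∧ ∀ w, IsSwitching θ.encode θ.links w →
      (switchGraph θ.encode θ.links w).Preconnected := by
  have hu := (unifiable_iff hθ hfv).1 h.1
  refine ⟨hu, fun w hw a b => ?_⟩
  let g : GVert L → GVert L := fun u =>
    if h : ∃ b, IsSwitched θ.encode b ∧ proj θ b = u then proj θ (w h.choose) else u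
  have hwg : ∀ b, IsSwitched θ.encode b → proj θ (w b) = g (proj θ b) := by
    intro b hb
    have h : ∃ b', IsSwitched θ.encode b' ∧ proj θ b' = proj θ b := ⟨b, hb, rfl⟩
    have : h.choose = b := eq_of_isSwitched hθ hb h.choose_spec.2
    simp only [g]
    rw [dif_pos h, this]
  have hg : GSwitching θ g := by
    intro v hv hsw
    obtain ⟨b, rfl⟩ := exists_proj_eq hθ hv
    have hb := (gswitched_proj hθ).1 hsw
    rw [← hwg b hb]
    rcases arc_proj hθ hfv hu (hw b hb) with ⟨c, -, hc⟩ | h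
    · rw [hc] at hsw
      cases hsw
    · exact h
  refine (GConn.reachable hθ hfv hu hw hwg (fun c => Set.notMem_empty _) ?_ ?_
    (h.2 g hg _ _ (gnode_proj hθ a) (gnode_proj hθ b))).2 a b rfl rfl
  · intro a a' h
    by_cases haa : a = a'
    · rw [haa]
    · exact SimpleGraph.Adj.reachable ((SimpleGraph.fromRel_adj _ _ _).2 ⟨haa, Or.inl (Or.inl h)⟩)
  · intro a a' h _
    by_cases haa : a = a'
    · rw [haa]
    · exact SimpleGraph.Adj.reachable ((SimpleGraph.fromRel_adj _ _ _).2 ⟨haa, Or.inl (Or.inr h)⟩)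

end

/-! ### Counting vertices and edges -/

/-- All subformulas. -/
def Fml.subs : Fml L → List (Fml L)
  | .atom l P ts => [.atom l P ts]
  | .tensor A B => .tensor A B :: (A.subs ++ B.subs)
  | .par A B => .par A B :: (A.subs ++ B.subs)
  | .all x A => .all x A :: A.subs
  | .ex x A => .ex x A :: A.subs

/-- The contribution of a vertex to twice the Euler characteristic of a switching. -/
def Fml.weight : Fml L → ℤ
  | .atom _ _ _ => 1
  | .tensor _ _ => -2
  | _ => 0

/-- The sum of the weights of all subformulas. -/
def Fml.balance : Fml L → ℤ
  | .atom _ _ _ => 1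
  | .tensor A B => A.balance + B.balance - 2
  | .par A B => A.balance + B.balance
  | .all _ A => A.balance
  | .ex _ A => A.balance

theorem mem_subs {A Q : Fml L} : Q ∈ A.subs ↔ Sub Q A := by
  induction A with
  | atom l P ts => simp [Fml.subs, sub_atom]
  | tensor A B ihA ihB => simp [Fml.subs, sub_tensor, ihA, ihB]
  | par A B ihA ihB => simp [Fml.subs, sub_par, ihA, ihB]
  | all x A ih => simp [Fml.subs, sub_all, ih]
  | ex x A ih => simp [Fml.subs, sub_ex, ih]

theorem sum_weight_subs (A : Fml L) : (A.subs.map Fml.weight).sum = A.balance := by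
  induction A with
  | atom l P ts => simp [Fml.subs, Fml.weight, Fml.balance]
  | tensor A B ihA ihB => simp [Fml.subs, Fml.weight, Fml.balance, ihA, ihB]; ring
  | par A B ihA ihB => simp [Fml.subs, Fml.weight, Fml.balance, ihA, ihB]
  | all x A ih => simp [Fml.subs, Fml.weight, Fml.balance, ih]
  | ex x A ih => simp [Fml.subs, Fml.weight, Fml.balance, ih]

theorem not_sub_of_disjoint {A B Q : Fml L} (h : A.names.Disjoint B.names) (hA : Sub Q A) : ¬ Sub Q B :=
  fun hB => by
    obtain ⟨l, hl⟩ := exists_mem_names Q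
    exact h (hA.names_subset hl) (hB.names_subset hl)

theorem subs_append_nodup {A B : Fml L} (hA : A.names.Nodup → A.subs.Nodup)
    (hB : B.names.Nodup → B.subs.Nodup) (h : (A.names ++ B.names).Nodup) :
    (A.subs ++ B.subs).Nodup := by
  obtain ⟨h1, h2, h3⟩ := List.nodup_append'.1 h
  exact List.nodup_append'.2 ⟨hA h1, hB h2, fun Q hQ hQ' =>
    not_sub_of_disjoint h3 (mem_subs.1 hQ) (mem_subs.1 hQ')⟩

theorem subs_nodup {A : Fml L} (hA : A.names.Nodup) : A.subs.Nodup := by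
  induction A with
  | atom l P ts => simp [Fml.subs]
  | tensor A B ihA ihB =>
    refine List.nodup_cons.2 ⟨fun h => ?_, subs_append_nodup ihA ihB (by simpa using hA)⟩
    simp only [List.mem_append, mem_subs] at h
    rcases h with h | h <;> have := h.size_le <;> simp only [Fml.size] at this <;> omega
  | par A B ihA ihB =>
    refine List.nodup_cons.2 ⟨fun h => ?_, subs_append_nodup ihA ihB (by simpa using hA)⟩
    simp only [List.mem_append, mem_subs] at h
    rcases h with h | h <;> have := h.size_le <;> simp only [Fml.size] at this <;> omega
  | all x A ih =>
    refine List.nodup_cons.2 ⟨fun h => ?_, ih hA⟩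
    have := (mem_subs.1 h).size_le
    simp only [Fml.size] at this
    omega
  | ex x A ih =>
    refine List.nodup_cons.2 ⟨fun h => ?_, ih hA⟩
    have := (mem_subs.1 h).size_le
    simp only [Fml.size] at this
    omega

theorem flatMap_subs_nodup {Γ : Sequent L} (hΓ : (Γ.flatMap Fml.names).Nodup) :
    (Γ.flatMap Fml.subs).Nodup := by
  rw [List.nodup_flatMap] at hΓ ⊢
  refine ⟨fun A hA => subs_nodup (hΓ.1 A hA), hΓ.2.imp fun h Q hQ hQ' => ?_⟩
  exact not_sub_of_disjoint h (mem_subs.1 hQ) (mem_subs.1 hQ')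

theorem mem_flatMap_subs {Γ : Sequent L} {Q : Fml L} :
    Q ∈ Γ.flatMap Fml.subs ↔ ∃ a : Vertex Γ, a.val = Q := by
  have : (∃ a : Vertex Γ, a.val = Q) ↔ ∃ a, subAt Γ a = some Q :=
    ⟨fun ⟨a, h⟩ => ⟨a.1, h ▸ a.subAt_eq⟩, fun ⟨a, h⟩ => (exists_vertex h).imp fun _ h => h.2⟩
  rw [this, exists_subAt]
  simp [List.mem_flatMap, mem_subs]

theorem finite_vertex {Γ : Sequent L} (hΓ : (Γ.flatMap Fml.names).Nodup) : Finite (Vertex Γ) := by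
  classical
  refine Finite.of_injective (β := {Q // Q ∈ (Γ.flatMap Fml.subs).toFinset})
    (fun a => ⟨a.val, List.mem_toFinset.2 (mem_flatMap_subs.2 ⟨a, rfl⟩)⟩) fun a b h => ?_
  exact Vertex.ext_val hΓ (Subtype.ext_iff.1 h)

/-- Vertices correspond to subformulas, each of which is listed once, so the sum follows the
recursion on formulas. -/
theorem sum_weight_vertex {Γ : Sequent L} (hΓ : (Γ.flatMap Fml.names).Nodup) [Fintype (Vertex Γ)] :
    ∑ a : Vertex Γ, a.val.weight = (Γ.map Fml.balance).sum := by
  classical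
  have h1 : ∑ a : Vertex Γ, a.val.weight = ∑ Q ∈ (Γ.flatMap Fml.subs).toFinset, Q.weight := by
    refine Finset.sum_nbij (fun a => a.val) ?_ ?_ ?_ fun _ _ => rfl
    · exact fun a _ => List.mem_toFinset.2 (mem_flatMap_subs.2 ⟨a, rfl⟩)
    · exact fun a _ b _ h => Vertex.ext_val hΓ h
    · intro Q hQ
      obtain ⟨a, ha⟩ := mem_flatMap_subs.1 (List.mem_toFinset.1 hQ)
      exact ⟨a, Finset.mem_coe.2 (Finset.mem_univ _), ha⟩
  rw [h1, List.sum_toFinset _ (flatMap_subs_nodup hΓ)]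
  clear h1 hΓ
  induction Γ with
  | nil => rfl
  | cons A Γ ih => rw [List.flatMap_cons, List.map_append, List.sum_append, ih, sum_weight_subs,
      List.map_cons, List.sum_cons]

-- Ordered adjacent pairs are counted: those of `l`, and those of `k` and its converse by inclusion
-- and exclusion. The correction term consists of the parallel edges that a simple graph merges.
open Classical in
theorem two_mul_card_edges {V : Type*} [Fintype V] {G : SimpleGraph V} {l k : V → V → Prop}
    (hG : ∀ a b, G.Adj a b ↔ l a b ∨ k a b ∨ k b a) (hlk : ∀ a b, l a b → ¬ k a b ∧ ¬ k b a) :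
    2 * G.edgeFinset.card + (Finset.univ.filter fun p : V × V => k p.1 p.2 ∧ k p.2 p.1).card =
      ∑ b, ((Finset.univ.filter fun a => l a b).card + 2 * (Finset.univ.filter fun a => k a b).card) := by
  have hcount : ∀ r : V → V → Prop, (Finset.univ.filter fun p : V × V => r p.1 p.2).card =
      ∑ b, (Finset.univ.filter fun a => r a b).card := by
    intro r
    simp only [Finset.card_filter]
    rw [Fintype.sum_prod_type_right]
  have hswap : (Finset.univ.filter fun p : V × V => k p.2 p.1).card =
      (Finset.univ.filter fun p : V × V => k p.1 p.2).card := by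
    refine Finset.card_nbij Prod.swap ?_ ?_ ?_
    · exact fun p hp => by simpa using hp
    · exact Prod.swap_injective.injOn
    · rintro ⟨a, b⟩ h
      exact ⟨(b, a), by simpa using h, rfl⟩
  have h1 : (Finset.univ.filter fun p : V × V => G.Adj p.1 p.2) =
      (Finset.univ.filter fun p : V × V => l p.1 p.2) ∪
        ((Finset.univ.filter fun p : V × V => k p.1 p.2) ∪
          (Finset.univ.filter fun p : V × V => k p.2 p.1)) := by
    ext p
    simp [hG]
  have h2 : Disjoint (Finset.univ.filter fun p : V × V => l p.1 p.2)
      ((Finset.univ.filter fun p : V × V => k p.1 p.2) ∪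
          (Finset.univ.filter fun p : V × V => k p.2 p.1)) := by
    rw [Finset.disjoint_left]
    intro p hp hp'
    simp only [Finset.mem_union, Finset.mem_filter, Finset.mem_univ, true_and] at hp hp'
    exact hp'.elim (hlk _ _ hp).1 (hlk _ _ hp).2
  have h3 := Finset.card_union_add_card_inter (Finset.univ.filter fun p : V × V => k p.1 p.2)
    (Finset.univ.filter fun p : V × V => k p.2 p.1)
  rw [← Finset.filter_and] at h3
  have h4 := congrArg Finset.card h1
  rw [Finset.card_union_of_disjoint h2] at h4
  have h5 : 2 * G.edgeFinset.card = (Finset.univ.filter fun p : V × V => G.Adj p.1 p.2).card := by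
    rw [G.two_mul_card_edgeFinset]
  rw [Finset.sum_add_distrib, ← Finset.mul_sum, ← hcount, ← hcount]
  omega

/-! ### Degrees in a switching and its Euler characteristic -/

section

variable {Γ : Sequent L} {Λ : Finset (Sym2 ℕ)}

theorem Precedes.cases {a b : Vertex Γ} (h : Precedes Γ Λ a.1 b.1) :
    (∃ x A, a.val = .ex x A) ∧ ∃ x A, b.val = .all x A := by
  obtain ⟨⟨⟨x, A, h⟩, -⟩, ⟨y, B, h'⟩, -⟩ := h
  rw [a.subAt_eq, Option.some.injEq] at h
  rw [b.subAt_eq, Option.some.injEq] at h'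
  exact ⟨⟨x, A, h⟩, y, B, h'⟩

/-- Leaps enter only universal quantifiers, so elsewhere the incoming edges are the argument edges.
-/
theorem arc_iff_child (hΓ : (Γ.flatMap Fml.names).Nodup) {a b : Vertex Γ}
    (hb : ∀ x A, b.val ≠ .all x A) : Arc Γ Λ a b ↔ Child a.val b.val := by
  constructor
  · rintro (h | h)
    · exact child_of_addr h
    · obtain ⟨x, A, h⟩ := h.cases.2
      exact absurd h (hb x A)
  · intro h
    obtain ⟨a', ha', h⟩ := exists_child_vertex h
    rw [← Vertex.ext_val hΓ ha']
    exact Or.inl h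

theorem Arc.ne {a b : Vertex Γ} (h : Arc Γ Λ a b) : a ≠ b := by
  rintro rfl
  rcases h with ⟨-, d, h⟩ | h
  · simpa using congrArg List.length h
  · obtain ⟨⟨x, A, h1⟩, y, B, h2⟩ := h.cases
    rw [h1] at h2
    cases h2

theorem Linked.not_arc {a b : Vertex Γ} (h : Linked Γ Λ a b) : ¬ Arc Γ Λ a b ∧ ¬ Arc Γ Λ b a := by
  obtain ⟨l, m, n, n', P, Q, ts, us, h1, h2, -⟩ := linked_iff.1 h
  constructor
  · rintro (h | h)
    · exact not_child_atom (h2 ▸ child_of_addr h)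
    · obtain ⟨x, A, h⟩ := h.cases.2
      rw [h2] at h
      cases h
  · rintro (h | h)
    · exact not_child_atom (h1 ▸ child_of_addr h)
    · obtain ⟨x, A, h⟩ := h.cases.2
      rw [h1] at h
      cases h

theorem Linked.symm {a b : Vertex Γ} (h : Linked Γ Λ a b) : Linked Γ Λ b a := by
  obtain ⟨l, m, n, n', P, Q, ts, us, h1, h2, h3⟩ := h
  exact ⟨m, l, n', n, Q, P, us, ts, h2, h1, Sym2.eq_swap ▸ h3⟩

theorem exists_isSwitching (Γ : Sequent L) (Λ : Finset (Sym2 ℕ)) : ∃ w, IsSwitching Γ Λ w := by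
  have : ∀ b : Vertex Γ, ∃ a, IsSwitched Γ b → Arc Γ Λ a b := by
    intro b
    by_cases hb : IsSwitched Γ b
    · have : ∃ Q, Child Q b.val := by
        rcases isSwitched_iff.1 hb with ⟨A, B, h⟩ | ⟨x, A, h⟩ <;> rw [h]
        · exact ⟨A, child_par.2 (Or.inl rfl)⟩
        · exact ⟨A, child_all.2 rfl⟩
      obtain ⟨Q, hQ⟩ := this
      obtain ⟨a, -, h⟩ := exists_child_vertex hQ
      exact ⟨a, fun _ => Or.inl h⟩
    · exact ⟨b, fun h => absurd h hb⟩
  choose w hw using this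
  exact ⟨w, hw⟩

variable {D : Duality L}

theorem Linked.ne (hΛ : IsLinking D Γ Λ) {a b : Vertex Γ} (h : Linked Γ Λ a b) : a ≠ b := by
  rintro rfl
  obtain ⟨l, m, n, n', P, Q, ts, us, h1, h2, h3⟩ := linked_iff.1 h
  rw [h1] at h2
  injection h2 with h2
  exact (isLinking_iff.1 hΛ).ne h3 h2

theorem vertex_atom_unique (hΓ : (Γ.flatMap Fml.names).Nodup) {a b : Vertex Γ} {l n n' : ℕ}
    {P : L.Relations n} {Q : L.Relations n'} {ts : Fin n → L.Term ℕ} {us : Fin n' → L.Term ℕ}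
    (ha : a.val = .atom l P ts) (hb : b.val = .atom l Q us) : a = b := by
  have key : ∀ {a : Vertex Γ}, GNode ⟨Γ, [], ∅⟩ (.node a.val) := fun {a} => by
    obtain ⟨A, hA, h⟩ := exists_subAt.1 ⟨_, a.subAt_eq⟩
    exact ⟨A, Or.inl hA, h⟩
  have h1 := key (a := a)
  have h2 := key (a := b)
  rw [ha] at h1
  rw [hb] at h2
  refine Vertex.ext_val hΓ ?_
  rw [ha, hb]
  exact gnode_atom_unique (θ := ⟨Γ, [], ∅⟩) (by simpa [Net.names] using hΓ) h1 h2

open Classical in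
/-- The degrees of a vertex in a switching. -/
theorem weight_eq (hΛ : IsLinking D Γ Λ) {w : Vertex Γ → Vertex Γ} (hw : IsSwitching Γ Λ w)
    [Fintype (Vertex Γ)] (b : Vertex Γ) :
    ((Finset.univ.filter fun a => Linked Γ Λ a b).card +
      2 * (Finset.univ.filter fun a => Kept Γ Λ w a b).card : ℤ) = 2 - b.val.weight := by
  have hS := isLinking_iff.1 hΛ
  have hΓ : (Γ.flatMap Fml.names).Nodup := by rw [← leaves_sequent_name]; exact hΛ.1
  have hlink : (∀ l n (P : L.Relations n) ts, b.val ≠ .atom l P ts) →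
      (Finset.univ.filter fun a => Linked Γ Λ a b).card = 0 := by
    intro h
    rw [Finset.card_eq_zero, Finset.filter_eq_empty_iff]
    intro a _ hl
    obtain ⟨l, m, n, n', P, Q, ts, us, h1, h2, -⟩ := linked_iff.1 hl
    exact h _ _ _ _ h2
  have hsw : IsSwitched Γ b → (Finset.univ.filter fun a => Kept Γ Λ w a b).card = 1 := by
    intro h
    refine Finset.card_eq_one.2 ⟨w b, ?_⟩
    ext a
    simp only [Finset.mem_filter, Finset.mem_univ, true_and, Finset.mem_singleton]
    constructor
    · exact fun h' => (h'.2 h).symm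
    · rintro rfl
      exact ⟨hw b h, fun _ => rfl⟩
  have hch : ¬ IsSwitched Γ b → ∀ a, Kept Γ Λ w a b ↔ Child a.val b.val := by
    intro h a
    rw [← arc_iff_child (Λ := Λ) hΓ fun x A hb => h (isSwitched_iff.2 (Or.inr ⟨x, A, hb⟩))]
    exact ⟨fun h => h.1, fun h' => ⟨h', fun h'' => absurd h'' h⟩⟩
  cases hb : b.val with
  | atom l P ts =>
    have h0 : (Finset.univ.filter fun a => Kept Γ Λ w a b).card = 0 := by
      rw [Finset.card_eq_zero, Finset.filter_eq_empty_iff]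
      intro a _ h
      rw [hch (by simp [isSwitched_iff, hb]), hb] at h
      exact not_child_atom h
    have h1 : (Finset.univ.filter fun a => Linked Γ Λ a b).card = 1 := by
      obtain ⟨A, hA, hs⟩ := exists_subAt.1 ⟨_, b.subAt_eq⟩
      rw [hb] at hs
      obtain ⟨⟨m, n', Q⟩, ho', hl⟩ := hS.exists_partner
        (List.mem_flatMap.2 ⟨A, hA, mem_sigs.2 ⟨ts, hs⟩⟩)
      obtain ⟨A', hA', ho'⟩ := List.mem_flatMap.1 ho'
      obtain ⟨us, ho'⟩ := mem_sigs.1 ho'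
      obtain ⟨a, ha⟩ := mem_flatMap_subs.1 (List.mem_flatMap.2 ⟨A', hA', mem_subs.2 ho'⟩)
      refine Finset.card_eq_one.2 ⟨a, ?_⟩
      ext a'
      simp only [Finset.mem_filter, Finset.mem_univ, true_and, Finset.mem_singleton]
      constructor
      · intro h
        obtain ⟨l', m', n₁, n₂, P', Q', ts', us', h1, h2, h3⟩ := linked_iff.1 h
        rw [hb] at h2
        injection h2 with h2
        subst h2
        have := hS.eq_of_left hl (Sym2.eq_swap ▸ h3)
        subst this
        exact vertex_atom_unique hΓ h1 ha
      · rintro rfl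
        exact linked_iff.2 ⟨m, l, _, _, Q, P, us, ts, ha, hb, Sym2.eq_swap ▸ hl⟩
    rw [h0, h1]
    simp [Fml.weight]
  | tensor A B =>
    have h2 : (Finset.univ.filter fun a => Kept Γ Λ w a b).card = 2 := by
      obtain ⟨a, ha, -⟩ := exists_child_vertex (b := b) (hb ▸ child_tensor.2 (Or.inl rfl))
      obtain ⟨a', ha', -⟩ := exists_child_vertex (b := b) (hb ▸ child_tensor.2 (Or.inr rfl))
      refine Finset.card_eq_two.2 ⟨a, a', ?_, ?_⟩
      · rintro rfl
        rw [ha] at ha'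
        obtain ⟨R, hR, hs⟩ := exists_subAt.1 ⟨_, b.subAt_eq⟩
        have hn := (hs.names_sublist).nodup ((List.nodup_flatMap.1 hΓ).1 R hR)
        rw [hb, names_tensor, ha'] at hn
        obtain ⟨l, hl⟩ := exists_mem_names B
        exact (List.nodup_append'.1 hn).2.2 hl hl
      · ext x
        simp only [Finset.mem_filter, Finset.mem_univ, true_and, Finset.mem_insert,
          Finset.mem_singleton]
        rw [hch (by simp [isSwitched_iff, hb]), hb, child_tensor]
        exact or_congr ⟨fun h => Vertex.ext_val hΓ (h.trans ha.symm), fun h => h ▸ ha⟩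
          ⟨fun h => Vertex.ext_val hΓ (h.trans ha'.symm), fun h => h ▸ ha'⟩
    rw [hlink (by simp [hb]), h2]
    simp [Fml.weight]
  | par A B =>
    rw [hlink (by simp [hb]), hsw (by simp [isSwitched_iff, hb])]
    simp [Fml.weight]
  | all x A =>
    rw [hlink (by simp [hb]), hsw (by simp [isSwitched_iff, hb])]
    simp [Fml.weight]
  | ex x A =>
    have h1 : (Finset.univ.filter fun a => Kept Γ Λ w a b).card = 1 := by
      obtain ⟨a, ha, -⟩ := exists_child_vertex (b := b) (hb ▸ child_ex.2 rfl)
      refine Finset.card_eq_one.2 ⟨a, ?_⟩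
      ext x
      simp only [Finset.mem_filter, Finset.mem_univ, true_and, Finset.mem_singleton]
      rw [hch (by simp [isSwitched_iff, hb]), hb, child_ex]
      exact ⟨fun h => Vertex.ext_val hΓ (h.trans ha.symm), fun h => h ▸ ha⟩
    rw [hlink (by simp [hb]), h1]
    simp [Fml.weight]

-- Summing `weight_eq` over all vertices fixes the Euler characteristic, parallel edges included, by
-- the formulas alone: neither the leaps nor the choices of the switching enter.
open Classical in
theorem balance_eq (hΛ : IsLinking D Γ Λ) {w : Vertex Γ → Vertex Γ} (hw : IsSwitching Γ Λ w)
    [Fintype (Vertex Γ)] : (2 * (switchGraph Γ Λ w).edgeFinset.card +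
      (Finset.univ.filter fun p : Vertex Γ × Vertex Γ =>
        Kept Γ Λ w p.1 p.2 ∧ Kept Γ Λ w p.2 p.1).card : ℤ) =
      2 * Fintype.card (Vertex Γ) - (Γ.map Fml.balance).sum := by
  have hΓ : (Γ.flatMap Fml.names).Nodup := by rw [← leaves_sequent_name]; exact hΛ.1
  have h := two_mul_card_edges (G := switchGraph Γ Λ w) (l := Linked Γ Λ) (k := Kept Γ Λ w) ?_ ?_
  · have h := congrArg (fun n : ℕ => (n : ℤ)) h
    push_cast at h
    rw [h, Finset.sum_congr rfl fun b _ => weight_eq hΛ hw b, Finset.sum_sub_distrib,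
      sum_weight_vertex hΓ]
    simp [mul_comm]
  · intro a b
    rw [switchGraph, SimpleGraph.fromRel_adj]
    constructor
    · rintro ⟨-, (h | h) | h | h⟩
      · exact Or.inl h
      · exact Or.inr (Or.inl h)
      · exact Or.inl h.symm
      · exact Or.inr (Or.inr h)
    · rintro (h | h | h)
      · exact ⟨h.ne hΛ, Or.inl (Or.inl h)⟩
      · exact ⟨h.1.ne, Or.inl (Or.inr h)⟩
      · exact ⟨h.1.ne.symm, Or.inr (Or.inr h)⟩
  · exact fun a b h => ⟨fun h' => h.not_arc.1 h'.1, fun h' => h.not_arc.2 h'.1⟩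

/-- The balance of a correct linking is two. -/
theorem IsCorrect.balance (hΛ : IsLinking D Γ Λ) (h : IsCorrect Γ Λ) :
    (Γ.map Fml.balance).sum = 2 := by
  classical
  have hΓ : (Γ.flatMap Fml.names).Nodup := by rw [← leaves_sequent_name]; exact hΛ.1
  have := finite_vertex hΓ
  have := Fintype.ofFinite (Vertex Γ)
  obtain ⟨w, hw⟩ := exists_isSwitching Γ Λ
  obtain ⟨htree, hpar⟩ := h.2 w hw
  have h1 := balance_eq hΛ hw
  have h2 := htree.card_edgeFinset
  rw [Finset.filter_false_of_mem fun p _ => hpar p.1 p.2, Finset.card_empty] at h1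
  omega

/-- A linking with connected switchings is correct if its balance is two. -/
theorem isCorrect_of_preconnected (hΛ : IsLinking D Γ Λ) (hu : ∃ σ, IsUnifier Γ Λ σ)
    (hc : ∀ w, IsSwitching Γ Λ w → (switchGraph Γ Λ w).Preconnected)
    (hb : (Γ.map Fml.balance).sum = 2) : IsCorrect Γ Λ := by
  classical
  have hΓ : (Γ.flatMap Fml.names).Nodup := by rw [← leaves_sequent_name]; exact hΛ.1
  have := finite_vertex hΓ
  have := Fintype.ofFinite (Vertex Γ)
  refine ⟨hu, fun w hw => ?_⟩
  have h1 := balance_eq hΛ hw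
  -- Without vertices the balance would be zero.
  have hne : Nonempty (Vertex Γ) := by
    by_contra hne
    rw [not_nonempty_iff] at hne
    rw [← sum_weight_vertex hΓ, Fintype.sum_empty] at hb
    omega
  have hcon : (switchGraph Γ Λ w).Connected := ⟨hc w hw⟩
  have h2 := hcon.card_vert_le_card_edgeSet_add_one
  rw [Nat.card_eq_fintype_card, Nat.card_eq_fintype_card, ← SimpleGraph.edgeFinset_card] at h2
  -- A connected graph has at least one edge less than it has vertices. The count leaves no room for
  -- a further edge or for parallel edges.
  refine ⟨SimpleGraph.isTree_iff_connected_and_card.2 ⟨hcon, ?_⟩, fun a b h => ?_⟩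
  · rw [Nat.card_eq_fintype_card, Nat.card_eq_fintype_card, ← SimpleGraph.edgeFinset_card]
    omega
  · have h3 : 0 < (Finset.univ.filter fun p : Vertex Γ × Vertex Γ =>
        Kept Γ Λ w p.1 p.2 ∧ Kept Γ Λ w p.2 p.1).card :=
      Finset.card_pos.2 ⟨(a, b), by simpa using h⟩
    omega

end

/-! ### Cut reduction preserves unification nets -/

variable {D : Duality L}

theorem IsDual.freeVars_eq {A A' : Fml L} (h : IsDual D A A') : A.freeVars = A'.freeVars := by
  induction h with
  | atom i j P ts => rfl
  | tensor _ _ ih ih' => rw [Fml.freeVars, Fml.freeVars, ih, ih']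
  | par _ _ ih ih' => rw [Fml.freeVars, Fml.freeVars, ih, ih']
  | all x _ ih => rw [Fml.freeVars, Fml.freeVars, ih]
  | ex x _ ih => rw [Fml.freeVars, Fml.freeVars, ih]

theorem balance_chain (xs : List ℕ) (A : Fml L) : (xs.foldr Fml.ex A).balance = A.balance := by
  induction xs with
  | nil => rfl
  | cons x xs ih => rw [List.foldr_cons, Fml.balance, ih]

theorem balance_encode (θ : Net L) : (θ.encode.map Fml.balance).sum =
    (θ.concl.map Fml.balance).sum + (θ.cuts.map fun c => c.1.balance + c.2.balance - 2).sum := by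
  rw [Net.encode, List.map_append, List.sum_append, List.map_map]
  congr 3
  funext c
  rw [Function.comp, encodeCut, balance_chain, Fml.balance]

theorem IsSigLinking.perm {S S' : List (Sig L)} {Λ : Finset (Sym2 ℕ)} (h : IsSigLinking D S Λ)
    (hp : S.Perm S') : IsSigLinking D S' Λ :=
  ⟨(hp.map _).nodup_iff.1 h.1, by simpa only [hp.mem_iff] using h.2.1,
    by simpa only [hp.mem_iff] using h.2.2⟩

namespace Net.IsUnet

variable {θ : Net L} (h : θ.IsUnet D)
include h

theorem isSigLinking : IsSigLinking D θ.sigs θ.links := encode_sigs θ ▸ isLinking_iff.1 h.2.1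

theorem names_nodup : θ.names.Nodup := h.isSigLinking.names_nodup

theorem freeVars_eq : ∀ c ∈ θ.cuts, c.1.freeVars = c.2.freeVars := fun c hc => (h.1 c hc).freeVars_eq

theorem contract : GConnected θ ∧ GPrincipal θ ∧ GBridges θ :=
  IsCorrect.contract h.names_nodup h.freeVars_eq h.2.2

theorem balance : (θ.encode.map Fml.balance).sum = 2 := h.2.2.balance h.2.1

end Net.IsUnet

/-- Acyclicity needs no argument of its own: connectedness and the balance force it. -/
theorem isUnet_of_gconnected {θ : Net L} (hd : ∀ c ∈ θ.cuts, IsDual D c.1 c.2)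
    (hS : IsSigLinking D θ.sigs θ.links) (hG : GConnected θ)
    (hb : (θ.encode.map Fml.balance).sum = 2) : θ.IsUnet D := by
  have hΛ : IsLinking D θ.encode θ.links := isLinking_iff.2 (by rwa [encode_sigs])
  obtain ⟨hu, hc⟩ := hG.preconnected hS.names_nodup fun c hc => (hd c hc).freeVars_eq
  exact ⟨hd, hΛ, isCorrect_of_preconnected hΛ hu hc hb⟩

theorem sigs_perm_of_cuts {Γ : List (Fml L)} {pre post cs : List (Fml L × Fml L)}
    {c₀ : Fml L × Fml L} {Λ Λ' : Finset (Sym2 ℕ)} (h : (cutSigs c₀).Perm (cs.flatMap cutSigs)) :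
    (Net.mk Γ (pre ++ c₀ :: post) Λ).sigs.Perm (Net.mk Γ (pre ++ (cs ++ post)) Λ').sigs := by
  simp only [Net.sigs, List.flatMap_append, List.flatMap_cons]
  exact ((h.append_right _).append_left _).append_left _

/-! ### Nets are preserved by multiplicative and quantifier reductions -/

section Mul

variable {Γ : List (Fml L)} {pre post : List (Fml L × Fml L)} {Λ : Finset (Sym2 ℕ)} {A B A' B' : Fml L}

/-- The weight -2 of the reduced tensor is taken over by the tensor that encodes the additional cut,
so the balance is unchanged. -/
theorem Net.IsUnet.mul {c₀ : Fml L × Fml L} (h : (Net.mk Γ (pre ++ c₀ :: post) Λ).IsUnet D)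
    (hc₀ : c₀ = (.tensor A B, .par A' B') ∨ c₀ = (.par A B, .tensor A' B')) :
    (Net.mk Γ (pre ++ ([(A, A'), (B, B')] ++ post)) Λ).IsUnet D := by
  have hd : IsDual D A A' ∧ IsDual D B B' := by
    have := h.1 c₀ (by simp)
    rcases hc₀ with rfl | rfl <;> cases this <;> exact ⟨‹_›, ‹_›⟩
  refine isUnet_of_gconnected ?_ (h.isSigLinking.perm (sigs_perm_of_cuts ?_)) ?_ ?_
  · intro c hc
    simp only [List.mem_append, List.mem_cons, List.not_mem_nil, or_false] at hc
    rcases hc with hc | (rfl | rfl) | hc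
    · exact h.1 c (by simp [hc])
    · exact hd.1
    · exact hd.2
    · exact h.1 c (by simp [hc])
  · have : cutSigs c₀ = (A.sigs ++ B.sigs) ++ (A'.sigs ++ B'.sigs) := by rcases hc₀ with rfl | rfl <;> rfl
    rw [this]
    simp only [List.flatMap_cons, List.flatMap_nil, List.append_nil, cutSigs, List.append_assoc]
    refine List.Perm.append_left _ ?_
    rw [← List.append_assoc, ← List.append_assoc]
    exact List.perm_append_comm.append_right _
  · obtain ⟨hG, -, hbr⟩ := h.contract
    rcases hc₀ with rfl | rfl
    · refine GReduction.gconnected_mul (GReduction.of_cuts (T := .tensor A B) (P := .par A' B') h.names_nodup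
        (Or.inl rfl) ?_ ?_ ?_ ?_ ?_ ?_ ?_) rfl ?_ hG hbr
      case refine_1 => rintro ⟨⟩
      case refine_2 => constructor
      all_goals simp [child_tensor, child_par]
    · refine GReduction.gconnected_mul (GReduction.of_cuts (T := .tensor A' B') (P := .par A B) h.names_nodup
        (Or.inr rfl) ?_ ?_ ?_ ?_ ?_ ?_ ?_) rfl ?_ hG hbr
      case refine_1 => rintro ⟨⟩
      case refine_2 => constructor
      all_goals simp [child_tensor, child_par]
  · rw [← h.balance, balance_encode, balance_encode]
    rcases hc₀ with rfl | rfl <;> simp [Fml.balance] <;> ring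

theorem Net.IsUnet.quant {x : ℕ} {c₀ : Fml L × Fml L} (h : (Net.mk Γ (pre ++ c₀ :: post) Λ).IsUnet D)
    (hc₀ : c₀ = (.ex x A, .all x A') ∨ c₀ = (.all x A, .ex x A')) :
    (Net.mk Γ (pre ++ ([(A, A')] ++ post)) Λ).IsUnet D := by
  have hd : IsDual D A A' := by
    have := h.1 c₀ (by simp)
    rcases hc₀ with rfl | rfl <;> cases this <;> assumption
  refine isUnet_of_gconnected ?_ (h.isSigLinking.perm (sigs_perm_of_cuts ?_)) ?_ ?_
  · intro c hc
    simp only [List.mem_append, List.mem_cons, List.not_mem_nil, or_false] at hc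
    rcases hc with hc | rfl | hc
    · exact h.1 c (by simp [hc])
    · exact hd
    · exact h.1 c (by simp [hc])
  · rcases hc₀ with rfl | rfl <;> simp [cutSigs, Fml.sigs]
  · obtain ⟨hG, hpr, hbr⟩ := h.contract
    rcases hc₀ with rfl | rfl
    · refine GReduction.gconnected_quant (c₁ := (A, A')) (x := x) (A := A) (A' := A') (GReduction.of_cuts
        h.names_nodup (Or.inl rfl) ?_ ?_ ?_ ?_ ?_ ?_ ?_) rfl (Or.inl rfl) hd.freeVars_eq hG hpr hbr
      case refine_1 => rintro ⟨⟩
      case refine_2 => constructor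
      all_goals simp [child_ex, child_all, or_comm]
    · refine GReduction.gconnected_quant (c₁ := (A, A')) (x := x) (A := A') (A' := A) (GReduction.of_cuts
        h.names_nodup (Or.inr rfl) ?_ ?_ ?_ ?_ ?_ ?_ ?_) rfl (Or.inr rfl) hd.freeVars_eq.symm hG hpr hbr
      case refine_1 => rintro ⟨⟩
      case refine_2 => constructor
      all_goals simp [child_ex, child_all, or_comm]
  · rw [← h.balance, balance_encode, balance_encode]
    rcases hc₀ with rfl | rfl <;> simp [Fml.balance]

end Mul

/-! ### Nets are preserved by atomic reductions -/

section Atomic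

variable {Γ : List (Fml L)} {pre post : List (Fml L × Fml L)} {Λ : Finset (Sym2 ℕ)}
  {a i j d n : ℕ} {P : L.Relations n} {ts : Fin n → L.Term ℕ}

/-- The atomic reduction preserves linkings. -/
theorem IsSigLinking.atomic {S : List (Sig L)}
    (h : IsSigLinking D ((i, (⟨n, P⟩ : Σ n, L.Relations n)) :: (j, (⟨n, D.neg P⟩ : Σ n, L.Relations n)) :: S) Λ)
    (hai : s(a, i) ∈ Λ) (hjd : s(j, d) ∈ Λ) (hij : i ≠ j) (hai' : a ≠ i) (haj : a ≠ j) (hdi : d ≠ i)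
    (hdj : d ≠ j) : IsSigLinking D S (insert s(a, d) ((Λ.erase s(a, i)).erase s(j, d))) := by
  have hrest : ∀ l m, s(l, m) ∈ (Λ.erase s(a, i)).erase s(j, d) →
      s(l, m) ∈ Λ ∧ l ≠ a ∧ l ≠ d ∧ l ≠ i ∧ l ≠ j := by
    intro l m hl
    obtain ⟨h1, hl⟩ := Finset.mem_erase.1 hl
    obtain ⟨h2, hm⟩ := Finset.mem_erase.1 hl
    have hia : s(i, a) ∈ Λ := Sym2.eq_swap ▸ hai
    have hdj' : s(d, j) ∈ Λ := Sym2.eq_swap ▸ hjd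
    refine ⟨hm, fun h' => h2 ?_, fun h' => h1 ?_, fun h' => h2 ?_, fun h' => h1 ?_⟩ <;> subst h'
    · rw [h.eq_of_left hm hai]
    · rw [h.eq_of_left hm hdj', Sym2.eq_swap]
    · rw [h.eq_of_left hm hia, Sym2.eq_swap]
    · rw [h.eq_of_left hm hjd]
  have hmemS : ∀ l, l ≠ i → l ≠ j → ∀ o ∈ (i, (⟨n, P⟩ : Σ n, L.Relations n)) ::
      (j, (⟨n, D.neg P⟩ : Σ n, L.Relations n)) :: S, o.1 = l → o ∈ S := by
    intro l hli hlj o ho hol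
    simp only [List.mem_cons] at ho
    rcases ho with rfl | rfl | ho
    · exact absurd hol.symm hli
    · exact absurd hol.symm hlj
    · exact ho
  have hnd := h.1
  simp only [List.map_cons, List.nodup_cons] at hnd
  refine isSigLinking_of hnd.2.2 ?_ ?_ ?_
  · have key : ∃ o ∈ S, ∃ o' ∈ S, DualSig D o o' ∧ o.1 = a ∧ o'.1 = d := by
      obtain ⟨o, ho, rfl⟩ := h.exists_left hai
      obtain ⟨o', ho', rfl⟩ := h.exists_right hjd
      refine ⟨o, hmemS _ hai' haj o ho rfl, o', hmemS _ hdi hdj o' ho' rfl, ?_, rfl, rfl⟩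
      -- `a` carries the dual of the symbol at `i`, which is the symbol at `j`, and `d` carries the
      -- dual of the latter.
      obtain ⟨n₁, P₁, h1, h2⟩ := (h.dual ho (o' := (i, ⟨n, P⟩)) (by simp) hai).symm
      obtain ⟨n₂, P₂, h3, h4⟩ := (h.dual (o := (j, ⟨n, D.neg P⟩)) (by simp) ho' hjd).symm
      simp only at h1 h4
      cases h1
      refine ⟨n, D.neg P, h2, ?_⟩
      rw [h3]
      obtain ⟨rfl, h4⟩ := Sigma.mk.inj_iff.1 h4
      have h5 := congrArg D.neg (eq_of_heq h4)
      rw [D.neg_neg, D.neg_neg] at h5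
      rw [← h5, D.neg_neg]
    intro l m hl
    rcases Finset.mem_insert.1 hl with hl | hl
    · obtain ⟨o, ho, o', ho', hd, rfl, rfl⟩ := key
      rcases Sym2.eq_iff.1 hl with ⟨rfl, rfl⟩ | ⟨rfl, rfl⟩
      · exact ⟨o, ho, o', ho', hd, rfl, rfl⟩
      · exact ⟨o', ho', o, ho, hd.symm, rfl, rfl⟩
    · obtain ⟨hΛ, -, -, hli, hlj⟩ := hrest l m hl
      obtain ⟨-, -, -, hmi, hmj⟩ := hrest m l (by rwa [Sym2.eq_swap (a := m)])
      obtain ⟨o, ho, rfl⟩ := h.exists_left hΛ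
      obtain ⟨o', ho', rfl⟩ := h.exists_right hΛ
      exact ⟨o, hmemS _ hli hlj o ho rfl, o', hmemS _ hmi hmj o' ho' rfl, h.dual ho ho' hΛ, rfl, rfl⟩
  · intro o ho
    by_cases hoa : o.1 = a
    · exact ⟨d, by rw [hoa]; exact Finset.mem_insert_self _ _⟩
    by_cases hod : o.1 = d
    · exact ⟨a, by rw [hod, Sym2.eq_swap]; exact Finset.mem_insert_self _ _⟩
    have hoi : o.1 ≠ i := fun h => hnd.1 (by simp only [List.mem_cons, List.mem_map]; exact Or.inr ⟨o, ho, h⟩)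
    have hoj : o.1 ≠ j := fun h => hnd.2.1 (by simp only [List.mem_map]; exact ⟨o, ho, h⟩)
    obtain ⟨o', -, hl⟩ := h.exists_partner (o := o) (by simp [ho])
    refine ⟨o'.1, Finset.mem_insert_of_mem (Finset.mem_erase.2 ⟨?_, Finset.mem_erase.2 ⟨?_, hl⟩⟩)⟩
    · intro he
      rcases Sym2.eq_iff.1 he with ⟨h, -⟩ | ⟨h, -⟩
      · exact hoj h
      · exact hod h
    · intro he
      rcases Sym2.eq_iff.1 he with ⟨h, -⟩ | ⟨h, -⟩
      · exact hoa h
      · exact hoi h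
  · intro l m m' hl hl'
    have hone : ∀ m, s(l, m) ∈ insert s(a, d) ((Λ.erase s(a, i)).erase s(j, d)) →
        (l = a ∧ m = d) ∨ (l = d ∧ m = a) ∨ (s(l, m) ∈ Λ ∧ l ≠ a ∧ l ≠ d) := by
      intro m hl
      rcases Finset.mem_insert.1 hl with hl | hl
      · rcases Sym2.eq_iff.1 hl with h | h
        · exact Or.inl h
        · exact Or.inr (Or.inl h)
      · obtain ⟨h1, h2, h3, -⟩ := hrest l m hl
        exact Or.inr (Or.inr ⟨h1, h2, h3⟩)
    rcases hone m hl with ⟨h1, h2⟩ | ⟨h1, h2⟩ | ⟨h1, h2, h3⟩ <;>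
      rcases hone m' hl' with ⟨h4, h5⟩ | ⟨h4, h5⟩ | ⟨h4, h5, h6⟩
    · rw [h2, h5]
    · rw [h2, h5, ← h1, h4]
    · exact absurd h1 h5
    · rw [h2, h5, ← h1, h4]
    · rw [h2, h5]
    · exact absurd h1 h6
    · exact absurd h4 h2
    · exact absurd h4 h3
    · exact h.eq_of_left h1 h4

/-- The deleted leaves have weight 1 each and the tensor of their cut has weight -2, so the balance
is unchanged. -/
theorem Net.IsUnet.atomic
    (h : (Net.mk Γ (pre ++ (.atom i P ts, .atom j (D.neg P) ts) :: post) Λ).IsUnet D)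
    (hai : s(a, i) ∈ Λ) (hjd : s(j, d) ∈ Λ) (hne : s(a, i) ≠ s(j, d)) :
    (Net.mk Γ (pre ++ post) (insert s(a, d) ((Λ.erase s(a, i)).erase s(j, d)))).IsUnet D := by
  obtain ⟨hij, hai', haj, hdi, hdj, -⟩ := atomic_names_ne h.isSigLinking hai hjd hne
  refine isUnet_of_gconnected ?_ (IsSigLinking.atomic (P := P) (h.isSigLinking.perm ?_) hai hjd hij hai' haj hdi hdj)
    (gconnected_atomic h.isSigLinking hai hjd hne h.contract.1) ?_
  · exact fun c hc => h.1 c (by simp only [List.mem_append, List.mem_cons] at hc ⊢; tauto)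
  · simp only [Net.sigs, List.flatMap_append, List.flatMap_cons, cutSigs, Fml.sigs,
      List.cons_append, ← List.append_assoc]
    exact List.perm_middle.trans (List.perm_middle.cons _)
  · rw [← h.balance, balance_encode, balance_encode]
    simp [Fml.balance]

end Atomic

theorem Step.isUnet {θ θ' : Net L} (h : Step D θ θ') (hθ : θ.IsUnet D) : θ'.IsUnet D := by
  cases h with
  | atomic Γ pre post Λ a i j d P ts hai hjd hne => exact hθ.atomic hai hjd hne
  | tensorPar Γ pre post Λ A B A' B' => exact hθ.mul (Or.inl rfl)
  | parTensor Γ pre post Λ A B A' B' => exact hθ.mul (Or.inr rfl)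
  | exAll Γ pre post Λ x A A' => exact hθ.quant (Or.inl rfl)
  | allEx Γ pre post Λ x A A' => exact hθ.quant (Or.inr rfl)

theorem Reduces.isUnet {θ θ' : Net L} (h : Reduces D θ θ') (hθ : θ.IsUnet D) : θ'.IsUnet D := by
  induction h with
  | refl => exact hθ
  | tail _ h ih => exact h.isUnet ih

/-! ### Strong normalization -/

theorem Fml.size_pos (A : Fml L) : 0 < A.size := by cases A <;> simp only [Fml.size] <;> omega

theorem Step.size_lt {θ θ' : Net L} (h : Step D θ θ') : θ'.size < θ.size := by
  cases h <;> simp [Net.size, Fml.size] <;> omega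

theorem step_count_le {k : ℕ} {s : ℕ → Net L} (h : ∀ i < k, Step D (s i) (s (i + 1))) :
    k ≤ (s 0).size := by
  have key : ∀ i ≤ k, (s i).size + i ≤ (s 0).size := by
    intro i
    induction i with
    | zero => exact fun _ => le_rfl
    | succ i ih =>
      intro hi
      have := (h i hi).size_lt
      have := ih (by omega)
      omega
  have := key k le_rfl
  omega

/-! ### Absence of deadlocks -/

/-- The two leaves of an atomic cut of a unification net are not linked to each other. -/
theorem Net.IsUnet.not_linked {θ : Net L} (hθ : θ.IsUnet D) {i j n n' : ℕ} {P : L.Relations n}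
    {Q : L.Relations n'} {ts : Fin n → L.Term ℕ} {us : Fin n' → L.Term ℕ}
    (hc : (.atom i P ts, .atom j Q us) ∈ θ.cuts) : s(i, j) ∉ θ.links := by
  intro hl
  obtain ⟨a₀, ht⟩ := exists_subAt_encode.2 (Or.inr ⟨_, hc, isHub_tensor _⟩)
  obtain ⟨t, -, ht⟩ := exists_vertex ht
  obtain ⟨a, ha, hat⟩ := exists_child_vertex (ht ▸ child_tensor.2 (Or.inl rfl))
  obtain ⟨b, hb, hbt⟩ := exists_child_vertex (ht ▸ child_tensor.2 (Or.inr rfl))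
  obtain ⟨w, hw⟩ := exists_isSwitching θ.encode θ.links
  have hkeep : ∀ x : Vertex θ.encode, Arc θ.encode θ.links x t →
      (switchGraph θ.encode θ.links w).Adj x t := fun x hx =>
    (SimpleGraph.fromRel_adj _ _ _).2 ⟨hx.ne, Or.inl (Or.inr ⟨hx, fun h => by
      simp [isSwitched_iff, ht] at h⟩)⟩
  have hab : Linked θ.encode θ.links a b := linked_iff.2 ⟨_, _, _, _, _, _, _, _, ha, hb, hl⟩
  have h1 := hkeep a (Or.inl hat)
  have h2 := hkeep b (Or.inl hbt)
  have h3 : (switchGraph θ.encode θ.links w).Adj a b :=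
    (SimpleGraph.fromRel_adj _ _ _).2 ⟨hab.ne hθ.2.1, Or.inl (Or.inl hab)⟩
  have hac := (hθ.2.2.2 w hw).1.2
  -- The two leaves and the tensor that encodes their cut form a triangle in the switching.
  refine hac (v := a) (.cons h3 (.cons h2 (.cons h1.symm .nil))) ?_
  simp [SimpleGraph.Walk.isCycle_def, SimpleGraph.Walk.isTrail_def, h1.ne, h2.ne, h3.ne, h1.ne.symm,
    h3.ne.symm]

/-! ### Confluence -/

variable {D : Duality L}

/-- A logical reduction replaces the cut `c` by the cuts `cs`. -/
inductive LogicalRed : Fml L × Fml L → List (Fml L × Fml L) → Prop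
  | tensorPar (A B A' B' : Fml L) : LogicalRed (.tensor A B, .par A' B') [(A, A'), (B, B')]
  | parTensor (A B A' B' : Fml L) : LogicalRed (.par A B, .tensor A' B') [(A, A'), (B, B')]
  | exAll (x : ℕ) (A A' : Fml L) : LogicalRed (.ex x A, .all x A') [(A, A')]
  | allEx (x : ℕ) (A A' : Fml L) : LogicalRed (.all x A, .ex x A') [(A, A')]

/-- The reduction of a cut between leaves with names `i` and `j`. -/
inductive AtomicRed (D : Duality L) (i j : ℕ) :
    Finset (Sym2 ℕ) → Fml L × Fml L → Finset (Sym2 ℕ) → Prop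
  | mk (Λ : Finset (Sym2 ℕ)) (a d : ℕ) {n : ℕ} (P : L.Relations n) (ts : Fin n → L.Term ℕ) :
      s(a, i) ∈ Λ → s(j, d) ∈ Λ → s(a, i) ≠ s(j, d) →
      AtomicRed D i j Λ (.atom i P ts, .atom j (D.neg P) ts)
        (insert s(a, d) ((Λ.erase s(a, i)).erase s(j, d)))

/-- A reduction replaces the cut `c` by the cuts `cs` and the links `Λ` by the links `Λ'`. -/
inductive CutRed (D : Duality L) : Finset (Sym2 ℕ) → Fml L × Fml L → List (Fml L × Fml L) →
    Finset (Sym2 ℕ) → Prop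
  | atomic {i j : ℕ} {Λ Λ' : Finset (Sym2 ℕ)} {c : Fml L × Fml L} : AtomicRed D i j Λ c Λ' → CutRed D Λ c [] Λ'
  | logical {Λ : Finset (Sym2 ℕ)} {c : Fml L × Fml L} {cs : List (Fml L × Fml L)} :
      LogicalRed c cs → CutRed D Λ c cs Λ

theorem step_iff {θ θ' : Net L} : Step D θ θ' ↔ ∃ Γ pre c post cs Λ Λ',
    CutRed D Λ c cs Λ' ∧ θ = ⟨Γ, pre ++ c :: post, Λ⟩ ∧ θ' = ⟨Γ, pre ++ (cs ++ post), Λ'⟩ := by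
  constructor
  · intro h
    cases h with
    | atomic Γ pre post Λ a i j d P ts hai hjd hne =>
      exact ⟨Γ, pre, _, post, [], Λ, _, .atomic (.mk Λ a d P ts hai hjd hne), rfl, rfl⟩
    | tensorPar Γ pre post Λ A B A' B' => exact ⟨Γ, pre, _, post, _, Λ, Λ, .logical (.tensorPar A B A' B'), rfl, rfl⟩
    | parTensor Γ pre post Λ A B A' B' => exact ⟨Γ, pre, _, post, _, Λ, Λ, .logical (.parTensor A B A' B'), rfl, rfl⟩
    | exAll Γ pre post Λ x A A' => exact ⟨Γ, pre, _, post, _, Λ, Λ, .logical (.exAll x A A'), rfl, rfl⟩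
    | allEx Γ pre post Λ x A A' => exact ⟨Γ, pre, _, post, _, Λ, Λ, .logical (.allEx x A A'), rfl, rfl⟩
  · rintro ⟨Γ, pre, c, post, cs, Λ, Λ', h, rfl, rfl⟩
    cases h with
    | atomic h => obtain ⟨a, d, P, ts, hai, hjd, hne⟩ := h; exact .atomic Γ pre post Λ a _ _ d P ts hai hjd hne
    | logical h =>
      cases h with
      | tensorPar A B A' B' => exact .tensorPar Γ pre post Λ A B A' B'
      | parTensor A B A' B' => exact .parTensor Γ pre post Λ A B A' B'
      | exAll x A A' => exact .exAll Γ pre post Λ x A A'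
      | allEx x A A' => exact .allEx Γ pre post Λ x A A'

theorem LogicalRed.unique {c : Fml L × Fml L} {cs cs' : List (Fml L × Fml L)} (h : LogicalRed c cs)
    (h' : LogicalRed c cs') : cs = cs' := by
  cases h <;> cases h' <;> rfl

theorem AtomicRed.unique {S : List (Sig L)} {i j i' j' : ℕ} {Λ Λ₁ Λ₂ : Finset (Sym2 ℕ)} {c : Fml L × Fml L}
    (hS : IsSigLinking D S Λ) (h : AtomicRed D i j Λ c Λ₁) (h' : AtomicRed D i' j' Λ c Λ₂) : Λ₁ = Λ₂ := by
  obtain ⟨a, d, P, ts, hai, hjd, -⟩ := h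
  obtain ⟨a', d', P', ts', hai', hjd', -⟩ := h'
  rw [hS.eq_of_right hai hai', hS.eq_of_left hjd hjd']

theorem CutRed.unique {S : List (Sig L)} {Λ Λ₁ Λ₂ : Finset (Sym2 ℕ)} {c : Fml L × Fml L}
    {cs₁ cs₂ : List (Fml L × Fml L)} (hS : IsSigLinking D S Λ) (h : CutRed D Λ c cs₁ Λ₁)
    (h' : CutRed D Λ c cs₂ Λ₂) : cs₁ = cs₂ ∧ Λ₁ = Λ₂ := by
  cases h with
  | atomic h =>
    cases h' with
    | atomic h' => exact ⟨rfl, h.unique hS h'⟩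
    | logical h' => obtain ⟨⟩ := h; cases h'
  | logical h =>
    cases h' with
    | atomic h' => obtain ⟨⟩ := h'; cases h
    | logical h' => exact ⟨h.unique h', rfl⟩

/-- The links of an atomic reduction. -/
theorem AtomicRed.mem_iff {S : List (Sig L)} {i j : ℕ} {Λ Λ' : Finset (Sym2 ℕ)} {c : Fml L × Fml L}
    (hS : IsSigLinking D S Λ) (hij : i ≠ j) (h : AtomicRed D i j Λ c Λ') (l m : ℕ) :
    s(l, m) ∈ Λ' ↔ l ≠ i ∧ l ≠ j ∧ m ≠ i ∧ m ≠ j ∧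
      (s(l, m) ∈ Λ ∨ (s(l, i) ∈ Λ ∧ s(j, m) ∈ Λ) ∨ (s(l, j) ∈ Λ ∧ s(i, m) ∈ Λ)) := by
  obtain ⟨a, d, P, ts, hai, hjd, hne⟩ := h
  have hfun : ∀ {l m m'}, s(l, m) ∈ Λ → s(l, m') ∈ Λ → m = m' := hS.eq_of_left
  have hsymm : ∀ {l m}, s(l, m) ∈ Λ → s(m, l) ∈ Λ := fun h => Sym2.eq_swap ▸ h
  have hlm : ∀ {l m}, s(l, m) ∈ Λ → l ≠ m := hS.ne
  have haj : a ≠ j := by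
    rintro rfl
    exact hne (by rw [hfun hai hjd])
  have hdi : d ≠ i := by
    rintro rfl
    exact haj (hfun (hsymm hai) (hsymm hjd))
  rw [Finset.mem_insert, Finset.mem_erase, Finset.mem_erase]
  simp only [ne_eq, Sym2.eq_iff]
  have h1 := hsymm hai
  have h2 := hsymm hjd
  have h3 := hlm hai
  have h4 := hlm hjd
  constructor
  · rintro ((⟨rfl, rfl⟩ | ⟨rfl, rfl⟩) | ⟨hn1, hn2, hl⟩)
    · exact ⟨h3, haj, hdi, h4.symm, Or.inr (Or.inl ⟨hai, hjd⟩)⟩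
    · exact ⟨hdi, h4.symm, h3, haj, Or.inr (Or.inr ⟨h2, h1⟩)⟩
    · refine ⟨?_, ?_, ?_, ?_, Or.inl hl⟩ <;> rintro rfl
      · exact hn2 (Or.inr ⟨rfl, hfun hl h1⟩)
      · exact hn1 (Or.inl ⟨rfl, hfun hl hjd⟩)
      · exact hn2 (Or.inl ⟨hfun (hsymm hl) h1, rfl⟩)
      · exact hn1 (Or.inr ⟨hfun (hsymm hl) hjd, rfl⟩)
  · rintro ⟨hli, hlj, hmi, hmj, hl | ⟨hl, hm⟩ | ⟨hl, hm⟩⟩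
    · exact Or.inr ⟨by tauto, by tauto, hl⟩
    · exact Or.inl (Or.inl ⟨hfun (hsymm hl) h1, hfun hm hjd⟩)
    · exact Or.inl (Or.inr ⟨hfun (hsymm hl) hjd, hfun hm h1⟩)

/-- Contracting two pairs of points of a matching commutes. -/
theorem contract_comm {M : ℕ → ℕ → Prop} (hs : ∀ {l m}, M l m → M m l)
    (hf : ∀ {l m m'}, M l m → M l m' → m = m') {i j i' j' l m : ℕ}
    {N N' : ℕ → ℕ → Prop}
    (hN : ∀ l m, N l m ↔ l ≠ i ∧ l ≠ j ∧ m ≠ i ∧ m ≠ j ∧ (M l m ∨ (M l i ∧ M j m) ∨ (M l j ∧ M i m)))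
    (hN' : ∀ l m, N' l m ↔ l ≠ i' ∧ l ≠ j' ∧ m ≠ i' ∧ m ≠ j' ∧ (M l m ∨ (M l i' ∧ M j' m) ∨ (M l j' ∧ M i' m)))
    (h1 : i ≠ i') (h2 : i ≠ j') (h3 : j ≠ i') (h4 : j ≠ j') (h5 : i ≠ j) (h6 : i' ≠ j')
    (h : l ≠ i' ∧ l ≠ j' ∧ m ≠ i' ∧ m ≠ j' ∧ (N l m ∨ (N l i' ∧ N j' m) ∨ (N l j' ∧ N i' m))) :
    l ≠ i ∧ l ≠ j ∧ m ≠ i ∧ m ≠ j ∧ (N' l m ∨ (N' l i ∧ N' j m) ∨ (N' l j ∧ N' i m)) := by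
  -- In either order, surviving points are joined if and only if links and removed pairs form an
  -- alternating path between them. Such a path has at most three links, which leaves finitely many
  -- cases.
  grind

theorem AtomicRed.comm {S : List (Sig L)} {i j i' j' : ℕ} {Λ Λ₁ Λ₂ Λ₃ Λ₄ : Finset (Sym2 ℕ)}
    {c c' : Fml L × Fml L} {S₁ S₂ : List (Sig L)}
    (hS : IsSigLinking D S Λ) (hS₁ : IsSigLinking D S₁ Λ₁) (hS₂ : IsSigLinking D S₂ Λ₂)
    (hij : i ≠ j) (hij' : i' ≠ j') (h1 : i ≠ i') (h2 : i ≠ j') (h3 : j ≠ i') (h4 : j ≠ j')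
    (h : AtomicRed D i j Λ c Λ₁) (h' : AtomicRed D i' j' Λ c' Λ₂)
    (hc' : AtomicRed D i' j' Λ₁ c' Λ₃) (hc : AtomicRed D i j Λ₂ c Λ₄) : Λ₃ = Λ₄ := by
  have hs : ∀ {l m}, s(l, m) ∈ Λ → s(m, l) ∈ Λ := fun h => Sym2.eq_swap ▸ h
  ext e
  induction e with | h l m => ?_
  rw [hc'.mem_iff hS₁ hij', hc.mem_iff hS₂ hij]
  exact ⟨contract_comm (M := fun l m => s(l, m) ∈ Λ) hs hS.eq_of_left (h.mem_iff hS hij) (h'.mem_iff hS hij')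
      h1 h2 h3 h4 hij hij',
    contract_comm (M := fun l m => s(l, m) ∈ Λ) hs hS.eq_of_left (h'.mem_iff hS hij') (h.mem_iff hS hij)
      h1.symm h3.symm h2.symm h4.symm hij' hij⟩

theorem atomic_cut_ne {θ : Net L} (hθ : θ.names.Nodup) {i j n n' : ℕ} {P : L.Relations n} {Q : L.Relations n'}
    {ts : Fin n → L.Term ℕ} {us : Fin n' → L.Term ℕ} (hc : (.atom i P ts, .atom j Q us) ∈ θ.cuts) : i ≠ j :=
  fun h => cut_sides_disjoint hθ hc (l := i) (List.mem_singleton.2 rfl) (List.mem_singleton.2 h)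

/-- A cut of a unification net between leaves can be reduced. -/
theorem Net.IsUnet.exists_atomicRed {θ : Net L} (hθ : θ.IsUnet D) {i j n : ℕ} {P : L.Relations n}
    {ts : Fin n → L.Term ℕ} (hc : (.atom i P ts, .atom j (D.neg P) ts) ∈ θ.cuts) :
    ∃ Λ', AtomicRed D i j θ.links (.atom i P ts, .atom j (D.neg P) ts) Λ' := by
  have hi : (i, (⟨n, P⟩ : Σ n, L.Relations n)) ∈ θ.sigs :=
    mem_net_sigs.2 ⟨_, Or.inr ⟨_, hc, Or.inl rfl⟩, List.mem_singleton.2 rfl⟩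
  have hj : (j, (⟨n, D.neg P⟩ : Σ n, L.Relations n)) ∈ θ.sigs :=
    mem_net_sigs.2 ⟨_, Or.inr ⟨_, hc, Or.inr rfl⟩, List.mem_singleton.2 rfl⟩
  obtain ⟨a, -, ha⟩ := hθ.isSigLinking.exists_partner hi
  obtain ⟨d, -, hd⟩ := hθ.isSigLinking.exists_partner hj
  refine ⟨_, .mk _ a.1 d.1 P ts (Sym2.eq_swap ▸ ha) hd fun h => ?_⟩
  rcases Sym2.eq_iff.1 h with ⟨h1, -⟩ | ⟨-, h1⟩
  · exact hθ.not_linked hc (h1 ▸ ha)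
  · exact atomic_cut_ne hθ.names_nodup hc h1

/-- A logical reduction ignores the links. After one of two atomic reductions the other cut can
still be reduced, since the reduct is again a net; the resulting links agree by `AtomicRed.comm`. -/
theorem CutRed.comm {Γ : List (Fml L)} {pre mid post cs cs' : List (Fml L × Fml L)} {c c' : Fml L × Fml L}
    {Λ Λ₁ Λ₂ : Finset (Sym2 ℕ)} (hθ : (Net.mk Γ (pre ++ c :: (mid ++ c' :: post)) Λ).IsUnet D)
    (h : CutRed D Λ c cs Λ₁) (h' : CutRed D Λ c' cs' Λ₂) :
    ∃ Λ₃, CutRed D Λ₁ c' cs' Λ₃ ∧ CutRed D Λ₂ c cs Λ₃ := by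
  have h₁ : (Net.mk Γ (pre ++ (cs ++ (mid ++ c' :: post))) Λ₁).IsUnet D :=
    (step_iff.2 ⟨Γ, pre, c, mid ++ c' :: post, cs, Λ, Λ₁, h, rfl, rfl⟩).isUnet hθ
  have h₂ : (Net.mk Γ ((pre ++ c :: mid) ++ (cs' ++ post)) Λ₂).IsUnet D :=
    (step_iff.2 ⟨Γ, pre ++ c :: mid, c', post, cs', Λ, Λ₂, h', by simp, rfl⟩).isUnet hθ
  cases h with
  | logical h => exact ⟨Λ₂, h', .logical h⟩
  | @atomic i j _ _ _ h =>
    cases h' with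
    | logical h' => exact ⟨Λ₁, .logical h', .atomic h⟩
    | @atomic i' j' _ _ _ h' =>
      have hne : ∀ l, l ∈ cutNames c' → l ∉ cutNames c := fun l hl hl' =>
        rest_disjoint hθ.names_nodup (c := c') (by simp) hl hl'
      have hs := hθ.isSigLinking
      have hs₁ := h₁.isSigLinking
      have hs₂ := h₂.isSigLinking
      have hij : i ≠ j := by
        obtain ⟨a, d, P, ts⟩ := h
        exact atomic_cut_ne hθ.names_nodup (P := P) (Q := D.neg P) (ts := ts) (us := ts) (by simp)
      have hij' : i' ≠ j' := by
        obtain ⟨a, d, P, ts⟩ := h'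
        exact atomic_cut_ne hθ.names_nodup (P := P) (Q := D.neg P) (ts := ts) (us := ts) (by simp)
      obtain ⟨Λ₃, h₃⟩ : ∃ Λ₃, AtomicRed D i' j' Λ₁ c' Λ₃ := by
        obtain ⟨a, d, P, ts⟩ := h'
        exact h₁.exists_atomicRed (by simp)
      obtain ⟨Λ₄, h₄⟩ : ∃ Λ₄, AtomicRed D i j Λ₂ c Λ₄ := by
        obtain ⟨a, d, P, ts⟩ := h
        exact h₂.exists_atomicRed (by simp)
      have hmem : i ∈ cutNames c ∧ j ∈ cutNames c := by
        obtain ⟨a, d, P, ts⟩ := h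
        simp [cutNames]
      have hmem' : i' ∈ cutNames c' ∧ j' ∈ cutNames c' := by
        obtain ⟨a, d, P, ts⟩ := h'
        simp [cutNames]
      have := h.comm hs hs₁ hs₂ hij hij' (fun e => hne _ hmem'.1 (e ▸ hmem.1))
        (fun e => hne _ hmem'.2 (e ▸ hmem.1)) (fun e => hne _ hmem'.1 (e ▸ hmem.2))
        (fun e => hne _ hmem'.2 (e ▸ hmem.2)) h' h₃ h₄
      subst this
      exact ⟨Λ₃, .atomic h₃, .atomic h₄⟩

/-- Reductions of the same cut agree, because each leaf has a unique partner. Reductions at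
different positions of the list of cuts commute in one step each. -/
theorem Step.diamond {θ θ₁ θ₂ : Net L} (hθ : θ.IsUnet D) (h₁ : Step D θ θ₁) (h₂ : Step D θ θ₂) :
    θ₁ = θ₂ ∨ ∃ θ₃, Step D θ₁ θ₃ ∧ Step D θ₂ θ₃ := by
  obtain ⟨Γ, pre, c, post, cs, Λ, Λ₁, hr, rfl, rfl⟩ := step_iff.1 h₁
  obtain ⟨Γ', pre', c', post', cs', Λ', Λ₂, hr', he, rfl⟩ := step_iff.1 h₂
  injection he with he1 he2 he3
  subst he1
  subst he3
  have key : ∀ {pre mid post cs cs' : List (Fml L × Fml L)} {c c' : Fml L × Fml L} {Λ₁ Λ₂ : Finset (Sym2 ℕ)},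
      (Net.mk Γ (pre ++ c :: (mid ++ c' :: post)) Λ).IsUnet D → CutRed D Λ c cs Λ₁ → CutRed D Λ c' cs' Λ₂ →
      ∃ θ₃, Step D ⟨Γ, pre ++ (cs ++ (mid ++ c' :: post)), Λ₁⟩ θ₃ ∧
        Step D ⟨Γ, (pre ++ c :: mid) ++ (cs' ++ post), Λ₂⟩ θ₃ := by
    intro pre mid post cs cs' c c' Λ₁ Λ₂ hθ h h'
    obtain ⟨Λ₃, h₃, h₄⟩ := h.comm hθ h'
    refine ⟨⟨Γ, pre ++ (cs ++ (mid ++ (cs' ++ post))), Λ₃⟩, step_iff.2 ?_, step_iff.2 ?_⟩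
    · exact ⟨Γ, pre ++ (cs ++ mid), c', post, cs', Λ₁, Λ₃, h₃, by simp, by simp⟩
    · exact ⟨Γ, pre, c, mid ++ (cs' ++ post), cs, Λ₂, Λ₃, h₄, by simp, by simp⟩
  rcases List.append_eq_append_iff.1 he2 with ⟨mid, h1, h2⟩ | ⟨mid, h1, h2⟩
  · cases mid with
    | nil =>
      simp only [List.nil_append, List.cons.injEq, List.append_nil] at h1 h2
      obtain ⟨rfl, rfl⟩ := h2
      obtain ⟨rfl, rfl⟩ := hr.unique hθ.isSigLinking hr'
      exact Or.inl (by rw [h1])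
    | cons x mid =>
      simp only [List.cons_append, List.cons.injEq] at h2
      obtain ⟨rfl, rfl⟩ := h2
      subst h1
      exact Or.inr (key hθ hr hr')
  · cases mid with
    | nil =>
      simp only [List.nil_append, List.cons.injEq, List.append_nil] at h1 h2
      obtain ⟨rfl, rfl⟩ := h2
      obtain ⟨rfl, rfl⟩ := hr.unique hθ.isSigLinking hr'
      exact Or.inl (by rw [h1])
    | cons x mid =>
      simp only [List.cons_append, List.cons.injEq] at h2
      obtain ⟨rfl, rfl⟩ := h2
      subst h1
      obtain ⟨θ₃, h₃, h₄⟩ := key (pre := pre') (mid := mid) (post := post) (c := c') (c' := c)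
        (by simpa using hθ) hr' hr
      exact Or.inr ⟨θ₃, h₄, h₃⟩

/-- Cut reduction is confluent on unification nets. -/
theorem Net.IsUnet.confluent {θ θ₁ θ₂ : Net L} (hθ : θ.IsUnet D) (h₁ : Reduces D θ θ₁)
    (h₂ : Reduces D θ θ₂) : ∃ θ₃, Reduces D θ₁ θ₃ ∧ Reduces D θ₂ θ₃ := by
  -- The diamond is available on unification nets only, so `Relation.church_rosser` is applied to
  -- the steps that start from nets.
  let r : Net L → Net L → Prop := fun a b => Step D a b ∧ a.IsUnet D
  have hr : ∀ {θ'}, Reduces D θ θ' → Relation.ReflTransGen r θ θ' := by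
    intro θ' h
    induction h with
    | refl => exact .refl
    | tail h h' ih => exact ih.tail ⟨h', Reduces.isUnet h hθ⟩
  have hdia : ∀ a b c, r a b → r a c → ∃ d, Relation.ReflGen r b d ∧ Relation.ReflTransGen r c d := by
    rintro a b c ⟨hb, ha⟩ ⟨hc, -⟩
    rcases hb.diamond ha hc with rfl | ⟨d, hbd, hcd⟩
    · exact ⟨b, .refl, .refl⟩
    · exact ⟨d, .single ⟨hbd, hb.isUnet ha⟩, .single ⟨hcd, hc.isUnet ha⟩⟩
  have hle : r ≤ Step D := fun _ _ h => h.1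
  obtain ⟨θ₃, h₃, h₄⟩ := Relation.church_rosser hdia (hr h₁) (hr h₂)
  exact ⟨θ₃, Relation.ReflTransGen.mono hle _ _ h₃, Relation.ReflTransGen.mono hle _ _ h₄⟩

/-- A unification net with cuts can be reduced. -/
theorem Net.IsUnet.exists_step {θ : Net L} (hθ : θ.IsUnet D) (h : ¬ θ.CutFree) : ∃ θ', Step D θ θ' := by
  obtain ⟨Γ, cuts, Λ⟩ := θ
  cases cuts with
  | nil => exact absurd rfl h
  | cons c post =>
    have key : ∃ cs Λ', CutRed D Λ c cs Λ' := by
      have hd := hθ.1 c (by simp)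
      obtain ⟨A, A'⟩ := c
      cases hd with
      | atom i j P ts =>
        obtain ⟨Λ', h⟩ := hθ.exists_atomicRed (i := i) (j := j) (P := P) (ts := ts) (by simp)
        exact ⟨[], Λ', .atomic h⟩
      | tensor _ _ => exact ⟨_, Λ, .logical (.tensorPar _ _ _ _)⟩
      | par _ _ => exact ⟨_, Λ, .logical (.parTensor _ _ _ _)⟩
      | all x _ => exact ⟨_, Λ, .logical (.allEx _ _ _)⟩
      | ex x _ => exact ⟨_, Λ, .logical (.exAll _ _ _)⟩
    obtain ⟨cs, Λ', h⟩ := key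
    exact ⟨_, step_iff.2 ⟨Γ, [], c, post, cs, Λ, Λ', h, rfl, rfl⟩⟩

theorem Net.IsUnet.exists_cutFree {θ : Net L} (hθ : θ.IsUnet D) : ∃ θ', Reduces D θ θ' ∧ θ'.CutFree := by
  induction hn : θ.size using Nat.strong_induction_on generalizing θ with
  | _ n ih =>
    by_cases h : θ.CutFree
    · exact ⟨θ, .refl, h⟩
    · obtain ⟨θ₁, h₁⟩ := hθ.exists_step h
      obtain ⟨θ', h', hc⟩ := ih _ (hn ▸ h₁.size_lt) (h₁.isUnet hθ) rfl
      exact ⟨θ', .head h₁ h', hc⟩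

theorem Net.CutFree.eq_of_reduces {θ θ' : Net L} (h : θ.CutFree) (hr : Reduces D θ θ') : θ = θ' := by
  induction hr with
  | refl => rfl
  | tail _ hs ih =>
    subst ih
    obtain ⟨Γ, pre, c, post, cs, Λ, Λ', -, rfl, -⟩ := step_iff.1 hs
    simp [Net.CutFree] at h

/-- Cut-free nets do not reduce, so confluence forces them to coincide. This is what identifies the
result of the machine. -/
theorem Net.IsUnet.cutFree_unique {θ θ₁ θ₂ : Net L} (hθ : θ.IsUnet D) (h₁ : Reduces D θ θ₁)
    (h₂ : Reduces D θ θ₂) (hc₁ : θ₁.CutFree) (hc₂ : θ₂.CutFree) : θ₁ = θ₂ := by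
  obtain ⟨θ₃, h₃, h₄⟩ := hθ.confluent h₁ h₂
  rw [hc₁.eq_of_reduces h₃, hc₂.eq_of_reduces h₄]

/-! ### Records -/

theorem mem_termRecords {ν : Numbering L} {t : L.Term ℕ} {r : Record} (h : r ∈ termRecords ν t) :
    (r.1 = 6 ∨ r.1 = 7) ∧ r.2.2.2 = none := by
  induction t with
  | var x =>
    rw [termRecords, List.mem_singleton] at h
    subst h
    simp
  | func f ts ih =>
    rw [termRecords, List.mem_cons] at h
    rcases h with rfl | h
    · simp
    · obtain ⟨l, hl, h⟩ := List.mem_flatten.1 h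
      obtain ⟨k, rfl⟩ := List.mem_ofFn.1 hl
      exact ih k h

theorem length_termRecords (ν : Numbering L) (t : L.Term ℕ) : (termRecords ν t).length = termSize t := by
  induction t with
  | var x => rfl
  | func f ts ih =>
    rw [termRecords, termSize, List.length_cons, List.length_flatten, List.map_ofFn, List.sum_ofFn, add_comm]
    simp [Function.comp, ih]

/-- The records of the terms of a leaf. -/
theorem mem_argRecords {ν : Numbering L} {n : ℕ} {ts : Fin n → L.Term ℕ} {r : Record}
    (h : r ∈ (List.ofFn fun k => termRecords ν (ts k)).flatten) : (r.1 = 6 ∨ r.1 = 7) ∧ r.2.2.2 = none := by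
  obtain ⟨l, hl, h⟩ := List.mem_flatten.1 h
  obtain ⟨k, rfl⟩ := List.mem_ofFn.1 hl
  exact mem_termRecords h

/-- The marks 0, 9 and 10 do not occur inside formulas, so they reliably delimit the word and its
cuts. -/
theorem mem_records {ν : Numbering L} {A : Fml L} {r : Record} (h : r ∈ A.records ν) :
    r.1 ≠ 0 ∧ r.1 < 9 := by
  induction A with
  | atom l P ts =>
    rw [Fml.records, List.mem_cons] at h
    rcases h with rfl | h
    · simp
    · rcases (mem_argRecords h).1 with h | h <;> simp [h]
  | tensor A B ihA ihB =>
    rw [Fml.records, List.mem_cons, List.mem_append] at h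
    rcases h with rfl | h | h
    · simp
    · exact ihA h
    · exact ihB h
  | par A B ihA ihB =>
    rw [Fml.records, List.mem_cons, List.mem_append] at h
    rcases h with rfl | h | h
    · simp
    · exact ihA h
    · exact ihB h
  | all x A ih =>
    rw [Fml.records, List.mem_cons] at h
    rcases h with rfl | h
    · simp
    · exact ih h
  | ex x A ih =>
    rw [Fml.records, List.mem_cons] at h
    rcases h with rfl | h
    · simp
    · exact ih h

theorem length_records (ν : Numbering L) (A : Fml L) : (A.records ν).length = A.size := by
  induction A with
  | atom l P ts =>
    rw [Fml.records, Fml.size, List.length_cons, List.length_flatten, List.map_ofFn, List.sum_ofFn, add_comm]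
    simp [Function.comp, length_termRecords]
  | tensor A B ihA ihB => simp [Fml.records, Fml.size, ihA, ihB]; omega
  | par A B ihA ihB => simp [Fml.records, Fml.size, ihA, ihB]; omega
  | all x A ih => simp [Fml.records, Fml.size, ih]; omega
  | ex x A ih => simp [Fml.records, Fml.size, ih]; omega

theorem IsDual.size_eq {D : Duality L} {A A' : Fml L} (h : IsDual D A A') : A.size = A'.size := by
  induction h with
  | atom i j P ts => rfl
  | tensor _ _ ih ih' => rw [Fml.size, Fml.size, ih, ih']
  | par _ _ ih ih' => rw [Fml.size, Fml.size, ih, ih']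
  | all x _ ih => rw [Fml.size, Fml.size, ih]
  | ex x _ ih => rw [Fml.size, Fml.size, ih]

/-- The names of the leaves that a list of records describes. -/
def recNames (R : List Record) : List ℕ := R.filterMap fun r => r.2.2.2

theorem recNames_append (R S : List Record) : recNames (R ++ S) = recNames R ++ recNames S :=
  List.filterMap_append

theorem recNames_records (ν : Numbering L) (A : Fml L) : recNames (A.records ν) = A.names := by
  induction A with
  | atom l P ts =>
    have : recNames (List.ofFn fun k => termRecords ν (ts k)).flatten = [] :=
      List.filterMap_eq_nil_iff.2 fun r hr => (mem_argRecords hr).2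
    rw [Fml.records]
    change l :: recNames (List.ofFn fun k => termRecords ν (ts k)).flatten = [l]
    rw [this]
  | tensor A B ihA ihB =>
    rw [Fml.records, recNames, List.filterMap_cons_none rfl, ← recNames, recNames_append, ihA, ihB, names_tensor]
  | par A B ihA ihB =>
    rw [Fml.records, recNames, List.filterMap_cons_none rfl, ← recNames, recNames_append, ihA, ihB, names_par]
  | all x A ih => rw [Fml.records, recNames, List.filterMap_cons_none rfl, ← recNames, ih, names_all]
  | ex x A ih => rw [Fml.records, recNames, List.filterMap_cons_none rfl, ← recNames, ih, names_ex]

/-- The records of the conclusions of a net. -/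
def conclRecords (ν : Numbering L) (Γ : List (Fml L)) : List Record :=
  Γ.flatMap fun A => (8, 0, 0, none) :: A.records ν

/-- The records of the cuts of a net. -/
def cutRecords (ν : Numbering L) (cs : List (Fml L × Fml L)) : List Record :=
  cs.flatMap fun c => (9, 0, 0, none) :: c.1.records ν ++ (10, 0, 0, none) :: c.2.records ν

theorem records_eq (ν : Numbering L) (θ : Net L) :
    θ.records ν = conclRecords ν θ.concl ++ cutRecords ν θ.cuts ++ [(0, 0, 0, none)] := rfl

theorem recNames_cons_none {r : Record} (h : r.2.2.2 = none) (R : List Record) :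
    recNames (r :: R) = recNames R := List.filterMap_cons_none h

theorem recNames_conclRecords (ν : Numbering L) (Γ : List (Fml L)) :
    recNames (conclRecords ν Γ) = Γ.flatMap Fml.names := by
  induction Γ with
  | nil => rfl
  | cons A Γ ih =>
    rw [conclRecords, List.flatMap_cons, ← conclRecords, recNames_append, ih, recNames_cons_none rfl,
      recNames_records, List.flatMap_cons]

theorem recNames_cutRecords (ν : Numbering L) (cs : List (Fml L × Fml L)) :
    recNames (cutRecords ν cs) = cs.flatMap cutNames := by
  induction cs with
  | nil => rfl
  | cons c cs ih =>
    rw [cutRecords, List.flatMap_cons, ← cutRecords, recNames_append, ih, recNames_append,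
      recNames_cons_none rfl, recNames_cons_none rfl, recNames_records, recNames_records, List.flatMap_cons]
    rfl

theorem recNames_net (ν : Numbering L) (θ : Net L) : recNames (θ.records ν) = θ.names := by
  rw [records_eq, recNames_append, recNames_append, recNames_conclRecords, recNames_cutRecords, Net.names]
  exact List.append_nil _

/-- Each formula adds one mark to its at least one symbol, which at most doubles the size; the end
mark adds one. -/
theorem length_net_records (ν : Numbering L) (θ : Net L) : (θ.records ν).length ≤ 2 * θ.size + 1 := by
  have h1 : ∀ Γ : List (Fml L), (conclRecords ν Γ).length ≤ 2 * (Γ.map Fml.size).sum := by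
    intro Γ
    induction Γ with
    | nil => simp [conclRecords]
    | cons A Γ ih =>
      have := A.size_pos
      simp only [conclRecords, List.flatMap_cons, List.length_append, List.length_cons, length_records,
        List.map_cons, List.sum_cons] at ih ⊢
      omega
  have h2 : ∀ cs : List (Fml L × Fml L),
      (cutRecords ν cs).length ≤ 2 * (cs.map fun c => c.1.size + c.2.size).sum := by
    intro cs
    induction cs with
    | nil => simp [cutRecords]
    | cons c cs ih =>
      have := c.1.size_pos
      have := c.2.size_pos
      simp only [cutRecords, List.flatMap_cons, List.length_append, List.length_cons, length_records,
        List.map_cons, List.sum_cons] at ih ⊢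
      omega
  have := h1 θ.concl
  have := h2 θ.cuts
  rw [records_eq, List.length_append, List.length_append, Net.size, List.length_singleton]
  omega

/-! ### Positions -/

/-- The position of the record of the leaf with name `l`, counted in records. -/
def recIdx (R : List Record) (l : ℕ) : ℕ := R.findIdx fun r => decide (r.2.2.2 = some l)

/-- With distinct names, the first record found for a leaf is the only one. -/
theorem recIdx_eq {R : List Record} (hR : (recNames R).Nodup) {k : ℕ} {r : Record} {l : ℕ}
    (hk : R[k]? = some r) (hr : r.2.2.2 = some l) : recIdx R l = k := by
  obtain ⟨hlt, rfl⟩ := List.getElem?_eq_some_iff.1 hk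
  rw [recIdx, List.findIdx_eq hlt]
  refine ⟨by simp [hr], fun j hj => ?_⟩
  rw [decide_eq_false_iff_not]
  intro h
  have hdec : R = R.take (j + 1) ++ R.drop (j + 1) := (List.take_append_drop _ _).symm
  rw [hdec, recNames_append, List.nodup_append'] at hR
  have hdis := hR.2.2
  refine @hdis l (List.mem_filterMap.2 ⟨R[j], ?_, h⟩) (List.mem_filterMap.2 ⟨R[k], ?_, hr⟩)
  · exact List.mem_take_iff_getElem.2 ⟨j, by omega, rfl⟩
  · refine List.mem_drop_iff_getElem.2 ⟨k - (j + 1), by omega, ?_⟩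
    congr 1
    omega

theorem exists_record {R : List Record} {l : ℕ} (hl : l ∈ recNames R) :
    ∃ (k : ℕ) (r : Record), R[k]? = some r ∧ r.2.2.2 = some l := by
  obtain ⟨r, hr, h⟩ := List.mem_filterMap.1 hl
  obtain ⟨k, hk⟩ := List.mem_iff_getElem?.1 hr
  exact ⟨k, r, hk, h⟩

theorem recIdx_append {R S : List Record} {l : ℕ} (hl : l ∈ recNames R) : recIdx (R ++ S) l = recIdx R l := by
  obtain ⟨r, hr, h⟩ := List.mem_filterMap.1 hl
  rw [recIdx, List.findIdx_append, if_pos]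
  · rfl
  · exact List.findIdx_lt_length.2 ⟨r, hr, by simp [h]⟩

/-- `S` is found in `R` from the index `p`. -/
def Seg (R : List Record) (p : ℕ) (S : List Record) : Prop :=
  ∀ (k : ℕ) (r : Record), S[k]? = some r → R[p + k]? = some r

theorem seg_cons {R : List Record} {p : ℕ} {r : Record} {S : List Record} :
    Seg R p (r :: S) ↔ R[p]? = some r ∧ Seg R (p + 1) S := by
  constructor
  · intro h
    refine ⟨h 0 r rfl, fun k s hs => ?_⟩
    rw [add_assoc, add_comm 1 k]
    exact h (k + 1) s hs
  · rintro ⟨h, h'⟩ k s hs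
    cases k with
    | zero =>
      rw [List.getElem?_cons_zero, Option.some.injEq] at hs
      exact hs ▸ h
    | succ k =>
      rw [add_comm k 1, ← add_assoc]
      exact h' k s hs

theorem seg_append {R : List Record} {p : ℕ} {S T : List Record} :
    Seg R p (S ++ T) ↔ Seg R p S ∧ Seg R (p + S.length) T := by
  induction S generalizing p with
  | nil =>
    simp only [List.nil_append, List.length_nil, add_zero]
    exact ⟨fun h => ⟨fun k r h => by simp at h, h⟩, fun h => h.2⟩
  | cons s S ih =>
    rw [List.cons_append, seg_cons, seg_cons, ih, List.length_cons, and_assoc, add_assoc, add_comm 1]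

theorem seg_self (R : List Record) : Seg R 0 R := fun k r h => by rwa [zero_add]

/-! ### The representation of a linking in memory -/

/-- The memory holds the records `R`, with pointers according to `Λ`. -/
structure Rep (R : List Record) (Λ : Finset (Sym2 ℕ)) (mem : ℕ → ℕ) : Prop where
  tag : ∀ (k : ℕ) (r : Record), R[k]? = some r → mem (4 * k) = r.1
  snd : ∀ (k : ℕ) (r : Record), R[k]? = some r → mem (4 * k + 1) = r.2.1
  trd : ∀ (k : ℕ) (r : Record), R[k]? = some r → mem (4 * k + 2) = r.2.2.1
  plain : ∀ (k : ℕ) (r : Record), R[k]? = some r → r.2.2.2 = none → mem (4 * k + 3) = 0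
  link : ∀ (k : ℕ) (r : Record), R[k]? = some r → ∀ l m, r.2.2.2 = some l → s(l, m) ∈ Λ → mem (4 * k + 3) = 4 * recIdx R m
  names : ∀ l m, s(l, m) ∈ Λ → l ∈ recNames R

/-- `Rep` constrains only the pointers of linked leaves. Writing the pointers of `a` and `d`
therefore suffices, and those of the cut leaves may become stale. -/
theorem Rep.atomic {R : List Record} {Λ Λ' : Finset (Sym2 ℕ)} {mem : ℕ → ℕ} (h : Rep R Λ mem)
    (hR : (recNames R).Nodup) {a i j d : ℕ} (hai : s(a, i) ∈ Λ) (hjd : s(j, d) ∈ Λ) (had : a ≠ d)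
    (hΛ' : ∀ l m, s(l, m) ∈ Λ' → (l = a ∧ m = d) ∨ (l = d ∧ m = a) ∨ (s(l, m) ∈ Λ ∧ l ≠ a ∧ l ≠ d)) :
    Rep R Λ' (Function.update (Function.update mem (4 * recIdx R a + 3) (4 * recIdx R d))
      (4 * recIdx R d + 3) (4 * recIdx R a)) := by
  obtain ⟨ka, ra, hka, hra⟩ := exists_record (h.names _ _ hai)
  obtain ⟨kd, rd, hkd, hrd⟩ := exists_record (h.names d j (Sym2.eq_swap ▸ hjd))
  rw [recIdx_eq hR hka hra, recIdx_eq hR hkd hrd]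
  have hne : ka ≠ kd := by
    rintro rfl
    rw [hka, Option.some.injEq] at hkd
    subst hkd
    rw [hra, Option.some.injEq] at hrd
    exact had hrd
  refine ⟨fun k r hk => ?_, fun k r hk => ?_, fun k r hk => ?_, fun k r hk hr => ?_,
    fun k r hk l m hr hlm => ?_, fun l m hlm => ?_⟩
  · rw [Function.update_of_ne (by omega), Function.update_of_ne (by omega), h.tag k r hk]
  · rw [Function.update_of_ne (by omega), Function.update_of_ne (by omega), h.snd k r hk]
  · rw [Function.update_of_ne (by omega), Function.update_of_ne (by omega), h.trd k r hk]
  · have h1 : k ≠ ka := by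
      rintro rfl
      rw [hk, Option.some.injEq] at hka
      rw [← hka, hr] at hra
      cases hra
    have h2 : k ≠ kd := by
      rintro rfl
      rw [hk, Option.some.injEq] at hkd
      rw [← hkd, hr] at hrd
      cases hrd
    rw [Function.update_of_ne (by omega), Function.update_of_ne (by omega), h.plain k r hk hr]
  · have hkl := recIdx_eq hR hk hr
    rcases hΛ' l m hlm with ⟨rfl, rfl⟩ | ⟨rfl, rfl⟩ | ⟨hlm, hla, hld⟩
    · rw [recIdx_eq hR hka hra] at hkl
      subst hkl
      rw [Function.update_of_ne (by omega), Function.update_self, recIdx_eq hR hkd hrd]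
    · rw [recIdx_eq hR hkd hrd] at hkl
      subst hkl
      rw [Function.update_self, recIdx_eq hR hka hra]
    · have h1 : k ≠ ka := by
        rintro rfl
        rw [hk, Option.some.injEq] at hka
        rw [← hka, hr, Option.some.injEq] at hra
        exact hla hra
      have h2 : k ≠ kd := by
        rintro rfl
        rw [hk, Option.some.injEq] at hkd
        rw [← hkd, hr, Option.some.injEq] at hrd
        exact hld hrd
      rw [Function.update_of_ne (by omega), Function.update_of_ne (by omega), h.link k r hk l m hr hlm]
  · rcases hΛ' l m hlm with ⟨rfl, rfl⟩ | ⟨rfl, rfl⟩ | ⟨hlm, -, -⟩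
    · exact h.names _ _ hai
    · exact h.names _ _ (Sym2.eq_swap ▸ hjd)
    · exact h.names l m hlm

theorem getD_flatMap_four {α : Type*} (f : α → List ℕ) (hf : ∀ x, (f x).length = 4) {R : List α} {k i : ℕ} {r : α}
    (hk : R[k]? = some r) (hi : i < 4) : (R.flatMap f).getD (4 * k + i) 0 = (f r).getD i 0 := by
  induction R generalizing k with
  | nil => simp at hk
  | cons x R ih =>
    rw [List.flatMap_cons]
    cases k with
    | zero =>
      rw [List.getElem?_cons_zero, Option.some.injEq] at hk
      subst hk
      rw [List.getD_append _ _ _ _ (by rw [hf]; omega)]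
      simp
    | succ k =>
      rw [List.getElem?_cons_succ] at hk
      rw [List.getD_append_right _ _ _ _ (by rw [hf]; omega), hf, ← ih hk]
      congr 1
      omega

/-! ### Words of nets in the memory of the machine -/

section

variable {D : Duality L} {θ : Net L} (ν : Numbering L)

theorem partner_eq {S : List (Sig L)} (hS : IsSigLinking D S θ.links) {l m : ℕ} (h : s(l, m) ∈ θ.links) :
    θ.partner l = m :=
  hS.eq_of_left (Classical.epsilon_spec (p := fun m => s(l, m) ∈ θ.links) ⟨m, h⟩) h

theorem word_getD {k i : ℕ} {r : Record} (hk : (θ.records ν)[k]? = some r) (hi : i < 4) :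
    (θ.word ν).getD (4 * k + i) 0 =
      [r.1, r.2.1, r.2.2.1, r.2.2.2.elim 0 fun l => θ.position ν (θ.partner l)].getD i 0 :=
  getD_flatMap_four _ (fun _ => rfl) hk hi

theorem rep_init (hS : IsSigLinking D θ.sigs θ.links) :
    Rep (θ.records ν) θ.links (Ram.init (θ.word ν)).mem := by
  refine ⟨fun k r hk => word_getD ν hk (i := 0) (by omega), fun k r hk => word_getD ν hk (i := 1) (by omega),
    fun k r hk => word_getD ν hk (i := 2) (by omega), fun k r hk hr => ?_, fun k r hk l m hr hlm => ?_,
    fun l m hlm => ?_⟩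
  · have := word_getD ν hk (i := 3) (by omega)
    rw [hr] at this
    exact this
  · have := word_getD ν hk (i := 3) (by omega)
    rw [hr] at this
    refine this.trans ?_
    simp only [List.getD_cons_succ, List.getD_cons_zero, Option.elim_some]
    rw [partner_eq hS hlm]
    rfl
  · rw [recNames_net, ← map_fst_sigs]
    obtain ⟨o, ho, rfl⟩ := hS.exists_left hlm
    exact List.mem_map_of_mem ho

/-- The memory holds the word of a cut-free net. -/
theorem output_of_rep {Γ : List (Fml L)} {Λ : Finset (Sym2 ℕ)} {T : List Record} {r₀ : Record}
    {m : Ram} {mem : ℕ → ℕ} (hS : IsSigLinking D (Net.mk Γ [] Λ).sigs Λ)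
    (h : Rep (conclRecords ν Γ ++ r₀ :: T) Λ mem) (h₀ : r₀.2 = (0, 0, .none))
    (hm : m.mem = Function.update mem (4 * (conclRecords ν Γ).length) 0) :
    m.Output ((Net.mk Γ [] Λ).word ν) := by
  set θ' : Net L := ⟨Γ, [], Λ⟩ with hθ'
  have hrec : θ'.records ν = conclRecords ν Γ ++ [(0, 0, 0, none)] := by
    rw [records_eq]
    simp [hθ', cutRecords]
  have hlen : (θ'.word ν).length = 4 * (θ'.records ν).length := by
    rw [Net.word, List.length_flatMap]
    simp [mul_comm]
  intro a ha
  obtain ⟨k, i, hi, rfl⟩ : ∃ k i, i < 4 ∧ a = 4 * k + i := ⟨a / 4, a % 4, Nat.mod_lt _ (by omega), by omega⟩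
  have hk : k < (θ'.records ν).length := by omega
  rw [word_getD ν (List.getElem?_eq_getElem hk) hi, hm]
  have hk' : k < (conclRecords ν Γ).length ∨ k = (conclRecords ν Γ).length := by
    rw [hrec, List.length_append, List.length_singleton] at hk
    omega
  rcases hk' with hk' | rfl
  · have h1 : (θ'.records ν)[k] = (conclRecords ν Γ)[k] := by
      simp only [hrec]
      exact List.getElem_append_left hk'
    have h2 : (conclRecords ν Γ ++ r₀ :: T)[k]? = some (conclRecords ν Γ)[k] := by
      rw [List.getElem?_append_left hk', List.getElem?_eq_getElem hk']
    rw [h1, Function.update_of_ne (by omega)]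
    generalize hr : (conclRecords ν Γ)[k] = r at h2
    interval_cases i
    · exact h.tag k r h2
    · exact h.snd k r h2
    · exact h.trd k r h2
    · cases hn : r.2.2.2 with
      | none => exact h.plain k r h2 hn
      | some l =>
        have hmem : ∀ l, l ∈ recNames (conclRecords ν Γ) ↔ ∃ o ∈ θ'.sigs, o.1 = l := by
          intro l
          rw [recNames_conclRecords, ← List.mem_map (f := Prod.fst), map_fst_sigs]
          simp [Net.names, hθ']
        obtain ⟨o, ho, rfl⟩ := (hmem l).1 (List.mem_filterMap.2 ⟨r, hr ▸ List.getElem_mem _, hn⟩)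
        obtain ⟨o', ho', hl⟩ := hS.exists_partner ho
        rw [h.link k r h2 o.1 o'.1 hn hl]
        simp only [Option.elim_some, List.getD_cons_succ, List.getD_cons_zero]
        -- The conclusions come first, so their leaves have the same positions in the words of the
        -- net and of its reduct.
        have h3 := (hmem o'.1).2 ⟨o', ho', rfl⟩
        rw [partner_eq (θ := θ') hS hl, Net.position, ← recIdx, hrec, recIdx_append h3, recIdx_append h3]
  -- The record behind the conclusions starts a cut or ends the word. It differs from an end mark at
  -- most in its tag, which has been overwritten by zero.
  · have h1 : (θ'.records ν)[(conclRecords ν Γ).length] = (0, 0, 0, none) := by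
      simp only [hrec]
      exact List.getElem_concat_length rfl _
    have h2 : (conclRecords ν Γ ++ r₀ :: T)[(conclRecords ν Γ).length]? = some r₀ := by
      rw [List.getElem?_append_right le_rfl, Nat.sub_self]
      rfl
    rw [h1]
    interval_cases i
    · exact Function.update_self _ _ _
    · rw [Function.update_of_ne (by omega), h.snd _ _ h2, h₀]
      rfl
    · rw [Function.update_of_ne (by omega), h.trd _ _ h2, h₀]
      rfl
    · rw [Function.update_of_ne (by omega), h.plain _ _ h2 (by rw [h₀])]
      rfl

end

/-! ### The program

Register 0 walks through the records of the first formula of a cut, register 1 through those of the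
second one. Register 2 holds a tag, register 9 the position of the first cut; the registers 3, 4 and
10 hold constants, and register 11 stays zero. -/

/-- Relink the partners of the two leaves at the current positions. -/
def relinkProg : Prog :=
  .seq (.plus 5 0 3) (.seq (.load 6 5) (.seq (.plus 7 1 3) (.seq (.load 8 7)
    (.seq (.plus 5 6 3) (.seq (.store 5 8) (.seq (.plus 7 8 3) (.store 7 6)))))))

def advanceProg : Prog := .seq (.plus 0 0 4) (.seq (.plus 1 1 4) (.load 2 0))

/-- `.plus 5 5 0` does nothing; it stands in for an empty branch. -/
def walkBody : Prog := .seq (.cond (.eq 2 4) relinkProg (.plus 5 5 0)) advanceProg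

/-- Walk through both formulas of a cut. -/
def walkProg : Prog := .loop (.ne 2 3) walkBody

def seekBody : Prog := .seq (.plus 1 1 4) (.load 2 1)

/-- Find the second formula of a cut. -/
def seekProg : Prog := .loop (.ne 2 3) seekBody

/-- The walk stops when register 0 meets the mark 10 between the two formulas. By duality register 1
is then just behind the second formula, where the next cut or the end mark is found. -/
def cutBody : Prog :=
  .seq (.plus 0 1 4) (.seq seekProg (.seq (.plus 1 1 4) (.seq (.load 2 0) (.seq walkProg (.load 2 1)))))

def cutsProg : Prog := .loop (.ne 2 11) cutBody

/-- Load a tag, and clear register 5 at the end of the conclusions. -/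
def probeProg : Prog := .seq (.load 2 1) (.seq (.plus 5 2 0) (.cond (.eq 2 10) (.const 5 0) (.const 6 0)))

/-- The conclusions end at a tag 9 or 0. The probe sets register 5 to zero in both cases, so that
the loop needs only one condition. -/
def scanBody : Prog := .seq (.plus 1 1 4) probeProg

/-- Find the end of the conclusions. -/
def scanProg : Prog := .loop (.ne 5 11) scanBody

/-- Eliminate all cuts. -/
def cutElimProg : Prog :=
  -- The constants are the mark of the second formula of a cut, the tag of a leaf, and the mark of a
  -- first formula. The final store puts the end mark 0 behind the conclusions.
  .seq (.const 3 10) (.seq (.const 4 5) (.seq (.const 10 9) (.seq probeProg (.seq scanProg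
    (.seq (.plus 9 1 0) (.seq cutsProg (.store 9 11)))))))

/-! ### Loops -/

/-- Some iterations of a loop lead from `m` to `m'` in time at most `T`. -/
def Iter (b : Cond) (p : Prog) (m : Ram) (T : ℕ) (m' : Ram) : Prop :=
  ∃ t ≤ T, ∀ t' m'', Runs (.loop b p) m' t' m'' → Runs (.loop b p) m (t + t') m''

theorem Iter.refl (b : Cond) (p : Prog) (m : Ram) : Iter b p m 0 m :=
  ⟨0, le_rfl, fun t' m'' h => by rwa [zero_add]⟩

theorem Iter.trans {b : Cond} {p : Prog} {m m' m'' : Ram} {T T' U : ℕ} (h : Iter b p m T m')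
    (h' : Iter b p m' T' m'') (hU : T + T' ≤ U) : Iter b p m U m'' := by
  obtain ⟨t, ht, h⟩ := h
  obtain ⟨t', ht', h'⟩ := h'
  exact ⟨t + t', by omega, fun s n hs => by rw [add_assoc]; exact h _ _ (h' _ _ hs)⟩

theorem Iter.of_runs {b : Cond} {p : Prog} {m m' : Ram} {t T : ℕ} (hb : b.Holds m) (h : Runs p m t m')
    (hT : t + 1 ≤ T) : Iter b p m T m' :=
  ⟨t + 1, hT, fun t' m'' h' => by
    rw [add_right_comm]
    exact .loop_true hb h h'⟩

theorem Iter.runs {b : Cond} {p : Prog} {m m' : Ram} {T : ℕ} (h : Iter b p m T m') (hb : ¬ b.Holds m') :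
    ∃ t ≤ T + 1, Runs (.loop b p) m t m' := by
  obtain ⟨t, ht, h⟩ := h
  exact ⟨t + 1, by omega, h _ _ (.loop_false hb)⟩

/-- The registers with a fixed content, of which register 9 holds `e`. -/
structure Ram.Fixed (m : Ram) (e : ℕ) : Prop where
  r3 : m.reg 3 = 10
  r4 : m.reg 4 = 5
  r9 : m.reg 9 = e
  r10 : m.reg 10 = 9
  r11 : m.reg 11 = 0

/-! ### Walking through the formulas of a cut -/

/-- The state of the machine while it walks through the two formulas of a cut. -/
structure Walk (R : List Record) (Λ : Finset (Sym2 ℕ)) (e p q : ℕ) (m : Ram) : Prop where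
  fixed : m.Fixed e
  r0 : m.reg 0 = 4 * p
  r1 : m.reg 1 = 4 * q
  r2 : m.reg 2 = m.mem (4 * p)
  rep : Rep R Λ m.mem

theorem Walk.skip {R : List Record} {Λ : Finset (Sym2 ℕ)} {e p q : ℕ} {m : Ram} {r : Record}
    (h : Walk R Λ e p q m) (hr : R[p]? = some r) (h5 : r.1 ≠ 5) (h10 : r.1 ≠ 10) :
    ∃ m', Iter (.ne 2 3) walkBody m 13 m' ∧ Walk R Λ e (p + 1) (q + 1) m' := by
  have ht : m.reg 2 = r.1 := h.r2.trans (h.rep.tag p r hr)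
  have hb : ¬ (Cond.eq 2 4).Holds m := by
    rw [Cond.Holds, ht, h.fixed.r4]
    exact h5
  refine ⟨_, .of_runs ?_ (.seq (.cond_false hb (.plus _ _ _ _)) (.seq (.plus _ _ _ _)
    (.seq (.plus _ _ _ _) (.load _ _ _)))) (by omega), ⟨?_, ?_, ?_, ?_, ?_⟩⟩
  · rw [Cond.Holds, ht, h.fixed.r3]
    exact h10
  · constructor <;> simp [Ram.setReg, h.fixed.r3, h.fixed.r4, h.fixed.r9,
      h.fixed.r10, h.fixed.r11]
  · simp [Ram.setReg, h.r0]
    omega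
  · simp [Ram.setReg, h.r1]
    omega
  · simp [Ram.setReg, h.r0, mul_add]
  · exact h.rep

/-- The 13 units are 8 for relinking, 1 for the test of the tag, 3 for advancing and 1 for the loop.
Other iterations are cheaper and share this bound. -/
theorem Walk.relink {R : List Record} {Λ Λ' : Finset (Sym2 ℕ)} {e p q : ℕ} {m : Ram} {r r' : Record}
    (h : Walk R Λ e p q m) (hR : (recNames R).Nodup) {a i j d : ℕ} (hr : R[p]? = some r)
    (hr' : R[q]? = some r') (h5 : r.1 = 5) (hi : r.2.2.2 = some i) (hj : r'.2.2.2 = some j)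
    (hai : s(a, i) ∈ Λ) (hjd : s(j, d) ∈ Λ) (had : a ≠ d)
    (hΛ' : ∀ l m, s(l, m) ∈ Λ' → (l = a ∧ m = d) ∨ (l = d ∧ m = a) ∨ (s(l, m) ∈ Λ ∧ l ≠ a ∧ l ≠ d)) :
    ∃ m', Iter (.ne 2 3) walkBody m 13 m' ∧ Walk R Λ' e (p + 1) (q + 1) m' := by
  have ht : m.reg 2 = 5 := h5 ▸ h.r2.trans (h.rep.tag p r hr)
  have hb : (Cond.eq 2 4).Holds m := by rw [Cond.Holds, ht, h.fixed.r4]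
  have hp : m.mem (4 * p + 3) = 4 * recIdx R a := h.rep.link p r hr i a hi (Sym2.eq_swap ▸ hai)
  have hq : m.mem (4 * q + 3) = 4 * recIdx R d := h.rep.link q r' hr' j d hj hjd
  have hrep := h.rep.atomic hR hai hjd had hΛ'
  refine ⟨_, .of_runs ?_ (.seq (.cond_true hb (.seq (.plus _ _ _ _) (.seq (.load _ _ _) (.seq (.plus _ _ _ _)
    (.seq (.load _ _ _) (.seq (.plus _ _ _ _) (.seq (.store _ _ _) (.seq (.plus _ _ _ _) (.store _ _ _)))))))))
    (.seq (.plus _ _ _ _) (.seq (.plus _ _ _ _) (.load _ _ _)))) (by omega), ⟨?_, ?_, ?_, ?_, ?_⟩⟩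
  · rw [Cond.Holds, ht, h.fixed.r3]
    omega
  · constructor <;> simp [Ram.setReg, Ram.setMem, Function.update_apply, h.fixed.r3, h.fixed.r4, h.fixed.r9,
      h.fixed.r10, h.fixed.r11]
  · simp [Ram.setReg, Ram.setMem, Function.update_apply, h.r0]
    omega
  · simp [Ram.setReg, Ram.setMem, Function.update_apply, h.r1]
    omega
  · simp [Ram.setReg, Ram.setMem, Function.update_apply, h.r0, mul_add]
  · simpa [Ram.setReg, Ram.setMem, Function.update_apply, h.r0, h.r1, hp, hq] using hrep

theorem Walk.skips {R : List Record} {Λ : Finset (Sym2 ℕ)} {e : ℕ} {S : List Record} {p q : ℕ} {m : Ram}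
    (h : Walk R Λ e p q m) (hS : Seg R p S) (h5 : ∀ r ∈ S, r.1 ≠ 5) (h10 : ∀ r ∈ S, r.1 ≠ 10) :
    ∃ m', Iter (.ne 2 3) walkBody m (13 * S.length) m' ∧ Walk R Λ e (p + S.length) (q + S.length) m' := by
  induction S generalizing p q m with
  | nil => exact ⟨m, .refl _ _ _, h⟩
  | cons r S ih =>
    obtain ⟨hr, hS⟩ := seg_cons.1 hS
    obtain ⟨m₁, h₁, hw⟩ := h.skip hr (h5 r (by simp)) (h10 r (by simp))
    obtain ⟨m₂, h₂, hw⟩ := ih hw hS (fun r hr => h5 r (by simp [hr])) fun r hr => h10 r (by simp [hr])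
    refine ⟨m₂, h₁.trans h₂ (by rw [List.length_cons]; omega), ?_⟩
    rw [List.length_cons, add_comm S.length, ← add_assoc, ← add_assoc]
    exact hw

variable {D : Duality L}

/-- Walking through a cut eliminates it. -/
theorem Walk.cut {R : List Record} (hR : (recNames R).Nodup) (ν : Numbering L) {Γ : List (Fml L)} {e : ℕ}
    {A A' : Fml L} (hd : IsDual D A A') {post : List (Fml L × Fml L)} {Λ : Finset (Sym2 ℕ)} {p q : ℕ} {m : Ram}
    (hθ : (Net.mk Γ ((A, A') :: post) Λ).IsUnet D) (h : Walk R Λ e p q m)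
    (hp : Seg R p (A.records ν)) (hq : Seg R q (A'.records ν)) :
    ∃ m' Λ', Iter (.ne 2 3) walkBody m (13 * A.size) m' ∧ Walk R Λ' e (p + A.size) (q + A.size) m' ∧
      Reduces D ⟨Γ, (A, A') :: post, Λ⟩ ⟨Γ, post, Λ'⟩ := by
  -- The cut in progress stays at the head of the list, and the cuts that it produces are eliminated
  -- depth first, in the prefix order of the records.
  induction hd generalizing post Λ p q m with
  | atom i j P ts =>
    obtain ⟨Λ', hred⟩ := hθ.exists_atomicRed (i := i) (j := j) (P := P) (ts := ts) (by simp)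
    have hstep : Step D ⟨Γ, (.atom i P ts, .atom j (D.neg P) ts) :: post, Λ⟩ ⟨Γ, post, Λ'⟩ :=
      step_iff.2 ⟨Γ, [], _, post, [], Λ, Λ', .atomic hred, rfl, rfl⟩
    obtain ⟨a, d, _, _, hai, hjd, hne⟩ := hred
    obtain ⟨-, -, -, -, -, had⟩ := atomic_names_ne (pre := []) hθ.isSigLinking hai hjd hne
    have hs := hθ.isSigLinking
    simp only [Fml.records] at hp hq
    obtain ⟨hp, hp'⟩ := seg_cons.1 hp
    obtain ⟨hq, -⟩ := seg_cons.1 hq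
    obtain ⟨m₁, h₁, hw⟩ := h.relink hR (Λ' := insert s(a, d) ((Λ.erase s(a, i)).erase s(j, d))) hp hq rfl rfl rfl
      hai hjd had (by
        intro l m hl
        rcases Finset.mem_insert.1 hl with hl | hl
        · rcases Sym2.eq_iff.1 hl with h | h
          · exact Or.inl h
          · exact Or.inr (Or.inl h)
        · obtain ⟨h1, hl₁⟩ := Finset.mem_erase.1 hl
          obtain ⟨h2, hl₂⟩ := Finset.mem_erase.1 hl₁
          refine Or.inr (Or.inr ⟨hl₂, ?_, ?_⟩)
          · rintro rfl
            exact h2 (by rw [hs.eq_of_left hl₂ hai])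
          · rintro rfl
            exact h1 (by rw [hs.eq_of_left hl₂ (m' := j) (Sym2.eq_swap ▸ hjd), Sym2.eq_swap]))
    obtain ⟨m₂, h₂, hw⟩ := hw.skips hp' (fun r hr => by rcases (mem_argRecords hr).1 with h | h <;> omega)
      fun r hr => by rcases (mem_argRecords hr).1 with h | h <;> omega
    have hlen := length_records ν (.atom i P ts)
    rw [Fml.records, List.length_cons] at hlen
    refine ⟨m₂, _, h₁.trans h₂ (by omega), ?_, .single hstep⟩
    rw [← hlen, add_comm _ 1, ← add_assoc, ← add_assoc]
    exact hw
  | @tensor A A' B B' hA hB ihA ihB =>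
    have hstep : Step D ⟨Γ, (.tensor A B, .par A' B') :: post, Λ⟩ ⟨Γ, (A, A') :: (B, B') :: post, Λ⟩ :=
      .tensorPar Γ [] post Λ A B A' B'
    simp only [Fml.records] at hp hq
    obtain ⟨hp, hp'⟩ := seg_cons.1 hp
    obtain ⟨hq, hq'⟩ := seg_cons.1 hq
    obtain ⟨hp₁, hp₂⟩ := seg_append.1 hp'
    obtain ⟨hq₁, hq₂⟩ := seg_append.1 hq'
    rw [length_records] at hp₂ hq₂
    -- Dual formulas have equally many records, so both pointers reach the second arguments
    -- together.
    rw [← hA.size_eq] at hq₂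
    obtain ⟨m₁, h₁, hw⟩ := h.skip hp (by simp) (by simp)
    have hθ₁ := hstep.isUnet hθ
    obtain ⟨m₂, Λ₂, h₂, hw, hr₂⟩ := ihA hθ₁ hw hp₁ hq₁
    obtain ⟨m₃, Λ₃, h₃, hw, hr₃⟩ := ihB (hr₂.isUnet hθ₁) hw hp₂ hq₂
    refine ⟨m₃, Λ₃, (h₁.trans h₂ le_rfl).trans h₃ (by simp only [Fml.size]; omega), ?_,
      .head hstep (hr₂.trans hr₃)⟩
    rw [Fml.size, ← add_assoc, ← add_assoc, ← add_assoc, ← add_assoc]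
    exact hw
  | @par A A' B B' hA hB ihA ihB =>
    have hstep : Step D ⟨Γ, (.par A B, .tensor A' B') :: post, Λ⟩ ⟨Γ, (A, A') :: (B, B') :: post, Λ⟩ :=
      .parTensor Γ [] post Λ A B A' B'
    simp only [Fml.records] at hp hq
    obtain ⟨hp, hp'⟩ := seg_cons.1 hp
    obtain ⟨hq, hq'⟩ := seg_cons.1 hq
    obtain ⟨hp₁, hp₂⟩ := seg_append.1 hp'
    obtain ⟨hq₁, hq₂⟩ := seg_append.1 hq'
    rw [length_records] at hp₂ hq₂
    rw [← hA.size_eq] at hq₂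
    obtain ⟨m₁, h₁, hw⟩ := h.skip hp (by simp) (by simp)
    have hθ₁ := hstep.isUnet hθ
    obtain ⟨m₂, Λ₂, h₂, hw, hr₂⟩ := ihA hθ₁ hw hp₁ hq₁
    obtain ⟨m₃, Λ₃, h₃, hw, hr₃⟩ := ihB (hr₂.isUnet hθ₁) hw hp₂ hq₂
    refine ⟨m₃, Λ₃, (h₁.trans h₂ le_rfl).trans h₃ (by simp only [Fml.size]; omega), ?_,
      .head hstep (hr₂.trans hr₃)⟩
    rw [Fml.size, ← add_assoc, ← add_assoc, ← add_assoc, ← add_assoc]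
    exact hw
  | @all x A A' hA ih =>
    have hstep : Step D ⟨Γ, (.all x A, .ex x A') :: post, Λ⟩ ⟨Γ, (A, A') :: post, Λ⟩ :=
      .allEx Γ [] post Λ x A A'
    simp only [Fml.records] at hp hq
    obtain ⟨hp, hp'⟩ := seg_cons.1 hp
    obtain ⟨hq, hq'⟩ := seg_cons.1 hq
    obtain ⟨m₁, h₁, hw⟩ := h.skip hp (by simp) (by simp)
    obtain ⟨m₂, Λ₂, h₂, hw, hr₂⟩ := ih (hstep.isUnet hθ) hw hp' hq'
    refine ⟨m₂, Λ₂, h₁.trans h₂ (by simp only [Fml.size]; omega), ?_, .head hstep hr₂⟩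
    rw [Fml.size, ← add_assoc, ← add_assoc]
    exact hw
  | @ex x A A' hA ih =>
    have hstep : Step D ⟨Γ, (.ex x A, .all x A') :: post, Λ⟩ ⟨Γ, (A, A') :: post, Λ⟩ :=
      .exAll Γ [] post Λ x A A'
    simp only [Fml.records] at hp hq
    obtain ⟨hp, hp'⟩ := seg_cons.1 hp
    obtain ⟨hq, hq'⟩ := seg_cons.1 hq
    obtain ⟨m₁, h₁, hw⟩ := h.skip hp (by simp) (by simp)
    obtain ⟨m₂, Λ₂, h₂, hw, hr₂⟩ := ih (hstep.isUnet hθ) hw hp' hq'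
    refine ⟨m₂, Λ₂, h₁.trans h₂ (by simp only [Fml.size]; omega), ?_, .head hstep hr₂⟩
    rw [Fml.size, ← add_assoc, ← add_assoc]
    exact hw

/-! ### Seeking -/

/-- The state of the machine while it seeks in the records. -/
structure Seek (e x q : ℕ) (mem : ℕ → ℕ) (m : Ram) : Prop where
  fixed : m.Fixed e
  r0 : m.reg 0 = x
  r1 : m.reg 1 = 4 * q
  r2 : m.reg 2 = mem (4 * q)
  mem_eq : m.mem = mem

theorem Seek.skips {R : List Record} {Λ : Finset (Sym2 ℕ)} {e x q : ℕ} {mem : ℕ → ℕ} {m : Ram}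
    {S : List Record} (hrep : Rep R Λ mem) (h : Seek e x q mem m) (hS : Seg R q S) (h10 : ∀ r ∈ S, r.1 ≠ 10) :
    ∃ m', Iter (.ne 2 3) seekBody m (3 * S.length) m' ∧ Seek e x (q + S.length) mem m' := by
  induction S generalizing q m with
  | nil => exact ⟨m, .refl _ _ _, h⟩
  | cons r S ih =>
    obtain ⟨hr, hS⟩ := seg_cons.1 hS
    have key : ∃ m', Iter (.ne 2 3) seekBody m 3 m' ∧ Seek e x (q + 1) mem m' := by
      refine ⟨_, .of_runs ?_ (.seq (.plus _ _ _ _) (.load _ _ _)) (by omega), ⟨?_, ?_, ?_, ?_, h.mem_eq⟩⟩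
      · rw [Cond.Holds, h.r2, hrep.tag q r hr, h.fixed.r3]
        exact h10 r (by simp)
      · constructor <;> simp [Ram.setReg, h.fixed.r3, h.fixed.r4, h.fixed.r9,
          h.fixed.r10, h.fixed.r11]
      · simp [Ram.setReg, h.r0]
      · simp [Ram.setReg, h.r1]
        omega
      · simp [Ram.setReg, h.r1, h.mem_eq, mul_add]
    obtain ⟨m₁, h₁, hw⟩ := key
    obtain ⟨m₂, h₂, hw⟩ := ih hw hS fun r hr => h10 r (by simp [hr])
    refine ⟨m₂, h₁.trans h₂ (by rw [List.length_cons]; omega), ?_⟩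
    rw [List.length_cons, add_comm S.length, ← add_assoc]
    exact hw

/-- The state of the machine between two cuts. -/
structure AtCut (R : List Record) (Λ : Finset (Sym2 ℕ)) (e q : ℕ) (m : Ram) : Prop where
  fixed : m.Fixed e
  r1 : m.reg 1 = 4 * q
  r2 : m.reg 2 = m.mem (4 * q)
  rep : Rep R Λ m.mem

theorem AtCut.body {R : List Record} (hR : (recNames R).Nodup) (ν : Numbering L) {Γ : List (Fml L)} {e : ℕ}
    {c : Fml L × Fml L} {post : List (Fml L × Fml L)} {Λ : Finset (Sym2 ℕ)} {q : ℕ} {m : Ram} {r : Record}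
    (hθ : (Net.mk Γ (c :: post) Λ).IsUnet D) (h : AtCut R Λ e q m)
    (hq : Seg R q ((9, 0, 0, none) :: c.1.records ν ++ (10, 0, 0, none) :: c.2.records ν))
    (hr : R[q + (c.1.size + c.2.size + 2)]? = some r) :
    ∃ t m' Λ', t ≤ 16 * (c.1.size + c.2.size + 2) ∧ Runs cutBody m t m' ∧
      AtCut R Λ' e (q + (c.1.size + c.2.size + 2)) m' ∧ Reduces D ⟨Γ, c :: post, Λ⟩ ⟨Γ, post, Λ'⟩ := by
  obtain ⟨A, A'⟩ := c
  have hd : IsDual D A A' := hθ.1 (A, A') (by simp)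
  simp only at hq hr ⊢
  obtain ⟨hq₁, hq₂⟩ := seg_append.1 hq
  obtain ⟨hq₀, hq₃⟩ := seg_cons.1 hq₁
  obtain ⟨hq₄, hq₅⟩ := seg_cons.1 hq₂
  rw [List.length_cons, length_records] at hq₄ hq₅
  have hs : Seek e (4 * (q + 1)) q m.mem (m.setReg 0 (m.reg 1 + 4)) := by
    refine ⟨?_, ?_, ?_, ?_, rfl⟩
    · constructor <;> simp [Ram.setReg, h.fixed.r3, h.fixed.r4, h.fixed.r9, h.fixed.r10, h.fixed.r11]
    · simp [Ram.setReg, h.r1]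
      omega
    · simp [Ram.setReg, h.r1]
    · simp [Ram.setReg, h.r2]
  obtain ⟨m₁, h₁, hs⟩ := hs.skips h.rep hq₁ (by
    intro r hr
    rcases List.mem_cons.1 hr with rfl | hr
    · simp
    · have := (mem_records hr).2
      omega)
  rw [List.length_cons, length_records] at h₁ hs
  obtain ⟨t₁, ht₁, hrun₁⟩ := h₁.runs (by
    rw [Cond.Holds, hs.r2, h.rep.tag _ _ hq₄, hs.fixed.r3]
    simp)
  set m₂ := m₁.setReg 1 (m₁.reg 1 + 4) with hm₂
  set m₃ := m₂.setReg 2 (m₂.mem (m₂.reg 0)) with hm₃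
  have hmem : m₃.mem = m.mem := hs.mem_eq
  have hw : Walk R Λ e (q + 1) (q + (A.size + 1) + 1) m₃ := by
    refine ⟨?_, ?_, ?_, ?_, by rw [hmem]; exact h.rep⟩
    · constructor <;> simp [hm₃, hm₂, Ram.setReg, hs.fixed.r3, hs.fixed.r4, hs.fixed.r9,
        hs.fixed.r10, hs.fixed.r11]
    · simp [hm₃, hm₂, Ram.setReg, hs.r0]
    · simp [hm₃, hm₂, Ram.setReg, hs.r1]
      omega
    · simp [hm₃, hm₂, Ram.setReg, hs.r0]
  obtain ⟨m₄, Λ', h₄, hw, hred⟩ := Walk.cut hR ν hd hθ hw hq₃ hq₅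
  have hidx : q + 1 + A.size = q + (A.size + 1) := by omega
  obtain ⟨t₂, ht₂, hrun₂⟩ := h₄.runs (by
    rw [Cond.Holds, hw.r2, hw.fixed.r3, hidx, hw.rep.tag _ _ hq₄]
    simp)
  -- The length of the walk is set by the first formula; by duality it exhausts the second one as
  -- well.
  have hend : q + (A.size + 1) + 1 + A.size = q + (A.size + A'.size + 2) := by
    rw [hd.size_eq]
    omega
  refine ⟨_, _, Λ', ?_, .seq (.plus _ _ _ _) (.seq hrun₁ (.seq (.plus _ _ _ _) (.seq (.load _ _ _)
    (.seq hrun₂ (.load _ _ _))))), ⟨?_, ?_, ?_, hw.rep⟩, hred⟩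
  -- Seeking costs 3 and walking 13 units per symbol of the first formula; together with 9 further
  -- units this stays below the bound.
  · omega
  · constructor <;> simp [Ram.setReg, hw.fixed.r3, hw.fixed.r4, hw.fixed.r9,
      hw.fixed.r10, hw.fixed.r11]
  · simp [Ram.setReg, hw.r1, hend]
  · simp [Ram.setReg, hw.r1, hend]

/-- The main loop eliminates all cuts. -/
theorem AtCut.cuts {R : List Record} (hR : (recNames R).Nodup) (ν : Numbering L) {Γ : List (Fml L)} {e : ℕ}
    {cs : List (Fml L × Fml L)} {Λ : Finset (Sym2 ℕ)} {q : ℕ} {m : Ram}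
    (hθ : (Net.mk Γ cs Λ).IsUnet D) (h : AtCut R Λ e q m)
    (hq : Seg R q (cutRecords ν cs ++ [(0, 0, 0, none)])) :
    ∃ m' Λ', Iter (.ne 2 11) cutBody m (17 * (cutRecords ν cs).length) m' ∧
      AtCut R Λ' e (q + (cutRecords ν cs).length) m' ∧ Reduces D ⟨Γ, cs, Λ⟩ ⟨Γ, [], Λ'⟩ := by
  induction cs generalizing Λ q m with
  | nil => exact ⟨m, Λ, .refl _ _ _, h, .refl⟩
  | cons c cs ih =>
    rw [cutRecords, List.flatMap_cons, ← cutRecords] at hq ⊢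
    rw [List.append_assoc] at hq
    obtain ⟨hq₁, hq₂⟩ := seg_append.1 hq
    have hlen : ((9, 0, 0, none) :: c.1.records ν ++ (10, 0, 0, none) :: c.2.records ν : List Record).length =
        c.1.size + c.2.size + 2 := by
      simp only [List.length_append, List.length_cons, length_records]
      omega
    rw [hlen] at hq₂
    obtain ⟨r, hr⟩ : ∃ r, (cutRecords ν cs ++ [((0, 0, 0, none) : Record)])[0]? = some r := by
      cases hc : cutRecords ν cs <;> simp
    obtain ⟨t, m₁, Λ₁, ht, hrun, h₁, hred₁⟩ := h.body hR ν hθ hq₁ (hq₂ 0 r hr)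
    obtain ⟨m₂, Λ₂, h₂, hw, hred₂⟩ := ih (hred₁.isUnet hθ) h₁ hq₂
    -- The loop test adds one unit to the cost of the body, which turns the factor 16 into 17.
    have hit : Iter (.ne 2 11) cutBody m (17 * (c.1.size + c.2.size + 2)) m₁ := by
      refine .of_runs ?_ hrun (by omega)
      rw [Cond.Holds, h.r2, h.fixed.r11, h.rep.tag q (9, 0, 0, none) (hq₁ 0 _ rfl)]
      simp
    refine ⟨m₂, Λ₂, hit.trans h₂ (by rw [List.length_append, hlen]; omega), ?_, hred₁.trans hred₂⟩
    rw [List.length_append, hlen, ← add_assoc]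
    exact hw

/-! ### Finding the end of the conclusions -/

/-- The state of the machine while it seeks the end of the conclusions. -/
structure Scan (q : ℕ) (mem : ℕ → ℕ) (m : Ram) : Prop where
  fixed : m.Fixed 0
  r1 : m.reg 1 = 4 * q
  r2 : m.reg 2 = mem (4 * q)
  r5 : m.reg 5 = if mem (4 * q) = 9 then 0 else mem (4 * q)
  mem_eq : m.mem = mem

theorem Scan.of_probe {q : ℕ} {mem : ℕ → ℕ} {m : Ram} (h : m.Fixed 0) (h1 : m.reg 1 = 4 * q)
    (hmem : m.mem = mem) : ∃ m', Runs probeProg m 4 m' ∧ Scan q mem m' := by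
  by_cases h9 : mem (4 * q) = 9
  · refine ⟨_, .seq (.load _ _ _) (.seq (.plus _ _ _ _) (.cond_true ?_ (.const _ _ _))), ⟨?_, ?_, ?_, ?_, hmem⟩⟩
    · simp [Cond.Holds, Ram.setReg, h.r10, h1, hmem, h9]
    · constructor <;> simp [Ram.setReg, h.r3, h.r4, h.r9, h.r10, h.r11]
    · simp [Ram.setReg, h1]
    · simp [Ram.setReg, h1, hmem]
    · simp [Ram.setReg, h9]
  · refine ⟨_, .seq (.load _ _ _) (.seq (.plus _ _ _ _) (.cond_false ?_ (.const _ _ _))), ⟨?_, ?_, ?_, ?_, hmem⟩⟩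
    · simp [Cond.Holds, Ram.setReg, h.r10, h1, hmem, h9]
    · constructor <;> simp [Ram.setReg, h.r3, h.r4, h.r9, h.r10, h.r11]
    · simp [Ram.setReg, h1]
    · simp [Ram.setReg, h1, hmem]
    · simp [Ram.setReg, h9, h1, hmem]

theorem Scan.skips {R : List Record} {Λ : Finset (Sym2 ℕ)} {q : ℕ} {mem : ℕ → ℕ} {m : Ram}
    {S : List Record} (hrep : Rep R Λ mem) (h : Scan q mem m) (hS : Seg R q S)
    (hne : ∀ r ∈ S, r.1 ≠ 0 ∧ r.1 ≠ 9) :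
    ∃ m', Iter (.ne 5 11) scanBody m (6 * S.length) m' ∧ Scan (q + S.length) mem m' := by
  induction S generalizing q m with
  | nil => exact ⟨m, .refl _ _ _, h⟩
  | cons r S ih =>
    obtain ⟨hr, hS⟩ := seg_cons.1 hS
    have key : ∃ m', Iter (.ne 5 11) scanBody m 6 m' ∧ Scan (q + 1) mem m' := by
      obtain ⟨m', hrun, hm'⟩ := Scan.of_probe (q := q + 1) (mem := mem) (m := m.setReg 1 (m.reg 1 + 4))
        (by constructor <;> simp [Ram.setReg, h.fixed.r3, h.fixed.r4, h.fixed.r9, h.fixed.r10, h.fixed.r11])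
        (by simp [Ram.setReg, h.r1]; omega) h.mem_eq
      refine ⟨m', .of_runs ?_ (.seq (.plus _ _ _ _) hrun) (by omega), hm'⟩
      have := hne r (by simp)
      rw [Cond.Holds, h.r5, hrep.tag q r hr, h.fixed.r11, if_neg this.2]
      exact this.1
    obtain ⟨m₁, h₁, hw⟩ := key
    obtain ⟨m₂, h₂, hw⟩ := ih hw hS fun r hr => hne r (by simp [hr])
    refine ⟨m₂, h₁.trans h₂ (by rw [List.length_cons]; omega), ?_⟩
    rw [List.length_cons, add_comm S.length, ← add_assoc]
    exact hw

/-- The program computes a cut-free reduct. -/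
theorem runs_cutElimProg {θ : Net L} (hθ : θ.IsUnet D) (ν : Numbering L) :
    ∃ t m Λ', Runs cutElimProg (Ram.init (θ.word ν)) t m ∧ m.Output ((Net.mk θ.concl [] Λ').word ν) ∧
      Reduces D θ ⟨θ.concl, [], Λ'⟩ ∧ t ≤ 17 * (θ.records ν).length + 20 := by
  set R := θ.records ν with hRd
  set m₀ := Ram.init (θ.word ν) with hm₀
  have hR : (recNames R).Nodup := by
    rw [hRd, recNames_net]
    exact hθ.names_nodup
  have hrep : Rep R θ.links m₀.mem := rep_init ν hθ.isSigLinking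
  have hseg : Seg R 0 (conclRecords ν θ.concl ++ (cutRecords ν θ.cuts ++ [(0, 0, 0, none)])) := by
    rw [← List.append_assoc, ← records_eq]
    exact seg_self R
  obtain ⟨hs₁, hs₂⟩ := seg_append.1 hseg
  rw [zero_add] at hs₂
  set k := (conclRecords ν θ.concl).length with hk
  obtain ⟨r, T, hrT, hr⟩ : ∃ r T, cutRecords ν θ.cuts ++ [((0, 0, 0, none) : Record)] = r :: T ∧
      (r = (0, 0, 0, none) ∨ r = (9, 0, 0, none)) := by
    cases hc : θ.cuts with
    | nil => exact ⟨_, _, rfl, Or.inl rfl⟩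
    | cons c cs => exact ⟨_, _, rfl, Or.inr rfl⟩
  obtain ⟨m₁, hrun₁, h₁⟩ := Scan.of_probe (q := 0) (mem := m₀.mem)
    (m := ((m₀.setReg 3 10).setReg 4 5).setReg 10 9)
    (by constructor <;> simp [hm₀, Ram.init, Ram.setReg])
    (by simp [hm₀, Ram.init, Ram.setReg]) rfl
  obtain ⟨m₂, hit₂, h₂⟩ := h₁.skips hrep hs₁ (by
    intro r hr
    obtain ⟨A, -, hr⟩ := List.mem_flatMap.1 hr
    rcases List.mem_cons.1 hr with rfl | hr
    · simp
    · have := mem_records hr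
      exact ⟨this.1, by omega⟩)
  rw [zero_add, ← hk] at h₂
  rw [← hk] at hit₂
  have hkr : R[k]? = some r := hs₂ 0 r (by rw [hrT]; rfl)
  obtain ⟨t₂, ht₂, hrun₂⟩ := hit₂.runs (by
    rw [Cond.Holds, h₂.r5, h₂.fixed.r11, hrep.tag k r hkr]
    rcases hr with rfl | rfl <;> simp)
  have h₃ : AtCut R θ.links (4 * k) k (m₂.setReg 9 (m₂.reg 1 + 0)) := by
    refine ⟨?_, ?_, ?_, ?_⟩
    · constructor <;> simp [Ram.setReg, h₂.fixed.r3, h₂.fixed.r4, h₂.r1,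
        h₂.fixed.r10, h₂.fixed.r11]
    · simp [Ram.setReg, h₂.r1]
    · simp [Ram.setReg, h₂.r2, h₂.mem_eq]
    · simpa [Ram.setReg, h₂.mem_eq] using hrep
  obtain ⟨m₄, Λ', hit₄, h₄, hred⟩ := h₃.cuts hR ν (Γ := θ.concl) (cs := θ.cuts) hθ hs₂
  have hend : R[k + (cutRecords ν θ.cuts).length]? = some (0, 0, 0, none) := by
    refine (seg_append.1 hs₂).2 0 _ rfl
  obtain ⟨t₄, ht₄, hrun₄⟩ := hit₄.runs (by
    rw [Cond.Holds, h₄.r2, h₄.fixed.r11, h₄.rep.tag _ _ hend]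
    simp)
  have hlen : R.length = k + (cutRecords ν θ.cuts).length + 1 := by
    rw [hRd, records_eq, List.length_append, List.length_append, List.length_singleton]
  refine ⟨_, _, Λ', .seq (.const _ _ _) (.seq (.const _ _ _) (.seq (.const _ _ _) (.seq hrun₁ (.seq hrun₂
    (.seq (.plus _ _ _ _) (.seq hrun₄ (.store _ _ _))))))), ?_, hred, ?_⟩
  · have hRT : R = conclRecords ν θ.concl ++ r :: T := by
      rw [hRd, records_eq, List.append_assoc, hrT]
    refine output_of_rep ν (D := D) (hred.isUnet hθ).isSigLinking (hRT ▸ h₄.rep) (r₀ := r) ?_ ?_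
    · rcases hr with rfl | rfl <;> rfl
    · simp [Ram.setMem, h₄.fixed.r9, h₄.fixed.r11, hk]
  · omega

/-- The empty cut sequent has balance 0 instead of 2. A positive size is needed to absorb the
additive constant of the running time. -/
theorem Net.IsUnet.size_pos {θ : Net L} (hθ : θ.IsUnet D) : 0 < θ.size := by
  obtain ⟨Γ, cs, Λ⟩ := θ
  have h := hθ.balance
  rw [balance_encode] at h
  rcases Γ with _ | ⟨A, Γ⟩
  · rcases cs with _ | ⟨c, cs⟩
    · simp at h
    · have := c.1.size_pos
      simp only [Net.size, List.map_cons, List.sum_cons]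
      omega
  · have := A.size_pos
    simp only [Net.size, List.map_cons, List.sum_cons]
    omega

end UnificationNet

theorem mainTheorem5 :
    ∃ (p : Prog) (C : ℕ),
      ∀ (L : FirstOrder.Language.{u, v}) (D : Duality L) (θ : Net L), θ.IsUnet D →
        (∀ (k : ℕ) (s : ℕ → Net L), s 0 = θ → (∀ i < k, Step D (s i) (s (i + 1))) →
          k ≤ θ.size) ∧
        (∀ θ₁ θ₂ : Net L, Reduces D θ θ₁ → Reduces D θ θ₂ →
          ∃ θ₃ : Net L, Reduces D θ₁ θ₃ ∧ Reduces D θ₂ θ₃) ∧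
        ∃ θ' : Net L, Reduces D θ θ' ∧ θ'.CutFree ∧ θ'.IsUnet D ∧
          ∀ ν : Numbering L, ∃ (t : ℕ) (m : Ram),
            Runs p (Ram.init (θ.word ν)) t m ∧ m.Output (θ'.word ν) ∧ t ≤ C * θ.size := by
  -- There are at most `2 * θ.size + 1` records, at 17 units each, and 20 further units: 34 times
  -- the size plus 37, hence at most 71 times the positive size.
  refine ⟨cutElimProg, 71, fun L D θ hθ => ⟨fun k s h0 h => h0 ▸ step_count_le h,
    fun _ _ h₁ h₂ => hθ.confluent h₁ h₂, ?_⟩⟩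
  obtain ⟨θ', hr, hc⟩ := hθ.exists_cutFree
  refine ⟨θ', hr, hc, hr.isUnet hθ, fun ν => ?_⟩
  obtain ⟨t, m, Λ', hrun, hm, hr', ht⟩ := runs_cutElimProg hθ ν
  -- The run yields some cut-free reduct for each numbering; uniqueness identifies it with the `θ'`
  -- fixed before the numbering.
  rw [hθ.cutFree_unique hr' hr rfl hc] at hm
  have h₁ := length_net_records ν θ
  have h₂ := hθ.size_pos
  exact ⟨t, m, hrun, hm, by omega⟩
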